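/- For integers $n, m \ge 0$ let $p(n,m)$ be the number of (unordered) partitions of $n$ into exactly $m$ positive integer summands, and for $k \ge 1$ let $$t_k(n) = \sum_{m \ge 0} m^k\, p(n,m).$$ For $k \ge 1$ and real numbers $x_1,\dots,x_k$ write $$\Sigma(x_1,\dots,x_k) = \sum \frac{k!}{b_1!\,b_2!\cdots b_k!}\left(\frac{x_1}{1!}\right)^{b_1}\left(\frac{x_2}{2!}\right)^{b_2}\cdots\left(\frac{x_k}{k!}\right)^{b_k},$$ where the sum is over all $(b_1,\dots,b_k)$ of nonnegative integers with $b_1 + 2b_2 + \cdots + k b_k = k$. Let $\gamma$ be the Euler–Mascheroni constant and $\zeta$ the Riemann zeta function. Then, as $n \to \infty$, $$t_1(n) = \frac{\sqrt2}{4\pi\sqrt n}\, e^{\pi\sqrt{2n/3}}\left(\gamma + \log\frac{\sqrt{6n}}{\pi}\right)\left[1 + O(n^{-1/2})\right],$$ and for every integer $k \ge 2$, $$t_k(n) = \frac{1}{4\sqrt3\, n}\, e^{\pi\sqrt{2n/3}}\left(\frac{\sqrt{6n}}{\pi}\right)^{k} \Sigma\left(\gamma + \log\frac{\sqrt{6n}}{\pi},\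 \zeta(2),\ 2\zeta(3),\ \dots,\ (k-1)!\,\zeta(k)\right)\left[1 + O(n^{-1/2})\right],$$ where the constant implied by $O$ may depend on $k$. -/

import Mathlib

open Filter Asymptotics

namespace PartitionMoments

/-- The number `p(n, m)` of partitions of `n` into exactly `m` positive integer summands. -/
def partitionCount (n m : ℕ) : ℕ :=
  (Finset.univ.filter fun P : n.Partition => Multiset.card P.parts = m).card

/-- The `k`-th moment `t_k(n) = ∑_m m ^ k * p(n, m)`. The sum may stop at `m = n`, because
`p(n, m) = 0` for `m > n`. -/
def moment (k n : ℕ) : ℕ :=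
  ∑ m ∈ Finset.range (n + 1), m ^ k * partitionCount n m

/-- The solutions `(b_1, …, b_k)` in nonnegative integers of `b_1 + 2 b_2 + ⋯ + k b_k = k`;
the entry `b_{i+1}` is `b i` for `i : Fin k`. Each solution has all entries at most `k`. -/
def solutions (k : ℕ) : Finset (Fin k → ℕ) :=
  (Fintype.piFinset fun _ : Fin k => Finset.range (k + 1)).filter
    fun b => ∑ i : Fin k, ((i : ℕ) + 1) * b i = k

/-- The sum `Σ(x_1, …, x_k)` of
`k! / (b_1! ⋯ b_k!) * (x_1 / 1!) ^ b_1 * ⋯ * (x_k / k!) ^ b_k`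
over all solutions of `b_1 + 2 b_2 + ⋯ + k b_k = k`; the entry `x_{i+1}` is `x i`. -/
noncomputable def bellSum (k : ℕ) (x : Fin k → ℝ) : ℝ :=
  ∑ b ∈ solutions k,
    ((k.factorial : ℝ) / ∏ i : Fin k, ((b i).factorial : ℝ)) *
      ∏ i : Fin k, (x i / (((i : ℕ) + 1).factorial : ℝ)) ^ b i

/-- The arguments `(γ + log (√(6n) / π), ζ(2), 2 ζ(3), …, (k - 1)! ζ(k))`. The zeta values are
real, so taking real parts only moves them from `ℂ` to `ℝ`. -/
noncomputable def zetaArgs (k n : ℕ) (i : Fin k) : ℝ :=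
  if (i : ℕ) = 0 then
    Real.eulerMascheroniConstant + Real.log (Real.sqrt (6 * (n : ℝ)) / Real.pi)
  else ((i : ℕ).factorial : ℝ) * (riemannZeta (((i : ℕ) + 1 : ℕ) : ℂ)).re

/-- `f(n) = g(n) [1 + O(n^{-1/2})]` as `n → ∞`. -/
def EqOneAddBigO (f g : ℕ → ℝ) : Prop :=
  ∃ E : ℕ → ℝ, (E =O[atTop] fun n : ℕ => (n : ℝ) ^ (-(1 / 2) : ℝ)) ∧
    ∀ᶠ n : ℕ in atTop, f n = g n * (1 + E n)

end PartitionMoments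

open Filter Asymptotics

namespace PartitionMoments

/-! The number of parts of a partition equals the number of pairs (j, m), with j, m ≥ 1, such that
the part j occurs at least m times. Deleting those m copies of j leaves a partition of n - jm with m
fewer parts, so one factor of the moment can be traded for a sum over jm = N. Expanding binomially
gives t_{k+1} = ∑_i C(k,i) σ_i * t_{k-i}, a convolution in n (`moment_succ`). This is the recursion
of the complete Bell polynomials, so the generating function of t_k is that of p(n) times the k-th
Bell polynomial B_k of the Lambert series ∑ σ_i(n) X^n (`momentSeries_eq`). Thus t_k(n) = ∑_m
[X^m]B_k · p(n - m), and the coefficients of B_k are nonnegative.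

Put t = π/√(6n), and let a(n) be the Hardy–Ramanujan main term. Uniformly in m, p(n - m) = a(n)
e^{-tm} + O(t a(n) e^{-tm/2}), with p read as 0 at negative arguments
(`abs_card_partition_shift_sub_le`). Summing against the nonnegative coefficients yields t_k(n) =
a(n) [B_k(e^{-t}) + O(t B_k(e^{-t/2}))] (`abs_moment_sub_bellValue_le`).

As t → 0 the Lambert series satisfy t L_0(t) = γ - log t + O(t) and t^{i+1} L_i(t) = i! ζ(i+1) +
O(t) for i ≥ 1 (`abs_lambert_sub_zetaArg_le`). The Bell recursion carries this to t^k B_k(e^{-t})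
with relative error O(t) (`abs_bellValue_sub_le`), and passing from t to t/2 costs only a constant.
Since -log t = log(√(6n)/π) and t is of order n^{-1/2}, the theorem follows; for k = 1 the prefactor
simplifies.

The Hardy–Ramanujan formula with its error term is proved by the saddle point method: Cauchy's
integral on the circle of radius e^{-t}, the modular transformation of η near the real axis
(`partitionGenFun_exp_neg`), and an elementary product bound elsewhere (`norm_partitionGenFun_le`).
-/

/-! ### Combinatorial recursion for the moments -/

lemma moment_eq_sum_partition (k n : ℕ) :
    moment k n = ∑ P : n.Partition, (Multiset.card P.parts) ^ k := by
  classical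
  have hle : ∀ P : n.Partition, Multiset.card P.parts ≤ n := fun P => by
    have := Multiset.card_nsmul_le_sum (s := P.parts) (a := 1) (fun i hi => P.parts_pos hi)
    simpa [P.parts_sum] using this
  unfold moment partitionCount
  rw [← Finset.sum_fiberwise_of_maps_to (t := Finset.range (n + 1))
    (g := fun P : n.Partition => Multiset.card P.parts)
    (fun P _ => Finset.mem_range.2 (Nat.lt_succ_of_le (hle P)))]
  refine Finset.sum_congr rfl fun m _ => ?_
  rw [Finset.sum_congr rfl (g := fun _ => m ^ k)]
  · simp [mul_comm]
  · intro P hP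
    rw [(Finset.mem_filter.1 hP).2]

/-- Removing `m` copies of the part `j` from the partitions of `j * m + r` that contain them. -/
lemma sum_partition_count_ge {j m r n : ℕ} (hj : 0 < j) (h : j * m + r = n) (g : ℕ → ℕ) :
    ∑ P : n.Partition with m ≤ P.parts.count j, g (Multiset.card P.parts) =
      ∑ P : r.Partition, g (Multiset.card P.parts + m) := by
  classical
  refine Finset.sum_bij'
    (i := fun P hP => (⟨P.parts - Multiset.replicate m j,
      fun hi => P.parts_pos (Multiset.mem_of_le (Multiset.sub_le_self _ _) hi), ?_⟩ : r.Partition))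
    (j := fun P _ => (⟨P.parts + Multiset.replicate m j, ?_, ?_⟩ : n.Partition)) ?_ ?_ ?_ ?_ ?_
  · have hle : Multiset.replicate m j ≤ P.parts :=
      Multiset.le_count_iff_replicate_le.1 (Finset.mem_filter.1 hP).2
    have := congrArg Multiset.sum (Multiset.sub_add_cancel hle)
    rw [Multiset.sum_add, P.parts_sum, Multiset.sum_replicate, smul_eq_mul] at this
    have hc := mul_comm m j
    omega
  · intro i hi
    rcases Multiset.mem_add.1 hi with hi | hi
    · exact P.parts_pos hi
    · rw [Multiset.eq_of_mem_replicate hi]; exact hj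
  · rw [Multiset.sum_add, P.parts_sum, Multiset.sum_replicate, smul_eq_mul, ← h]; ring
  · intro P hP; simp
  · intro P hP; simp
  · intro P hP
    have hle : Multiset.replicate m j ≤ P.parts :=
      Multiset.le_count_iff_replicate_le.1 (Finset.mem_filter.1 hP).2
    ext1
    exact Multiset.sub_add_cancel hle
  · intro P hP
    ext1
    exact Multiset.add_sub_cancel_right
  · intro P hP
    have hle : Multiset.replicate m j ≤ P.parts :=
      Multiset.le_count_iff_replicate_le.1 (Finset.mem_filter.1 hP).2
    have := congrArg Multiset.card (Multiset.sub_add_cancel hle)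
    rw [Multiset.card_add, Multiset.card_replicate] at this
    simp only [this]

lemma card_parts_eq_sum {n : ℕ} (P : n.Partition) :
    Multiset.card P.parts =
      ∑ x ∈ Finset.Icc 1 n ×ˢ Finset.Icc 1 n, if x.2 ≤ P.parts.count x.1 then 1 else 0 := by
  classical
  rw [Finset.sum_product]
  have hc : ∀ j, P.parts.count j ≤ n := fun j => by
    have h1 := Multiset.card_nsmul_le_sum (s := P.parts) (a := 1) (fun i hi => P.parts_pos hi)
    have h2 := Multiset.count_le_card j P.parts
    rw [P.parts_sum] at h1
    simp at h1
    omega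
  have : ∀ j ∈ Finset.Icc 1 n,
      (∑ m ∈ Finset.Icc 1 n, if m ≤ P.parts.count j then 1 else 0) = P.parts.count j := by
    intro j _
    rw [← Finset.card_filter]
    have : (Finset.Icc 1 n).filter (fun m => m ≤ P.parts.count j) =
        Finset.Icc 1 (P.parts.count j) := by
      ext m
      have := hc j
      simp only [Finset.mem_filter, Finset.mem_Icc]
      omega
    rw [this]; simp
  rw [Finset.sum_congr rfl this]
  refine (Multiset.sum_count_eq_card fun a ha => ?_).symm
  exact Finset.mem_Icc.2 ⟨P.parts_pos ha, Nat.Partition.le_of_mem_parts ha⟩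

/-- The factor `card` is expanded over pairs (part size j, threshold m), and for each pair m copies
of j are removed. Collecting the pairs by N = j * m makes m run over the divisors of N. -/
lemma sum_card_mul (n : ℕ) (g : ℕ → ℕ) :
    ∑ P : n.Partition, Multiset.card P.parts * g (Multiset.card P.parts) =
      ∑ x ∈ Finset.HasAntidiagonal.antidiagonal n, ∑ d ∈ x.1.divisors,
        ∑ P : x.2.Partition, g (Multiset.card P.parts + d) := by
  classical
  have h1 : ∑ P : n.Partition, Multiset.card P.parts * g (Multiset.card P.parts) =
      ∑ x ∈ Finset.Icc 1 n ×ˢ Finset.Icc 1 n,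
        ∑ P : n.Partition with x.2 ≤ P.parts.count x.1, g (Multiset.card P.parts) := by
    simp_rw [Finset.sum_filter]
    rw [Finset.sum_comm]
    refine Finset.sum_congr rfl fun P _ => ?_
    conv_lhs => rw [card_parts_eq_sum P, Finset.sum_mul]
    refine Finset.sum_congr rfl fun x _ => ?_
    rw [card_parts_eq_sum P]
    split_ifs <;> simp
  -- A partition of n containing m copies of j forces j * m ≤ n, so the pairs outside this range
  -- contribute nothing and may be dropped before reindexing.
  have h2 : ∀ x ∈ Finset.Icc 1 n ×ˢ Finset.Icc 1 n,
      ∑ P : n.Partition with x.2 ≤ P.parts.count x.1, g (Multiset.card P.parts) ≠ 0 →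
        x.1 * x.2 ≤ n := by
    intro x _ hne
    obtain ⟨P, hP, _⟩ := Finset.exists_ne_zero_of_sum_ne_zero hne
    have hle : Multiset.replicate x.2 x.1 ≤ P.parts :=
      Multiset.le_count_iff_replicate_le.1 (Finset.mem_filter.1 hP).2
    have := congrArg Multiset.sum (Multiset.sub_add_cancel hle)
    rw [Multiset.sum_add, P.parts_sum, Multiset.sum_replicate, smul_eq_mul] at this
    rw [mul_comm]; omega
  rw [h1, ← Finset.sum_filter_of_ne h2,
    Finset.sum_sigma' (Finset.HasAntidiagonal.antidiagonal n) fun x => x.1.divisors]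
  -- The marked divisor is the multiplicity m; the part size is recovered as the quotient N / m. The
  -- pair with N = 0 is harmless because `Nat.divisors 0` is empty.
  refine Finset.sum_bij' (i := fun x _ => ⟨(x.1 * x.2, n - x.1 * x.2), x.2⟩)
    (j := fun y _ => (y.1.1 / y.2, y.2)) ?_ ?_ ?_ ?_ ?_
  · rintro ⟨j, m⟩ hx
    simp only [Finset.mem_filter, Finset.mem_product, Finset.mem_Icc] at hx
    simp only [Finset.mem_sigma, Finset.HasAntidiagonal.mem_antidiagonal, Nat.mem_divisors]
    refine ⟨by omega, Dvd.intro_left _ rfl, ?_⟩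
    exact (Nat.mul_pos (by omega) (by omega)).ne'
  · rintro ⟨⟨N, r⟩, d⟩ hy
    simp only [Finset.mem_sigma, Finset.HasAntidiagonal.mem_antidiagonal, Nat.mem_divisors] at hy
    obtain ⟨hNr, ⟨e, rfl⟩, h0⟩ := hy
    have hd : 0 < d := Nat.pos_of_ne_zero fun h => h0 (by simp [h])
    have he : 0 < e := Nat.pos_of_ne_zero fun h => h0 (by simp [h])
    simp only [Finset.mem_filter, Finset.mem_product, Finset.mem_Icc, Nat.mul_div_cancel_left _ hd]
    have := Nat.le_mul_of_pos_left e hd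
    have := Nat.le_mul_of_pos_right d he
    have := mul_comm e d
    omega
  · rintro ⟨j, m⟩ hx
    simp only [Finset.mem_filter, Finset.mem_product, Finset.mem_Icc] at hx
    simp only [Nat.mul_div_cancel _ (show 0 < m by omega)]
  · rintro ⟨⟨N, r⟩, d⟩ hy
    simp only [Finset.mem_sigma, Finset.HasAntidiagonal.mem_antidiagonal, Nat.mem_divisors] at hy
    simp only [Nat.div_mul_cancel hy.2.1]
    obtain rfl : r = n - N := by omega
    rfl
  · rintro ⟨j, m⟩ hx
    simp only [Finset.mem_filter, Finset.mem_product, Finset.mem_Icc] at hx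
    exact sum_partition_count_ge (by omega) (by simp only; omega) g

lemma moment_succ (k n : ℕ) :
    moment (k + 1) n = ∑ x ∈ Finset.HasAntidiagonal.antidiagonal n, ∑ i ∈ Finset.range (k + 1),
      k.choose i * (ArithmeticFunction.sigma i x.1 * moment (k - i) x.2) := by
  rw [moment_eq_sum_partition]
  have h1 : ∀ P : n.Partition, (Multiset.card P.parts) ^ (k + 1) =
      Multiset.card P.parts * (fun c => c ^ k) (Multiset.card P.parts) := fun P => by
    simp only; ring
  rw [Finset.sum_congr rfl fun P _ => h1 P, sum_card_mul n fun c => c ^ k]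
  refine Finset.sum_congr rfl fun x _ => ?_
  simp_rw [moment_eq_sum_partition, ArithmeticFunction.sigma_apply, Finset.sum_mul, Finset.mul_sum]
  rw [Finset.sum_comm (s := Finset.range (k + 1))]
  refine Finset.sum_congr rfl fun d _ => ?_
  rw [Finset.sum_comm (s := Finset.range (k + 1))]
  refine Finset.sum_congr rfl fun P _ => ?_
  rw [add_comm, add_pow]
  refine Finset.sum_congr rfl fun i _ => ?_
  simp only [Nat.cast_id]
  ring


/-! ### Generating functions and the Bell recursion -/

/-- The Lambert series `∑ σ_i(n) X ^ n`. -/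
noncomputable def sigmaSeries (i : ℕ) : PowerSeries ℝ :=
  PowerSeries.mk fun n => (ArithmeticFunction.sigma i n : ℝ)

/-- The generating function of the `k`-th moments. -/
noncomputable def momentSeries (k : ℕ) : PowerSeries ℝ :=
  PowerSeries.mk fun n => (moment k n : ℝ)

/-- The complete Bell polynomials of the Lambert series. -/
noncomputable def bellSeries : ℕ → PowerSeries ℝ
  | 0 => 1
  | k + 1 => ∑ i : Fin (k + 1), (k.choose i : PowerSeries ℝ) * (sigmaSeries i * bellSeries (k - i))
decreasing_by omega

lemma bellSeries_succ (k : ℕ) : bellSeries (k + 1) =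
    ∑ i ∈ Finset.range (k + 1),
      (k.choose i : PowerSeries ℝ) * (sigmaSeries i * bellSeries (k - i)) := by
  rw [bellSeries, Finset.sum_range]

lemma momentSeries_succ (k : ℕ) : momentSeries (k + 1) =
    ∑ i ∈ Finset.range (k + 1),
      (k.choose i : PowerSeries ℝ) * (sigmaSeries i * momentSeries (k - i)) := by
  ext n
  simp only [momentSeries, sigmaSeries, map_sum, PowerSeries.coeff_mk, moment_succ]
  push_cast
  rw [Finset.sum_comm]
  refine Finset.sum_congr rfl fun i _ => ?_
  rw [← map_natCast (PowerSeries.C (R := ℝ)), PowerSeries.coeff_C_mul, PowerSeries.coeff_mul,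
    Finset.mul_sum]
  simp

/-- Both sides satisfy the same linear recursion in k, with the same value at k = 0. -/
lemma momentSeries_eq (k : ℕ) : momentSeries k = bellSeries k * momentSeries 0 := by
  induction k using Nat.strong_induction_on with
  | _ k ih =>
    cases k with
    | zero => simp [bellSeries]
    | succ k =>
      rw [momentSeries_succ, bellSeries_succ, Finset.sum_mul]
      refine Finset.sum_congr rfl fun i _ => ?_
      rw [ih (k - i) (by omega)]
      ring

/-- Positivity is what allows a termwise bound on p(n - m) to be summed against these coefficients
without loss. -/
lemma coeff_bellSeries_nonneg (k n : ℕ) : 0 ≤ PowerSeries.coeff n (bellSeries k) := by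
  induction k using Nat.strong_induction_on generalizing n with
  | _ k ih =>
    cases k with
    | zero =>
      rw [bellSeries, PowerSeries.coeff_one]
      split_ifs <;> norm_num
    | succ k =>
      rw [bellSeries_succ, map_sum]
      refine Finset.sum_nonneg fun i _ => ?_
      rw [← map_natCast (PowerSeries.C (R := ℝ)), PowerSeries.coeff_C_mul, PowerSeries.coeff_mul]
      refine mul_nonneg (Nat.cast_nonneg _) (Finset.sum_nonneg fun x _ => mul_nonneg ?_ ?_)
      · simp [sigmaSeries]
      · exact ih _ (by omega) _

lemma moment_zero (n : ℕ) : moment 0 n = Fintype.card n.Partition := by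
  simp [moment_eq_sum_partition]

lemma moment_eq_sum_bellSeries (k n : ℕ) : (moment k n : ℝ) =
    ∑ m ∈ Finset.range (n + 1),
      PowerSeries.coeff m (bellSeries k) * (Fintype.card (n - m).Partition : ℝ) := by
  have := congrArg (PowerSeries.coeff n) (momentSeries_eq k)
  rw [PowerSeries.coeff_mul, Finset.Nat.sum_antidiagonal_eq_sum_range_succ_mk] at this
  simpa [momentSeries, moment_zero] using this

/-! ### Evaluating products of absolutely convergent power series -/

section Evaluation

variable {𝕜 : Type*} [NormedField 𝕜]

/-- The power series `f` converges absolutely at `x`, with sum `v`. -/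
def AbsHasSum (f : PowerSeries 𝕜) (x v : 𝕜) : Prop :=
  (Summable fun n => ‖PowerSeries.coeff n f * x ^ n‖) ∧
    HasSum (fun n => PowerSeries.coeff n f * x ^ n) v

lemma absHasSum_C (a x : 𝕜) : AbsHasSum (PowerSeries.C a) x a := by
  have h : ∀ n, n ≠ 0 → PowerSeries.coeff n (PowerSeries.C a) * x ^ n = 0 := fun n hn => by
    simp [PowerSeries.coeff_C, hn]
  refine ⟨summable_of_ne_finset_zero (s := {0}) fun n hn => ?_, ?_⟩
  · rw [h n (by simpa using hn), norm_zero]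
  · simpa [PowerSeries.coeff_C] using hasSum_single 0 h

lemma AbsHasSum.add {f g : PowerSeries 𝕜} {x v w : 𝕜} (hf : AbsHasSum f x v)
    (hg : AbsHasSum g x w) : AbsHasSum (f + g) x (v + w) := by
  have h : ∀ n, PowerSeries.coeff n (f + g) * x ^ n =
      PowerSeries.coeff n f * x ^ n + PowerSeries.coeff n g * x ^ n := fun n => by
    rw [map_add, add_mul]
  refine ⟨(hf.1.add hg.1).of_nonneg_of_le (fun _ => norm_nonneg _) fun n => ?_, ?_⟩
  · rw [h]; exact norm_add_le _ _
  · simp_rw [h]; exact hf.2.add hg.2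

lemma absHasSum_sum {ι : Type*} (s : Finset ι) {f : ι → PowerSeries 𝕜} {x : 𝕜} {v : ι → 𝕜}
    (h : ∀ i ∈ s, AbsHasSum (f i) x (v i)) : AbsHasSum (∑ i ∈ s, f i) x (∑ i ∈ s, v i) := by
  classical
  induction s using Finset.induction_on with
  | empty => simpa using absHasSum_C (0 : 𝕜) x
  | insert a s ha ih =>
    rw [Finset.sum_insert ha, Finset.sum_insert ha]
    exact (h a (Finset.mem_insert_self a s)).add
      (ih fun i hi => h i (Finset.mem_insert_of_mem hi))

lemma AbsHasSum.mul [CompleteSpace 𝕜] {f g : PowerSeries 𝕜} {x v w : 𝕜} (hf : AbsHasSum f x v)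
    (hg : AbsHasSum g x w) : AbsHasSum (f * g) x (v * w) := by
  have h : ∀ n, PowerSeries.coeff n (f * g) * x ^ n =
      ∑ kl ∈ Finset.HasAntidiagonal.antidiagonal n,
        (PowerSeries.coeff kl.1 f * x ^ kl.1) * (PowerSeries.coeff kl.2 g * x ^ kl.2) := fun n => by
    rw [PowerSeries.coeff_mul, Finset.sum_mul]
    refine Finset.sum_congr rfl fun kl hkl => ?_
    rw [← Finset.HasAntidiagonal.mem_antidiagonal.1 hkl, pow_add]
    ring
  have hs := summable_norm_sum_mul_antidiagonal_of_summable_norm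
    (f := fun n => PowerSeries.coeff n f * x ^ n) (g := fun n => PowerSeries.coeff n g * x ^ n)
    hf.1 hg.1
  have ht := tsum_mul_tsum_eq_tsum_sum_antidiagonal_of_summable_norm
    (f := fun n => PowerSeries.coeff n f * x ^ n) (g := fun n => PowerSeries.coeff n g * x ^ n)
    hf.1 hg.1
  rw [hf.2.tsum_eq, hg.2.tsum_eq] at ht
  unfold AbsHasSum
  simp only [h]
  rw [ht]
  exact ⟨hs, hs.of_norm.hasSum⟩

lemma absHasSum_prod [CompleteSpace 𝕜] {ι : Type*} (s : Finset ι) {f : ι → PowerSeries 𝕜} {x : 𝕜} {v : ι → 𝕜}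
    (h : ∀ i ∈ s, AbsHasSum (f i) x (v i)) : AbsHasSum (∏ i ∈ s, f i) x (∏ i ∈ s, v i) := by
  classical
  induction s using Finset.induction_on with
  | empty => simpa using absHasSum_C (1 : 𝕜) x
  | insert a s ha ih =>
    rw [Finset.prod_insert ha, Finset.prod_insert ha]
    exact (h a (Finset.mem_insert_self a s)).mul
      (ih fun i hi => h i (Finset.mem_insert_of_mem hi))

end Evaluation

/-! ### Lambert series and Bell series at e^{-t} -/

/-- The Lambert series `∑ σ_i(n) e ^ (-n t)`. -/
noncomputable def lambert (i : ℕ) (t : ℝ) : ℝ :=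
  ∑' n : ℕ, (ArithmeticFunction.sigma i n : ℝ) * Real.exp (-t) ^ n

lemma exp_neg_lt_one {t : ℝ} (ht : 0 < t) : Real.exp (-t) < 1 := by
  rw [Real.exp_lt_one_iff]; linarith

lemma norm_exp_neg_lt_one {t : ℝ} (ht : 0 < t) : ‖Real.exp (-t)‖ < 1 := by
  rw [Real.norm_eq_abs, abs_of_pos (Real.exp_pos _)]; exact exp_neg_lt_one ht

lemma summable_sigma_mul (i : ℕ) {t : ℝ} (ht : 0 < t) :
    Summable fun n : ℕ => (ArithmeticFunction.sigma i n : ℝ) * Real.exp (-t) ^ n := by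
  refine (summable_pow_mul_geometric_of_norm_lt_one (i + 1)
    (norm_exp_neg_lt_one ht)).of_nonneg_of_le (fun n => by positivity) fun n => ?_
  gcongr
  exact_mod_cast ArithmeticFunction.sigma_le_pow_succ i n

lemma absHasSum_sigmaSeries (i : ℕ) {t : ℝ} (ht : 0 < t) :
    AbsHasSum (sigmaSeries i) (Real.exp (-t)) (lambert i t) := by
  have h := summable_sigma_mul i ht
  constructor
  · simpa [sigmaSeries] using h
  · simp only [sigmaSeries, PowerSeries.coeff_mk]
    exact h.hasSum

/-- The value of the Bell series at `e ^ (-t)`. -/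
noncomputable def bellValue (k : ℕ) (t : ℝ) : ℝ :=
  ∑' n : ℕ, PowerSeries.coeff n (bellSeries k) * Real.exp (-t) ^ n

lemma absHasSum_bellSeries (k : ℕ) {t : ℝ} (ht : 0 < t) :
    AbsHasSum (bellSeries k) (Real.exp (-t)) (bellValue k t) := by
  induction k using Nat.strong_induction_on with
  | _ k ih =>
    suffices ∃ v, AbsHasSum (bellSeries k) (Real.exp (-t)) v by
      obtain ⟨v, hv⟩ := this
      rwa [bellValue, hv.2.tsum_eq]
    cases k with
    | zero => exact ⟨1, by simpa [bellSeries] using absHasSum_C (1 : ℝ) (Real.exp (-t))⟩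
    | succ k =>
      rw [bellSeries_succ]
      refine ⟨∑ i ∈ Finset.range (k + 1), (k.choose i : ℝ) * (lambert i t * bellValue (k - i) t),
        absHasSum_sum _ fun i _ => ?_⟩
      rw [← map_natCast (PowerSeries.C (R := ℝ))]
      exact (absHasSum_C _ _).mul ((absHasSum_sigmaSeries i ht).mul (ih _ (by omega)))

lemma bellValue_zero (t : ℝ) : bellValue 0 t = 1 := by
  simpa only [bellValue, bellSeries, map_one] using
    (absHasSum_C (1 : ℝ) (Real.exp (-t))).2.tsum_eq

lemma bellValue_succ (k : ℕ) {t : ℝ} (ht : 0 < t) : bellValue (k + 1) t =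
    ∑ i ∈ Finset.range (k + 1), (k.choose i : ℝ) * (lambert i t * bellValue (k - i) t) := by
  refine (absHasSum_bellSeries (k + 1) ht).2.unique ?_
  rw [bellSeries_succ]
  refine (absHasSum_sum _ fun i _ => ?_).2
  rw [← map_natCast (PowerSeries.C (R := ℝ))]
  exact (absHasSum_C _ _).mul ((absHasSum_sigmaSeries i ht).mul (absHasSum_bellSeries _ ht))

/-! ### The power sums ∑ m^i e^{-ms} for small s -/

/-- The power sums `∑_{m ≥ 1} m ^ i e ^ (-m s)`. -/
noncomputable def powerExpSum (i : ℕ) (s : ℝ) : ℝ :=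
  ∑' m : ℕ, ((m : ℝ) + 1) ^ i * Real.exp (-s) ^ (m + 1)

lemma summable_powerExpSum (i : ℕ) {s : ℝ} (hs : 0 < s) :
    Summable fun m : ℕ => ((m : ℝ) + 1) ^ i * Real.exp (-s) ^ (m + 1) := by
  have := (summable_nat_add_iff 1).2
    (summable_pow_mul_geometric_of_norm_lt_one (R := ℝ) i (norm_exp_neg_lt_one hs))
  simpa using this

lemma powerExpSum_nonneg (i : ℕ) (s : ℝ) : 0 ≤ powerExpSum i s :=
  tsum_nonneg fun m => by positivity

/-- Writing n = dc and summing c^i first splits the Lambert series into power sums at the points t,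
2t, 3t, … -/
lemma hasSum_lambert (i : ℕ) {t : ℝ} (ht : 0 < t) :
    HasSum (fun j : ℕ => powerExpSum i (((j : ℝ) + 1) * t)) (lambert i t) := by
  have hr := norm_exp_neg_lt_one ht
  have hin : ∀ d : ℕ+, (∑' c : ℕ+, (c : ℝ) ^ i * Real.exp (-t) ^ (d * c : ℕ)) =
      powerExpSum i ((d : ℝ) * t) := fun d => by
    rw [tsum_pnat_eq_tsum_succ (f := fun c : ℕ => (c : ℝ) ^ i * Real.exp (-t) ^ (d * c : ℕ))]
    refine tsum_congr fun m => ?_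
    rw [pow_mul, ← Real.exp_nat_mul]
    push_cast
    ring_nf
  have hS := (summable_prod_mul_pow (𝕜 := ℝ) i hr).prod
  simp only [hin] at hS
  have hT := tsum_prod_pow_eq_tsum_sigma (𝕜 := ℝ) i hr
  simp only [hin] at hT
  have hσ : ∑' e : ℕ+, (ArithmeticFunction.sigma i (e : ℕ) : ℝ) * Real.exp (-t) ^ (e : ℕ) =
      lambert i t := by
    have := tsum_zero_pnat_eq_tsum_nat (summable_sigma_mul i ht)
    simpa [lambert] using this
  rw [hσ] at hT
  have h1 := (hS.hasSum_iff.2 hT)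
  rw [← Equiv.pnatEquivNat.symm.hasSum_iff] at h1
  simpa [Function.comp_def] using h1

lemma exp_neg_div_one_sub {s : ℝ} (hs : 0 < s) :
    Real.exp (-s) / (1 - Real.exp (-s)) = 1 / (Real.exp s - 1) := by
  have h1 : 0 < 1 - Real.exp (-s) := by linarith [exp_neg_lt_one hs]
  have h2 : 0 < Real.exp s - 1 := by linarith [Real.one_lt_exp_iff.2 hs]
  rw [div_eq_div_iff h1.ne' h2.ne']
  have : Real.exp (-s) * Real.exp s = 1 := by rw [← Real.exp_add]; simp
  linarith

lemma powerExpSum_zero {s : ℝ} (hs : 0 < s) : powerExpSum 0 s = 1 / (Real.exp s - 1) := by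
  rw [← exp_neg_div_one_sub hs, powerExpSum]
  simp only [pow_zero, one_mul, pow_succ']
  rw [tsum_mul_left, tsum_geometric_of_norm_lt_one (norm_exp_neg_lt_one hs)]
  rfl

lemma powerExpSum_one {s : ℝ} (hs : 0 < s) :
    powerExpSum 1 s = Real.exp (-s) / (1 - Real.exp (-s)) ^ 2 := by
  have := tsum_coe_mul_geometric_of_norm_lt_one (norm_exp_neg_lt_one hs)
  rw [← this, (hasSum_coe_mul_geometric_of_norm_lt_one
    (norm_exp_neg_lt_one hs)).summable.tsum_eq_zero_add]
  simp [powerExpSum]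

/-- Summation by parts: multiplying by 1 - e^{-s} differences the coefficients. As (m+1)^{i+1} -
m^{i+1} lies between (i+1) m^i and (i+1)(m+1)^i, the sum of exponent i + 1 is controlled from both
sides by that of exponent i. -/
lemma one_sub_mul_powerExpSum_succ (i : ℕ) {s : ℝ} (hs : 0 < s) :
    HasSum (fun m : ℕ => (((m : ℝ) + 1) ^ (i + 1) - (m : ℝ) ^ (i + 1)) * Real.exp (-s) ^ (m + 1))
      ((1 - Real.exp (-s)) * powerExpSum (i + 1) s) := by
  have h1 := (summable_powerExpSum (i + 1) hs).hasSum
  have h2 : HasSum (fun m : ℕ => (m : ℝ) ^ (i + 1) * Real.exp (-s) ^ (m + 1))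
      (Real.exp (-s) * powerExpSum (i + 1) s) := by
    have h3 := h1.mul_left (Real.exp (-s))
    rw [← hasSum_nat_add_iff' 1]
    simp only [Finset.sum_range_one, Nat.cast_zero, zero_pow (Nat.succ_ne_zero i), zero_mul,
      sub_zero]
    convert! h3 using 2 with m
    push_cast
    ring
  convert! h1.sub h2 using 1
  · funext m; ring
  · rw [sub_mul, one_mul]; rfl

lemma add_mul_pow_le_add_one_pow {x : ℝ} (hx : 0 ≤ x) (i : ℕ) :
    x ^ (i + 1) + (i + 1) * x ^ i ≤ (x + 1) ^ (i + 1) := by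
  induction i with
  | zero => simp
  | succ i ih =>
    have h1 : 0 ≤ (x + 1) ^ (i + 1) - (x ^ (i + 1) + (i + 1) * x ^ i) := by linarith
    have h2 : 0 ≤ x ^ i := pow_nonneg hx i
    have h3 : (x + 1) ^ (i + 1 + 1) - (x ^ (i + 1 + 1) + ((i + 1 : ℕ) + 1) * x ^ (i + 1)) =
        (x + 1) * ((x + 1) ^ (i + 1) - (x ^ (i + 1) + (i + 1) * x ^ i)) + (i + 1) * x ^ i := by
      push_cast; ring
    have h4 : 0 ≤ (x + 1) * ((x + 1) ^ (i + 1) - (x ^ (i + 1) + (i + 1) * x ^ i)) +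
        (i + 1) * x ^ i := by positivity
    linarith

lemma powerExpSum_succ_le (i : ℕ) {s : ℝ} (hs : 0 < s) :
    (1 - Real.exp (-s)) * powerExpSum (i + 1) s ≤ (i + 1) * powerExpSum i s := by
  refine hasSum_le (fun m => ?_) (one_sub_mul_powerExpSum_succ i hs)
    ((summable_powerExpSum i hs).hasSum.mul_left _)
  rw [← mul_assoc]
  gcongr
  have hm : (0 : ℝ) ≤ m := Nat.cast_nonneg m
  have h := abs_pow_sub_pow_le ((m : ℝ) + 1) m (i + 1)
  rw [add_sub_cancel_left, abs_one, one_mul, abs_of_nonneg hm,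
    abs_of_nonneg (show (0 : ℝ) ≤ m + 1 by positivity), max_eq_left (by linarith),
    Nat.add_sub_cancel] at h
  push_cast at h
  exact (le_abs_self _).trans h

lemma le_powerExpSum_succ (i : ℕ) {s : ℝ} (hs : 0 < s) :
    (i + 1) * (Real.exp (-s) * powerExpSum i s) ≤
      (1 - Real.exp (-s)) * powerExpSum (i + 1) s := by
  have h2 : HasSum (fun m : ℕ => if m = 0 then 0 else (m : ℝ) ^ i * Real.exp (-s) ^ (m + 1))
      (Real.exp (-s) * powerExpSum i s) := by
    have h3 := (summable_powerExpSum i hs).hasSum.mul_left (Real.exp (-s))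
    rw [← hasSum_nat_add_iff' 1]
    simp only [Finset.sum_range_one, if_true, sub_zero, Nat.add_eq_zero_iff, one_ne_zero, and_false,
      if_false]
    convert! h3 using 2 with m
    push_cast
    ring
  refine hasSum_le (fun m => ?_) (h2.mul_left _) (one_sub_mul_powerExpSum_succ i hs)
  have h4 := add_mul_pow_le_add_one_pow (Nat.cast_nonneg m : (0 : ℝ) ≤ m) i
  split_ifs with h
  · subst h
    simp [Real.exp_nonneg]
  · rw [← mul_assoc]
    gcongr
    linarith

lemma one_add_pow_le {s : ℝ} (h0 : 0 ≤ s) (h1 : s ≤ 1) (i : ℕ) :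
    (1 + s) ^ i ≤ 1 + (2 ^ i - 1) * s := by
  induction i with
  | zero => simp
  | succ i ih =>
    have h2 : (1 : ℝ) ≤ 2 ^ i := one_le_pow₀ (by norm_num)
    calc (1 + s) ^ (i + 1) = (1 + s) ^ i * (1 + s) := pow_succ _ _
      _ ≤ (1 + (2 ^ i - 1) * s) * (1 + s) := by gcongr
      _ ≤ 1 + (2 ^ (i + 1) - 1) * s := by
        rw [pow_succ]
        nlinarith [mul_nonneg (mul_nonneg (sub_nonneg.2 h2) h0) (sub_nonneg.2 h1)]

lemma one_sub_le_div_exp_sub_one {s : ℝ} (hs : 0 < s) : 1 - s ≤ s / (Real.exp s - 1) := by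
  have h2 : 0 < Real.exp s - 1 := by linarith [Real.one_lt_exp_iff.2 hs]
  rw [le_div_iff₀ h2]
  have h3 : 1 - s ≤ Real.exp (-s) := by linarith [Real.add_one_le_exp (-s)]
  have : Real.exp (-s) * Real.exp s = 1 := by rw [← Real.exp_add]; simp
  nlinarith [Real.exp_pos s]

lemma div_exp_sub_one_le_one {s : ℝ} (hs : 0 < s) : s / (Real.exp s - 1) ≤ 1 := by
  have h2 : 0 < Real.exp s - 1 := by linarith [Real.one_lt_exp_iff.2 hs]
  rw [div_le_one h2]
  linarith [Real.add_one_le_exp s]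

/-- With u = s/(e^s - 1) and u + s = s/(1 - e^{-s}), each differencing step contributes a factor of
at least (i+1)u and at most (i+1)(u+s). Both factors are i + 1 + O(s) as s → 0. -/
lemma powerExpSum_bounds (i : ℕ) {s : ℝ} (hs : 0 < s) :
    i.factorial * (s / (Real.exp s - 1)) ^ (i + 1) ≤ s ^ (i + 1) * powerExpSum i s ∧
    s ^ (i + 1) * powerExpSum i s ≤
      i.factorial * (s / (Real.exp s - 1) * (s / (Real.exp s - 1) + s) ^ i) := by
  have hq : 0 < 1 - Real.exp (-s) := by linarith [exp_neg_lt_one hs]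
  have hq' : 0 < Real.exp (-s) := Real.exp_pos _
  have h2 : 0 < Real.exp s - 1 := by linarith [Real.one_lt_exp_iff.2 hs]
  have hu : s / (Real.exp s - 1) = s * Real.exp (-s) / (1 - Real.exp (-s)) := by
    rw [mul_div_assoc, exp_neg_div_one_sub hs]; ring
  have hv : s / (Real.exp s - 1) + s = s / (1 - Real.exp (-s)) := by
    rw [hu]; field_simp; ring
  induction i with
  | zero =>
    rw [powerExpSum_zero hs]
    simp [div_eq_mul_inv]
  | succ i ih =>
    have hA := powerExpSum_nonneg i s
    constructor
    · have h3 := le_powerExpSum_succ i hs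
      rw [← div_le_iff₀' hq] at h3
      calc ((i + 1).factorial : ℝ) * (s / (Real.exp s - 1)) ^ (i + 1 + 1)
          = (i + 1) * (s / (Real.exp s - 1)) *
            (i.factorial * (s / (Real.exp s - 1)) ^ (i + 1)) := by
            rw [Nat.factorial_succ]; push_cast; ring
        _ ≤ (i + 1) * (s / (Real.exp s - 1)) * (s ^ (i + 1) * powerExpSum i s) := by
            have := ih.1
            gcongr
        _ = s ^ (i + 1 + 1) *
            ((i + 1) * (Real.exp (-s) * powerExpSum i s) / (1 - Real.exp (-s))) := by
            rw [hu]; ring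
        _ ≤ _ := by gcongr
    · have h3 := powerExpSum_succ_le i hs
      rw [← le_div_iff₀' hq] at h3
      calc s ^ (i + 1 + 1) * powerExpSum (i + 1) s
          ≤ s ^ (i + 1 + 1) * ((i + 1) * powerExpSum i s / (1 - Real.exp (-s))) := by gcongr
        _ = (i + 1) * (s / (1 - Real.exp (-s))) * (s ^ (i + 1) * powerExpSum i s) := by ring
        _ ≤ (i + 1) * (s / (1 - Real.exp (-s))) *
            (i.factorial * (s / (Real.exp s - 1) * (s / (Real.exp s - 1) + s) ^ i)) := by
            have := ih.2
            gcongr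
        _ = _ := by rw [← hv, Nat.factorial_succ]; push_cast; ring

/-- `∑ m ^ i e ^ (-m s) = i! / s ^ (i + 1) + O(s ^ (-i))`, uniformly in `s > 0`. -/
lemma abs_powerExpSum_sub_le (i : ℕ) : ∃ C : ℝ, 0 ≤ C ∧ ∀ s : ℝ, 0 < s →
    |s ^ (i + 1) * powerExpSum i s - i.factorial| ≤ C * s := by
  have hf : (1 : ℝ) ≤ i.factorial := by exact_mod_cast Nat.one_le_iff_ne_zero.2 i.factorial_ne_zero
  refine ⟨i.factorial * (2 ^ i * (i.factorial + 1) + i + 1), by positivity, fun s hs => ?_⟩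
  obtain ⟨hl, hr⟩ := powerExpSum_bounds i hs
  have hu1 := one_sub_le_div_exp_sub_one hs
  have hu2 := div_exp_sub_one_le_one hs
  have h2 : 0 < Real.exp s - 1 := by linarith [Real.one_lt_exp_iff.2 hs]
  have hu0 : 0 ≤ s / (Real.exp s - 1) := by positivity
  have hnn : 0 ≤ s ^ (i + 1) * powerExpSum i s :=
    mul_nonneg (by positivity) (powerExpSum_nonneg i s)
  have h2i : (1 : ℝ) ≤ 2 ^ i := one_le_pow₀ (by norm_num)
  -- For s ≤ 1, Bernoulli's inequality and `one_add_pow_le` linearise the two bounds. For s ≥ 1 it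
  -- is enough that the scaled sum is O(s), which follows from s^i / i! ≤ e^s - 1, while i! ≤ i! *
  -- s.
  rcases le_total s 1 with h1 | h1
  · have e1 : (i.factorial : ℝ) * (s / (Real.exp s - 1) * (s / (Real.exp s - 1) + s) ^ i) ≤
        i.factorial * (1 * (1 + s) ^ i) := by gcongr
    have e2 := one_add_pow_le hs.le h1 i
    have e3 : (i.factorial : ℝ) * (1 - s) ^ (i + 1) ≤
        i.factorial * (s / (Real.exp s - 1)) ^ (i + 1) := by
      have : 0 ≤ 1 - s := by linarith
      gcongr
    have e4 := one_add_mul_le_pow (a := -s) (by linarith) (i + 1)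
    push_cast at e4
    rw [← sub_eq_add_neg] at e4
    have e5 := mul_le_mul_of_nonneg_left e2 (by positivity : (0 : ℝ) ≤ i.factorial)
    have e6 := mul_le_mul_of_nonneg_left e4 (by positivity : (0 : ℝ) ≤ i.factorial)
    rw [abs_le]
    constructor
    · have : 0 ≤ (i.factorial : ℝ) * (2 ^ i * (i.factorial + 1)) * s := by positivity
      linarith
    · have : 0 ≤ (i.factorial : ℝ) * (2 ^ i * i.factorial + i + 1) * s := by positivity
      have : 0 ≤ (i.factorial : ℝ) * s := by positivity
      linarith
  · have e1 : s / (Real.exp s - 1) * s ^ i ≤ i.factorial * s := by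
      rw [div_mul_eq_mul_div, div_le_iff₀ h2]
      have e2 : s ^ i ≤ i.factorial * (Real.exp s - 1) := by
        rcases Nat.eq_zero_or_pos i with rfl | hi
        · simp; linarith [Real.add_one_le_exp s]
        · have h5 : 1 + s ^ i / i.factorial ≤ Real.exp s := by
            have := Real.sum_le_exp_of_nonneg hs.le (i + 1)
            rw [Finset.sum_range_succ] at this
            have h6 : (1 : ℝ) ≤ ∑ j ∈ Finset.range i, s ^ j / (j.factorial : ℝ) := by
              have := Finset.single_le_sum (f := fun j => s ^ j / (j.factorial : ℝ))
                (fun j _ => by positivity) (Finset.mem_range.2 hi)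
              simpa using this
            linarith
          rw [← div_le_iff₀' (by positivity)]
          linarith
      nlinarith
    have e2 : (i.factorial : ℝ) * (s / (Real.exp s - 1) * (s / (Real.exp s - 1) + s) ^ i) ≤
        i.factorial * (s / (Real.exp s - 1) * (2 * s) ^ i) := by
      gcongr
      linarith
    have e3 : (i.factorial : ℝ) * (s / (Real.exp s - 1) * (2 * s) ^ i) ≤
        i.factorial * (2 ^ i * (i.factorial * s)) := by
      rw [mul_pow, mul_left_comm _ (2 ^ i) (s ^ i)]
      gcongr
    have e4 : (i.factorial : ℝ) ≤ i.factorial * s := le_mul_of_one_le_right (by positivity) h1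
    have e5 : (0 : ℝ) ≤ i.factorial * s * (2 ^ i * (i.factorial + 1) + i) := by positivity
    have e6 : (0 : ℝ) ≤ i.factorial * s * (2 ^ i + i + 1) := by positivity
    rw [abs_le]
    constructor <;> linarith

/-! ### Asymptotics of the Lambert series -/

lemma summable_zeta_terms {k : ℕ} (hk : 1 < k) :
    Summable fun j : ℕ => 1 / ((j : ℝ) + 1) ^ k := by
  have := (summable_nat_add_iff 1).2 (Real.summable_one_div_nat_pow.2 hk)
  simpa using this

lemma hasSum_zeta {k : ℕ} (hk : 1 < k) :
    HasSum (fun j : ℕ => 1 / ((j : ℝ) + 1) ^ k) (riemannZeta (k : ℂ)).re := by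
  have h1 : riemannZeta (k : ℂ) = ((∑' n : ℕ, 1 / (n : ℝ) ^ k : ℝ) : ℂ) := by
    rw [zeta_nat_eq_tsum_of_gt_one hk]; push_cast; rfl
  have h2 : (riemannZeta (k : ℂ)).re = ∑' j : ℕ, 1 / ((j : ℝ) + 1) ^ k := by
    rw [h1, Complex.ofReal_re, (Real.summable_one_div_nat_pow.2 hk).tsum_eq_zero_add]
    simp [show k ≠ 0 by omega]
  rw [h2]
  exact (summable_zeta_terms hk).hasSum

/-- The error O(s) at s = (j+1)t, divided by (j+1)^{i+1}, is O(t/(j+1)^i). This is summable exactly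
when i ≥ 2, so i = 0 and i = 1 need separate arguments. -/
lemma abs_lambert_sub_le {i : ℕ} (hi : 2 ≤ i) : ∃ C : ℝ, 0 ≤ C ∧ ∀ t : ℝ, 0 < t →
    |t ^ (i + 1) * lambert i t - i.factorial * (riemannZeta ((i + 1 : ℕ) : ℂ)).re| ≤ C * t := by
  obtain ⟨C, hC, h⟩ := abs_powerExpSum_sub_le i
  have hS := summable_zeta_terms (k := i) (by omega)
  refine ⟨C * ∑' j : ℕ, 1 / ((j : ℝ) + 1) ^ i, mul_nonneg hC (tsum_nonneg fun j => by positivity),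
    fun t ht => ?_⟩
  have h1 := ((hasSum_lambert i ht).mul_left (t ^ (i + 1))).sub
    ((hasSum_zeta (k := i + 1) (by omega)).mul_left (i.factorial : ℝ))
  have h2 := (hS.hasSum.mul_left (C * t))
  rw [← Real.norm_eq_abs, ← h1.tsum_eq]
  refine (tsum_of_norm_bounded h2 fun j => ?_).trans (le_of_eq (by ring))
  have hj : (0 : ℝ) < (j : ℝ) + 1 := by positivity
  have h3 := h (((j : ℝ) + 1) * t) (by positivity)
  have h4 : t ^ (i + 1) * powerExpSum i (((j : ℝ) + 1) * t) -
      i.factorial * (1 / ((j : ℝ) + 1) ^ (i + 1)) =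
      ((((j : ℝ) + 1) * t) ^ (i + 1) * powerExpSum i (((j : ℝ) + 1) * t) - i.factorial) /
        ((j : ℝ) + 1) ^ (i + 1) := by
    rw [mul_pow]; field_simp
  rw [h4, Real.norm_eq_abs, abs_div, abs_of_pos (pow_pos hj (i + 1)), div_le_iff₀ (pow_pos hj _)]
  refine h3.trans (le_of_eq ?_)
  rw [pow_succ]; field_simp

/-- This is x/2 ≤ sinh(x/2), multiplied by 2 e^{x/2} and squared. -/
lemma sq_mul_exp_le {x : ℝ} (hx : 0 < x) : x ^ 2 * Real.exp x ≤ (Real.exp x - 1) ^ 2 := by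
  have h := Real.self_le_sinh_iff.2 (show 0 ≤ x / 2 by positivity)
  rw [Real.sinh_eq] at h
  have h1 : Real.exp (-(x / 2)) * Real.exp (x / 2) = 1 := by rw [← Real.exp_add]; simp
  have h2 : Real.exp x = Real.exp (x / 2) ^ 2 := by rw [sq, ← Real.exp_add]; ring_nf
  have h3 : x * Real.exp (x / 2) ≤ Real.exp x - 1 := by nlinarith [Real.exp_pos (x / 2)]
  calc x ^ 2 * Real.exp x = (x * Real.exp (x / 2)) ^ 2 := by rw [h2]; ring
    _ ≤ _ := by gcongr

lemma powerExpSum_one' {s : ℝ} (hs : 0 < s) :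
    powerExpSum 1 s = Real.exp s / (Real.exp s - 1) ^ 2 := by
  rw [powerExpSum_one hs]
  have h1 : 0 < 1 - Real.exp (-s) := by linarith [exp_neg_lt_one hs]
  have h2 : 0 < Real.exp s - 1 := by linarith [Real.one_lt_exp_iff.2 hs]
  have h3 : Real.exp s - 1 = Real.exp s * (1 - Real.exp (-s)) := by
    rw [mul_sub, mul_one, ← Real.exp_add]; simp
  rw [h3, Real.exp_neg]
  have := Real.exp_pos s
  field_simp

lemma powerExpSum_one_le {s : ℝ} (hs : 0 < s) : powerExpSum 1 s ≤ 1 / s ^ 2 := by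
  have h2 : 0 < Real.exp s - 1 := by linarith [Real.one_lt_exp_iff.2 hs]
  rw [powerExpSum_one' hs, div_le_div_iff₀ (by positivity) (by positivity)]
  linarith [sq_mul_exp_le hs]

/-- The defect is bounded near 0 and O(1/s²) at infinity. Near 0 this uses `powerExpSum 1 s` = 1/(2
cosh s - 2) and cosh s ≤ e^{s²/2}. The form 4/(1+s)² is chosen so that its sum over multiples of t
telescopes. -/
lemma sub_powerExpSum_one_le {s : ℝ} (hs : 0 < s) :
    1 / s ^ 2 - powerExpSum 1 s ≤ 4 / (1 + s) ^ 2 := by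
  have hA := powerExpSum_nonneg 1 s
  rcases le_total s 1 with h1 | h1
  · have h2 : 0 < Real.exp s - 1 := by linarith [Real.one_lt_exp_iff.2 hs]
    have h3 : 1 / s ^ 2 - powerExpSum 1 s ≤ 1 := by
      have hc := Real.cosh_le_exp_half_sq s
      rw [Real.cosh_eq] at hc
      have hu : Real.exp (s ^ 2 / 2) * (1 - s ^ 2 / 2) ≤ 1 := by
        have h5 := Real.add_one_le_exp (-(s ^ 2 / 2))
        have h6 : Real.exp (s ^ 2 / 2) * Real.exp (-(s ^ 2 / 2)) = 1 := by
          rw [← Real.exp_add]; simp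
        nlinarith [Real.exp_pos (s ^ 2 / 2)]
      have hk : powerExpSum 1 s = 1 / (Real.exp s + Real.exp (-s) - 2) := by
        have h7 : Real.exp s + Real.exp (-s) - 2 = (Real.exp s - 1) ^ 2 / Real.exp s := by
          rw [Real.exp_neg]; field_simp; ring
        rw [powerExpSum_one' hs, h7, one_div_div]
      have hpos : 0 < Real.exp s + Real.exp (-s) - 2 := by
        have h7 : Real.exp s + Real.exp (-s) - 2 = (Real.exp s - 1) ^ 2 / Real.exp s := by
          rw [Real.exp_neg]; field_simp; ring
        rw [h7]; positivity
      rw [hk, sub_le_iff_le_add, div_le_iff₀ (by positivity)]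
      set w := Real.exp s + Real.exp (-s) - 2 with hw
      have hs2 : s ^ 2 ≤ 1 := by nlinarith
      have hs3 : 0 < s ^ 2 := by positivity
      have h8 : w * (1 - s ^ 2 / 2) ≤ s ^ 2 := by nlinarith
      have h9 : w * (1 - s ^ 2) ≤ s ^ 2 := by nlinarith
      rw [add_mul, div_mul_eq_mul_div, one_mul, ← sub_le_iff_le_add', le_div_iff₀ hpos]
      linarith
    refine h3.trans ?_
    rw [le_div_iff₀ (by positivity)]
    nlinarith
  · have : 1 / s ^ 2 ≤ 4 / (1 + s) ^ 2 := by
      rw [div_le_div_iff₀ (by positivity) (by positivity)]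
      nlinarith
    linarith

/-- At s = (j+1)t the error is at most 4t²/(1+s)² ≤ 4t²/((1+s-t)(1+s)), which is 4t times a
difference of consecutive values of 1/(1+jt); the total telescopes to 4t. -/
lemma abs_lambert_one_sub_le {t : ℝ} (ht : 0 < t) :
    |t ^ 2 * lambert 1 t - (riemannZeta ((2 : ℕ) : ℂ)).re| ≤ 4 * t := by
  have h1 := ((hasSum_lambert 1 ht).mul_left (t ^ 2)).sub (hasSum_zeta (k := 2) (by norm_num))
  have h2 : HasSum (fun j : ℕ => 4 * t * (1 / (1 + (j : ℝ) * t) - 1 / (1 + ((j : ℝ) + 1) * t)))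
      (4 * t) := by
    have h3 : HasSum (fun j : ℕ => 1 / (1 + (j : ℝ) * t) - 1 / (1 + ((j : ℝ) + 1) * t)) 1 := by
      rw [hasSum_iff_tendsto_nat_of_nonneg]
      · have h4 : ∀ n : ℕ, ∑ j ∈ Finset.range n,
            (1 / (1 + (j : ℝ) * t) - 1 / (1 + ((j : ℝ) + 1) * t)) = 1 - 1 / (1 + (n : ℝ) * t) := by
          intro n
          have := Finset.sum_range_sub' (fun j : ℕ => 1 / (1 + (j : ℝ) * t)) n
          simpa using this
        simp_rw [h4]
        have h5 : Tendsto (fun n : ℕ => 1 + (n : ℝ) * t) atTop atTop :=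
          tendsto_atTop_add_const_left _ _ (tendsto_natCast_atTop_atTop.atTop_mul_const ht)
        simpa using (tendsto_const_nhds (x := (1 : ℝ))).sub h5.inv_tendsto_atTop
      · intro j
        rw [sub_nonneg]
        gcongr
        linarith
    simpa using h3.mul_left (4 * t)
  rw [← Real.norm_eq_abs, ← h1.tsum_eq]
  refine tsum_of_norm_bounded h2 fun j => ?_
  have hj : (0 : ℝ) ≤ (j : ℝ) := Nat.cast_nonneg j
  set s := ((j : ℝ) + 1) * t with hs
  have hs0 : 0 < s := by positivity
  have h4 : t ^ 2 * powerExpSum 1 s - 1 / ((j : ℝ) + 1) ^ 2 =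
      -(t ^ 2 * (1 / s ^ 2 - powerExpSum 1 s)) := by
    rw [hs, mul_pow]; field_simp; ring
  have h5 : 0 ≤ 1 / s ^ 2 - powerExpSum 1 s := sub_nonneg.2 (powerExpSum_one_le hs0)
  rw [h4, norm_neg, Real.norm_eq_abs, abs_of_nonneg (by positivity)]
  have h6 := sub_powerExpSum_one_le hs0
  have h7 : 1 + (j : ℝ) * t = 1 + s - t := by rw [hs]; ring
  have h8 : 0 < 1 + s - t := by rw [← h7]; positivity
  calc t ^ 2 * (1 / s ^ 2 - powerExpSum 1 s) ≤ t ^ 2 * (4 / (1 + s) ^ 2) := by gcongr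
    _ ≤ t ^ 2 * (4 / ((1 + s - t) * (1 + s))) := by
      gcongr
      nlinarith
    _ = 4 * t * (1 / (1 + (j : ℝ) * t) - 1 / (1 + s)) := by
      rw [h7]; field_simp; ring

lemma hasDerivAt_log_one_sub_exp {x : ℝ} (hx : 0 < x) :
    HasDerivAt (fun y => Real.log (1 - Real.exp (-y)) - Real.log y)
      (1 / (Real.exp x - 1) - 1 / x) x := by
  have h1 : 0 < 1 - Real.exp (-x) := by linarith [exp_neg_lt_one hx]
  have h2 : HasDerivAt (fun y => 1 - Real.exp (-y)) (Real.exp (-x)) x := by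
    simpa using ((hasDerivAt_neg x).exp).const_sub 1
  have h3 := (h2.log h1.ne').sub (Real.hasDerivAt_log hx.ne')
  rwa [exp_neg_div_one_sub hx, ← one_div] at h3

/-- The derivative is 1/x² - e^x/(e^x - 1)², which is nonnegative by `powerExpSum_one_le`.
Monotonicity lets Riemann sums of this function be compared with increments of its primitive log(1 -
e^{-y}) - log y. -/
lemma monotoneOn_inv_exp_sub_one_sub_inv :
    MonotoneOn (fun x : ℝ => 1 / (Real.exp x - 1) - 1 / x) (Set.Ioi 0) := by
  have hd : ∀ x ∈ Set.Ioi (0 : ℝ), HasDerivAt (fun x : ℝ => 1 / (Real.exp x - 1) - 1 / x)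
      (-Real.exp x / (Real.exp x - 1) ^ 2 + 1 / x ^ 2) x := by
    intro x hx
    have hx' : (0 : ℝ) < x := hx
    have h2 : 0 < Real.exp x - 1 := by linarith [Real.one_lt_exp_iff.2 hx']
    have h3 := (((Real.hasDerivAt_exp x).sub_const 1).inv h2.ne').sub (hasDerivAt_inv hx'.ne')
    simp only [one_div]
    convert! h3 using 1
    ring
  refine monotoneOn_of_deriv_nonneg (convex_Ioi 0)
    (fun x hx => (hd x hx).continuousAt.continuousWithinAt)
    (fun x hx => ?_) (fun x hx => ?_)
  · rw [interior_Ioi] at hx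
    exact (hd x hx).differentiableAt.differentiableWithinAt
  · rw [interior_Ioi] at hx
    rw [(hd x hx).deriv]
    have := powerExpSum_one_le hx
    rw [powerExpSum_one' hx] at this
    rw [neg_div]
    linarith

lemma log_one_sub_exp_sub_bounds {a b : ℝ} (ha : 0 < a) (hab : a < b) :
    (b - a) * (1 / (Real.exp a - 1) - 1 / a) ≤
      (Real.log (1 - Real.exp (-b)) - Real.log b) - (Real.log (1 - Real.exp (-a)) - Real.log a) ∧
    (Real.log (1 - Real.exp (-b)) - Real.log b) - (Real.log (1 - Real.exp (-a)) - Real.log a) ≤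
      (b - a) * (1 / (Real.exp b - 1) - 1 / b) := by
  obtain ⟨c, hc, h⟩ := exists_hasDerivAt_eq_slope
    (fun y => Real.log (1 - Real.exp (-y)) - Real.log y)
    (fun x => 1 / (Real.exp x - 1) - 1 / x) hab
    (fun x hx => (hasDerivAt_log_one_sub_exp
      (lt_of_lt_of_le ha hx.1)).continuousAt.continuousWithinAt)
    (fun x hx => hasDerivAt_log_one_sub_exp (ha.trans hx.1))
  have hc0 : 0 < c := ha.trans hc.1
  have h1 := monotoneOn_inv_exp_sub_one_sub_inv (Set.mem_Ioi.2 ha) (Set.mem_Ioi.2 hc0) hc.1.le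
  have h2 := monotoneOn_inv_exp_sub_one_sub_inv (Set.mem_Ioi.2 hc0)
    (Set.mem_Ioi.2 (ha.trans hab)) hc.2.le
  have hba : 0 < b - a := by linarith
  rw [eq_div_iff hba.ne'] at h
  simp only at h h1 h2
  rw [← h, mul_comm _ (b - a)]
  exact ⟨by gcongr, by gcongr⟩

/-- Subtracting 1/x from 1/(e^x - 1) turns the partial sums into the harmonic number H_M plus a
Riemann sum of a monotone function. That sum is squeezed between increments of the primitive L,
whose log(M+1) combines with H_M to give γ. What remains is L(t) and one boundary term, each O(t).
-/
lemma abs_lambert_zero_sub_le {t : ℝ} (ht : 0 < t) :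
    |t * lambert 0 t - (Real.eulerMascheroniConstant - Real.log t)| ≤ 2 * t := by
  set f : ℝ → ℝ := fun x => 1 / (Real.exp x - 1) with hf
  set L : ℝ → ℝ := fun y => Real.log (1 - Real.exp (-y)) - Real.log y with hL
  have hS : Tendsto (fun M : ℕ => t * ∑ m ∈ Finset.range M, f (((m : ℝ) + 1) * t)) atTop
      (nhds (t * lambert 0 t)) := by
    have h1 := (hasSum_lambert 0 ht).tendsto_sum_nat.const_mul t
    refine h1.congr fun M => ?_
    congr 1
    exact Finset.sum_congr rfl fun m _ => powerExpSum_zero (by positivity)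
  have hlim : Tendsto (fun M : ℕ => ((harmonic M : ℚ) : ℝ) - Real.log ((M : ℝ) + 1) +
      Real.log (1 - Real.exp (-(((M : ℝ) + 1) * t))) - Real.log t - L t) atTop
      (nhds (Real.eulerMascheroniConstant + 0 - Real.log t - L t)) := by
    refine ((Real.tendsto_harmonic_sub_log_add_one.add ?_).sub_const _).sub_const _
    have h5 : Tendsto (fun M : ℕ => -(((M : ℝ) + 1) * t)) atTop atBot :=
      tendsto_neg_atTop_atBot.comp ((tendsto_atTop_add_const_right _ _
        tendsto_natCast_atTop_atTop).atTop_mul_const ht)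
    have h6 := (Real.tendsto_exp_atBot.comp h5).const_sub 1
    rw [sub_zero] at h6
    have h7 := (Real.continuousAt_log one_ne_zero).tendsto.comp h6
    rwa [Real.log_one] at h7
  have hsum : ∀ M : ℕ, t * ∑ m ∈ Finset.range M, f (((m : ℝ) + 1) * t) - ((harmonic M : ℚ) : ℝ) =
      ∑ m ∈ Finset.range M, t * (f (((m : ℝ) + 1) * t) - 1 / (((m : ℝ) + 1) * t)) := by
    intro M
    rw [harmonic]
    push_cast
    rw [Finset.mul_sum, ← Finset.sum_sub_distrib]
    refine Finset.sum_congr rfl fun m _ => ?_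
    rw [mul_sub]
    congr 1
    field_simp
  have hLM : ∀ M : ℕ, L (((M : ℝ) + 1) * t) = Real.log (1 - Real.exp (-(((M : ℝ) + 1) * t))) -
      Real.log ((M : ℝ) + 1) - Real.log t := by
    intro M
    simp only [hL]
    rw [Real.log_mul (by positivity) ht.ne']
    ring
  have htel : ∀ M : ℕ, ∑ m ∈ Finset.range M, (L (((m : ℝ) + 1 + 1) * t) - L (((m : ℝ) + 1) * t)) =
      L (((M : ℝ) + 1) * t) - L t := by
    intro M
    have := Finset.sum_range_sub (fun m : ℕ => L (((m : ℝ) + 1) * t)) M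
    simpa using this
  have hstep : ∀ m : ℕ, t * (f (((m : ℝ) + 1) * t) - 1 / (((m : ℝ) + 1) * t)) ≤
        L (((m : ℝ) + 1 + 1) * t) - L (((m : ℝ) + 1) * t) ∧
      L (((m : ℝ) + 1 + 1) * t) - L (((m : ℝ) + 1) * t) ≤
        t * (f (((m : ℝ) + 1 + 1) * t) - 1 / (((m : ℝ) + 1 + 1) * t)) := by
    intro m
    have h := log_one_sub_exp_sub_bounds (a := ((m : ℝ) + 1) * t) (b := ((m : ℝ) + 1 + 1) * t)
      (by positivity) (by nlinarith)
    have e : ((m : ℝ) + 1 + 1) * t - ((m : ℝ) + 1) * t = t := by ring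
    rwa [e] at h
  have hup : t * lambert 0 t ≤ Real.eulerMascheroniConstant + 0 - Real.log t - L t := by
    refine le_of_tendsto_of_tendsto' hS hlim fun M => ?_
    have h1 := Finset.sum_le_sum fun m (_ : m ∈ Finset.range M) => (hstep m).1
    rw [htel, ← hsum, hLM] at h1
    linarith
  -- The lower bound compares right endpoints, so M + 1 terms are taken and the first, t * (f t - 1
  -- / t), is split off. Replacing H_{M+1} by the smaller H_M is harmless.
  have hlow : Real.eulerMascheroniConstant + 0 - Real.log t - L t + t * (f t - 1 / t) ≤
      t * lambert 0 t := by
    refine le_of_tendsto_of_tendsto' (hlim.add_const (t * (f t - 1 / t)))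
      ((tendsto_add_atTop_iff_nat 1).2 hS) fun M => ?_
    have h1 := Finset.sum_le_sum fun m (_ : m ∈ Finset.range M) => (hstep m).2
    rw [htel, hLM] at h1
    have h2 := hsum (M + 1)
    rw [Finset.sum_range_succ' fun m : ℕ =>
      t * (f (((m : ℝ) + 1) * t) - 1 / (((m : ℝ) + 1) * t))] at h2
    simp only [Nat.cast_add, Nat.cast_one, Nat.cast_zero, zero_add, one_mul] at h2
    have h3 : ((harmonic M : ℚ) : ℝ) ≤ ((harmonic (M + 1) : ℚ) : ℝ) := by
      rw [harmonic_succ]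
      push_cast
      have : (0 : ℝ) ≤ ((M : ℝ) + 1)⁻¹ := by positivity
      linarith
    linarith
  have hft : -t ≤ t * (f t - 1 / t) := by
    have := one_sub_le_div_exp_sub_one ht
    have e : t * (f t - 1 / t) = t / (Real.exp t - 1) - 1 := by
      simp only [hf]; field_simp
    linarith
  have hE : 0 < 1 - Real.exp (-t) := by linarith [exp_neg_lt_one ht]
  have hL0 : L t ≤ 0 := by
    have : Real.log (1 - Real.exp (-t)) ≤ Real.log t :=
      Real.log_le_log hE (by linarith [Real.add_one_le_exp (-t)])
    simp only [hL]; linarith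
  have hL1 : -t ≤ L t := by
    have h1 : Real.log (t / (1 - Real.exp (-t))) ≤ t / (1 - Real.exp (-t)) - 1 :=
      Real.log_le_sub_one_of_pos (by positivity)
    rw [Real.log_div ht.ne' hE.ne'] at h1
    have h2 : t / (1 - Real.exp (-t)) ≤ 1 + t := by
      rw [div_le_iff₀ hE]
      have h3 := Real.add_one_le_exp t
      have h4 : Real.exp (-t) * Real.exp t = 1 := by rw [← Real.exp_add]; simp
      nlinarith [Real.exp_pos (-t)]
    simp only [hL]; linarith
  rw [abs_le]
  constructor <;> linarith

/-- The scaled limits of the Lambert series: `γ - log t`, then `i! ζ(i + 1)`. -/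
noncomputable def zetaArg (t : ℝ) (i : ℕ) : ℝ :=
  if i = 0 then Real.eulerMascheroniConstant - Real.log t
  else (i.factorial : ℝ) * (riemannZeta ((i + 1 : ℕ) : ℂ)).re

lemma abs_lambert_sub_zetaArg_le (i : ℕ) : ∃ C : ℝ, 0 ≤ C ∧ ∀ t : ℝ, 0 < t →
    |t ^ (i + 1) * lambert i t - zetaArg t i| ≤ C * t := by
  match i with
  | 0 =>
    refine ⟨2, by norm_num, fun t ht => ?_⟩
    simpa [zetaArg] using abs_lambert_zero_sub_le ht
  | 1 =>
    refine ⟨4, by norm_num, fun t ht => ?_⟩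
    simpa [zetaArg] using abs_lambert_one_sub_le ht
  | i + 2 =>
    obtain ⟨C, hC, h⟩ := abs_lambert_sub_le (i := i + 2) (by omega)
    refine ⟨C, hC, fun t ht => ?_⟩
    simpa [zetaArg] using h t ht

/-- A lower bound on the main terms turns absolute errors O(t) into relative ones. For i = 0 it
comes from -log t ≥ 1, otherwise from the first term of the zeta series. -/
lemma one_le_zetaArg {t : ℝ} (ht : 0 < t) (ht1 : t ≤ Real.exp (-1)) (i : ℕ) :
    1 ≤ zetaArg t i := by
  unfold zetaArg
  split_ifs with h
  · have h1 := Real.log_le_log ht ht1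
    rw [Real.log_exp] at h1
    linarith [Real.one_half_lt_eulerMascheroniConstant]
  · have h1 := (hasSum_zeta (k := i + 1) (by omega))
    have h2 := h1.summable.le_tsum 0 fun j _ => by positivity
    rw [h1.tsum_eq] at h2
    simp at h2
    have h3 : (1 : ℝ) ≤ i.factorial := by
      exact_mod_cast Nat.one_le_iff_ne_zero.2 i.factorial_ne_zero
    push_cast
    nlinarith

/-! ### Complete Bell polynomials: explicit sum and recursion -/

/-- The solutions of `b_1 + 2 b_2 + ⋯ + L b_L = N` in nonnegative integers. -/
def weightedSolutions (L N : ℕ) : Finset (Fin L → ℕ) :=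
  (Fintype.piFinset fun _ : Fin L => Finset.range (N + 1)).filter
    fun b => ∑ i : Fin L, ((i : ℕ) + 1) * b i = N

lemma mem_weightedSolutions {L N : ℕ} {b : Fin L → ℕ} :
    b ∈ weightedSolutions L N ↔ ∑ i : Fin L, ((i : ℕ) + 1) * b i = N := by
  simp only [weightedSolutions, Finset.mem_filter, Fintype.mem_piFinset, Finset.mem_range,
    and_iff_right_iff_imp]
  rintro rfl i
  have h := Finset.single_le_sum (f := fun i : Fin L => ((i : ℕ) + 1) * b i)
    (fun _ _ => Nat.zero_le _) (Finset.mem_univ i)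
  exact Nat.lt_succ_of_le ((Nat.le_mul_of_pos_left _ (Nat.succ_pos _)).trans h)

/-- The coefficient of `X ^ N` in `exp (∑_{i ≤ L} y_i X ^ i)`. -/
noncomputable def expCoeff (y : ℕ → ℝ) (L N : ℕ) : ℝ :=
  ∑ b ∈ weightedSolutions L N, ∏ i : Fin L, y i ^ b i / ((b i).factorial : ℝ)

lemma expCoeff_succ_left (y : ℕ → ℝ) {L N : ℕ} (h : N ≤ L) :
    expCoeff y (L + 1) N = expCoeff y L N := by
  have hz : ∀ b ∈ weightedSolutions (L + 1) N, b (Fin.last L) = 0 := by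
    intro b hb
    rw [mem_weightedSolutions, Fin.sum_univ_castSucc] at hb
    by_contra hne
    have := Nat.le_mul_of_pos_right (L + 1) (Nat.pos_of_ne_zero hne)
    simp only [Fin.val_last] at hb
    omega
  unfold expCoeff
  refine Finset.sum_bij' (i := fun b _ => Fin.init b) (j := fun b _ => Fin.snoc b 0) ?_ ?_ ?_ ?_ ?_
  · intro b hb
    have h0 := hz b hb
    rw [mem_weightedSolutions, Fin.sum_univ_castSucc, h0] at hb
    rw [mem_weightedSolutions]
    simpa [Fin.init] using hb
  · intro b hb
    rw [mem_weightedSolutions] at hb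
    rw [mem_weightedSolutions, Fin.sum_univ_castSucc]
    simpa using hb
  · intro b hb
    rw [← hz b hb]
    exact Fin.snoc_init_self b
  · intro b _
    exact Fin.init_snoc _ _
  · intro b hb
    rw [Fin.prod_univ_castSucc, hz b hb]
    simp [Fin.init]

lemma expCoeff_of_le (y : ℕ → ℝ) {L N : ℕ} (h : N ≤ L) : expCoeff y L N = expCoeff y N N := by
  induction L, h using Nat.le_induction with
  | base => rfl
  | succ L h ih => rw [expCoeff_succ_left y h, ih]

/-- Since b · y^b / b! = y · y^{b-1} / (b-1)!, lowering the exponent b_i by one is a bijection onto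
the solutions of weight N - (i+1). -/
lemma sum_weightedSolutions_apply (y : ℕ → ℝ) {L N : ℕ} (i : Fin L) (hi : (i : ℕ) + 1 ≤ N) :
    ∑ b ∈ weightedSolutions L N, (b i : ℝ) * ∏ j : Fin L, y j ^ b j / ((b j).factorial : ℝ) =
      y i * expCoeff y L (N - (i + 1)) := by
  classical
  rw [expCoeff, Finset.mul_sum]
  have h0 : ∀ b ∈ weightedSolutions L N,
      (b i : ℝ) * ∏ j : Fin L, y j ^ b j / ((b j).factorial : ℝ) ≠ 0 → b i ≠ 0 := by
    intro b _ hne h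
    exact hne (by simp [h])
  rw [← Finset.sum_filter_of_ne h0]
  have hsum : ∀ (b : Fin L → ℕ) (c : ℕ), ∑ j : Fin L, ((j : ℕ) + 1) * Function.update b i c j =
      ((i : ℕ) + 1) * c + ∑ j ∈ Finset.univ.erase i, ((j : ℕ) + 1) * b j := by
    intro b c
    rw [← Finset.add_sum_erase _ _ (Finset.mem_univ i), Function.update_self]
    congr 1
    exact Finset.sum_congr rfl fun j hj => by
      rw [Function.update_of_ne (Finset.ne_of_mem_erase hj)]
  have hsum' : ∀ b : Fin L → ℕ, ∑ j : Fin L, ((j : ℕ) + 1) * b j =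
      ((i : ℕ) + 1) * b i + ∑ j ∈ Finset.univ.erase i, ((j : ℕ) + 1) * b j := fun b =>
    (Finset.add_sum_erase _ _ (Finset.mem_univ i)).symm
  refine Finset.sum_bij' (i := fun b _ => Function.update b i (b i - 1))
    (j := fun b _ => Function.update b i (b i + 1)) ?_ ?_ ?_ ?_ ?_
  · intro b hb
    obtain ⟨hb, hbi⟩ := Finset.mem_filter.1 hb
    rw [mem_weightedSolutions, hsum'] at hb
    rw [mem_weightedSolutions, hsum]
    obtain ⟨c, hc⟩ := Nat.exists_eq_succ_of_ne_zero hbi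
    rw [hc, Nat.succ_eq_add_one, mul_add] at hb
    rw [hc, Nat.succ_eq_add_one, Nat.add_sub_cancel]
    omega
  · intro b hb
    rw [mem_weightedSolutions, hsum'] at hb
    rw [Finset.mem_filter, mem_weightedSolutions, hsum, mul_add]
    refine ⟨by omega, by simp⟩
  · intro b hb
    have hbi := (Finset.mem_filter.1 hb).2
    simp [Nat.sub_add_cancel (Nat.one_le_iff_ne_zero.2 hbi)]
  · intro b _
    simp
  · intro b hb
    have hbi := (Finset.mem_filter.1 hb).2
    obtain ⟨c, hc⟩ := Nat.exists_eq_succ_of_ne_zero hbi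
    rw [← Finset.mul_prod_erase _ _ (Finset.mem_univ i),
      ← Finset.mul_prod_erase (Finset.univ : Finset (Fin L)) (fun j => y j ^ _ / _)
        (Finset.mem_univ i)]
    have he : ∏ j ∈ Finset.univ.erase i, y j ^ Function.update b i (b i - 1) j /
        ((Function.update b i (b i - 1) j).factorial : ℝ) =
        ∏ j ∈ Finset.univ.erase i, y j ^ b j / ((b j).factorial : ℝ) :=
      Finset.prod_congr rfl fun j hj => by
        rw [Function.update_of_ne (Finset.ne_of_mem_erase hj)]
    rw [he, Function.update_self, hc, Nat.succ_eq_add_one, Nat.add_sub_cancel, Nat.factorial_succ]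
    push_cast
    field_simp
    ring

/-- This is the coefficient form of X (exp Y)' = X Y' exp Y, obtained by writing the total weight k
+ 1 as ∑ (i+1) b_i inside the sum. -/
lemma natCast_mul_expCoeff (y : ℕ → ℝ) (k : ℕ) :
    ((k : ℝ) + 1) * expCoeff y (k + 1) (k + 1) =
      ∑ i ∈ Finset.range (k + 1), ((i : ℝ) + 1) * y i * expCoeff y (k - i) (k - i) := by
  have h1 : ((k : ℝ) + 1) * expCoeff y (k + 1) (k + 1) =
      ∑ b ∈ weightedSolutions (k + 1) (k + 1), ∑ i : Fin (k + 1), ((i : ℝ) + 1) *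
        ((b i : ℝ) * ∏ j : Fin (k + 1), y j ^ b j / ((b j).factorial : ℝ)) := by
    rw [expCoeff, Finset.mul_sum]
    refine Finset.sum_congr rfl fun b hb => ?_
    have := congrArg (Nat.cast (R := ℝ)) (mem_weightedSolutions.1 hb)
    push_cast at this
    rw [← this, Finset.sum_mul]
    exact Finset.sum_congr rfl fun i _ => by ring
  rw [h1, Finset.sum_comm, Finset.sum_range]
  refine Finset.sum_congr rfl fun i _ => ?_
  rw [← Finset.mul_sum, sum_weightedSolutions_apply y i (by omega), Nat.add_sub_add_right,
    expCoeff_of_le y (show k - i ≤ k + 1 by omega), mul_assoc]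

/-- The complete Bell polynomials with arguments `x 0, …, x (k - 1)`. -/
noncomputable def bellPoly (x : ℕ → ℝ) (k : ℕ) : ℝ := bellSum k fun i => x i

lemma bellPoly_eq (x : ℕ → ℝ) (k : ℕ) :
    bellPoly x k = k.factorial * expCoeff (fun i => x i / ((i + 1).factorial : ℝ)) k k := by
  rw [bellPoly, bellSum, expCoeff, Finset.mul_sum]
  refine Finset.sum_congr rfl fun b _ => ?_
  rw [Finset.prod_div_distrib]
  ring

lemma bellPoly_zero (x : ℕ → ℝ) : bellPoly x 0 = 1 := by
  simp [bellPoly, bellSum, solutions]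

lemma bellPoly_succ (x : ℕ → ℝ) (k : ℕ) : bellPoly x (k + 1) =
    ∑ i ∈ Finset.range (k + 1), (k.choose i : ℝ) * (x i * bellPoly x (k - i)) := by
  have h := natCast_mul_expCoeff (fun i => x i / ((i + 1).factorial : ℝ)) k
  rw [bellPoly_eq, Nat.factorial_succ]
  push_cast
  rw [mul_comm ((k : ℝ) + 1), mul_assoc, h, Finset.mul_sum]
  refine Finset.sum_congr rfl fun i hi => ?_
  have hik : i ≤ k := Nat.lt_succ_iff.1 (Finset.mem_range.1 hi)
  rw [bellPoly_eq, Nat.cast_choose ℝ hik, Nat.factorial_succ]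
  push_cast
  field_simp

lemma bellPoly_pos {x : ℕ → ℝ} (hx : ∀ i, 1 ≤ x i) (k : ℕ) : 0 < bellPoly x k := by
  induction k using Nat.strong_induction_on with
  | _ k ih =>
    cases k with
    | zero => simp [bellPoly_zero]
    | succ k =>
      rw [bellPoly_succ]
      refine Finset.sum_pos (fun i hi => ?_) ⟨0, by simp⟩
      have h1 := ih (k - i) (by omega)
      have h2 : (0 : ℝ) < k.choose i := by
        exact_mod_cast Nat.choose_pos (Nat.lt_succ_iff.1 (Finset.mem_range.1 hi))
      have h3 := hx i
      positivity

lemma bellPoly_le_two_pow {x y : ℕ → ℝ} (hx : ∀ i, 1 ≤ x i) (hy : ∀ i, 1 ≤ y i)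
    (h : ∀ i, y i ≤ 2 * x i) (k : ℕ) : bellPoly y k ≤ 2 ^ k * bellPoly x k := by
  induction k using Nat.strong_induction_on with
  | _ k ih =>
    cases k with
    | zero => simp [bellPoly_zero]
    | succ k =>
      rw [bellPoly_succ, bellPoly_succ, Finset.mul_sum]
      refine Finset.sum_le_sum fun i hi => ?_
      have h1 := ih (k - i) (by omega)
      have h2 := (bellPoly_pos hx (k - i)).le
      have h2' := (bellPoly_pos hy (k - i)).le
      have h3 : (2 : ℝ) ^ (k - i) ≤ 2 ^ k := pow_le_pow_right₀ (by norm_num) (Nat.sub_le _ _)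
      have h4 := hx i
      calc (k.choose i : ℝ) * (y i * bellPoly y (k - i))
          ≤ (k.choose i : ℝ) * ((2 * x i) * (2 ^ k * bellPoly x (k - i))) := by
            gcongr
            · exact h i
            · exact h1.trans (by gcongr)
        _ = _ := by rw [pow_succ]; ring

/-! ### Asymptotics of the Bell series at e^{-t} -/

lemma abs_bellValue_sub_le (k : ℕ) : ∃ C : ℝ, 0 ≤ C ∧ ∀ t : ℝ, 0 < t → t ≤ Real.exp (-1) →
    |t ^ k * bellValue k t - bellPoly (zetaArg t) k| ≤ C * t * bellPoly (zetaArg t) k := by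
  induction k using Nat.strong_induction_on with
  | _ k ih =>
    cases k with
    | zero =>
      refine ⟨0, le_rfl, fun t _ _ => ?_⟩
      simp [bellPoly_zero, bellValue_zero]
    | succ k =>
      have ih' : ∀ i : ℕ, ∃ C : ℝ, 0 ≤ C ∧ ∀ t : ℝ, 0 < t → t ≤ Real.exp (-1) →
          |t ^ (k - i) * bellValue (k - i) t - bellPoly (zetaArg t) (k - i)| ≤
            C * t * bellPoly (zetaArg t) (k - i) := fun i => ih (k - i) (by omega)
      choose C hC h using ih'
      choose D hD hl using abs_lambert_sub_zetaArg_le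
      have hnn : ∀ i, 0 ≤ D i * (1 + C i) + C i := fun i => by
        have := hC i
        have := hD i
        positivity
      refine ⟨∑ i ∈ Finset.range (k + 1), (D i * (1 + C i) + C i),
        Finset.sum_nonneg fun i _ => hnn i, fun t ht ht1 => ?_⟩
      have htle : t ≤ 1 := ht1.trans (Real.exp_le_one_iff.2 (by norm_num))
      have hz := one_le_zetaArg ht ht1
      have hb := bellPoly_pos hz
      rw [bellValue_succ k ht, bellPoly_succ, Finset.mul_sum, ← Finset.sum_sub_distrib,
        Finset.mul_sum]
      refine (Finset.abs_sum_le_sum_abs _ _).trans (Finset.sum_le_sum fun i hi => ?_)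
      have hik : i ≤ k := Nat.lt_succ_iff.1 (Finset.mem_range.1 hi)
      have hCi : D i * (1 + C i) + C i ≤ ∑ i ∈ Finset.range (k + 1), (D i * (1 + C i) + C i) :=
        Finset.single_le_sum (f := fun i => D i * (1 + C i) + C i) (fun j _ => hnn j) hi
      set X := t ^ (i + 1) * lambert i t
      set Y := t ^ (k - i) * bellValue (k - i) t
      set x := zetaArg t i
      set y := bellPoly (zetaArg t) (k - i)
      have e1 : t ^ (k + 1) * ((k.choose i : ℝ) * (lambert i t * bellValue (k - i) t)) -
          (k.choose i : ℝ) * (x * y) = (k.choose i : ℝ) * (X * Y - x * y) := by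
        have : t ^ (k + 1) = t ^ (i + 1) * t ^ (k - i) := by
          rw [← pow_add]; congr 1; omega
        rw [this]; ring
      have hXx : |X - x| ≤ D i * t := hl i t ht
      have hYy : |Y - y| ≤ C i * t * y := h i t ht ht1
      have hx : 1 ≤ x := hz i
      have hy : 0 < y := hb (k - i)
      have hYa : |Y| ≤ (1 + C i) * y := by
        have h1 : |Y| ≤ |Y - y| + |y| := by
          have := abs_add_le (Y - y) y
          rwa [sub_add_cancel] at this
        rw [abs_of_pos hy] at h1
        have h2 : C i * t * y ≤ C i * 1 * y := by
          have := hC i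
          gcongr
        linarith
      -- The Lambert error is only absolute, of size D t; the bound 1 ≤ x lets it be written as D t
      -- x, so the product error is relative to x y and the induction closes.
      have e2 : |X * Y - x * y| ≤ (D i * (1 + C i) + C i) * t * (x * y) := by
        have h3 : X * Y - x * y = (X - x) * Y + x * (Y - y) := by ring
        have hDi := hD i
        have hCi := hC i
        rw [h3]
        calc |(X - x) * Y + x * (Y - y)| ≤ |X - x| * |Y| + x * |Y - y| := by
              refine (abs_add_le _ _).trans ?_
              rw [abs_mul (X - x), abs_mul x, abs_of_pos (show 0 < x by linarith)]
          _ ≤ (D i * t) * ((1 + C i) * y) + x * (C i * t * y) := by gcongr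
          _ ≤ x * ((D i * t) * ((1 + C i) * y)) + x * (C i * t * y) := by
              have := le_mul_of_one_le_left
                (show 0 ≤ (D i * t) * ((1 + C i) * y) by positivity) hx
              linarith
          _ = _ := by ring
      rw [e1, abs_mul, abs_of_nonneg (Nat.cast_nonneg _)]
      calc (k.choose i : ℝ) * |X * Y - x * y|
          ≤ (k.choose i : ℝ) * ((D i * (1 + C i) + C i) * t * (x * y)) := by gcongr
        _ ≤ (k.choose i : ℝ) *
            ((∑ i ∈ Finset.range (k + 1), (D i * (1 + C i) + C i)) * t * (x * y)) := by
            gcongr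
        _ = _ := by ring

/-- Halving t adds only log 2 < 1 to the first argument, so every argument at most doubles because
each is at least 1; the Bell polynomial then grows by at most 2^k. -/
lemma bellValue_half_le (k : ℕ) : ∃ C : ℝ, 0 ≤ C ∧ ∀ t : ℝ, 0 < t → t ≤ Real.exp (-1) →
    t ^ k * bellValue k (t / 2) ≤ C * bellPoly (zetaArg t) k := by
  obtain ⟨C, hC, h⟩ := abs_bellValue_sub_le k
  refine ⟨2 ^ k * ((1 + C) * 2 ^ k), by positivity, fun t ht ht1 => ?_⟩
  have htle : t ≤ 1 := ht1.trans (Real.exp_le_one_iff.2 (by norm_num))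
  have hz := one_le_zetaArg ht ht1
  have hz' := one_le_zetaArg (t := t / 2) (by linarith) (by linarith)
  have hp := (bellPoly_pos hz' k).le
  have h1 := (le_abs_self _).trans (h (t / 2) (by linarith) (by linarith))
  have h2 : bellPoly (zetaArg (t / 2)) k ≤ 2 ^ k * bellPoly (zetaArg t) k := by
    refine bellPoly_le_two_pow hz hz' (fun i => ?_) k
    have h3 := hz i
    have h4 : zetaArg (t / 2) i ≤ zetaArg t i + 1 := by
      unfold zetaArg
      split_ifs
      · rw [Real.log_div ht.ne' (by norm_num)]
        linarith [Real.log_two_lt_d9]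
      · linarith
    linarith
  have h5 : t ^ k = 2 ^ k * (t / 2) ^ k := by rw [← mul_pow]; congr 1; ring
  have h6 : C * (t / 2) * bellPoly (zetaArg (t / 2)) k ≤ C * 1 * bellPoly (zetaArg (t / 2)) k := by
    gcongr; linarith
  calc t ^ k * bellValue k (t / 2) = 2 ^ k * ((t / 2) ^ k * bellValue k (t / 2)) := by
        rw [h5]; ring
    _ ≤ 2 ^ k * ((1 + C) * bellPoly (zetaArg (t / 2)) k) :=
        mul_le_mul_of_nonneg_left (by linarith) (by positivity)
    _ ≤ 2 ^ k * ((1 + C) * (2 ^ k * bellPoly (zetaArg t) k)) := by gcongr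
    _ = _ := by ring

/-! ### Euler's product for the partition generating function -/

/-- The geometric series `1 / (1 - X ^ (i + 1))`. -/
noncomputable def geomSeries (R : Type*) [Semiring R] (i : ℕ) : PowerSeries R :=
  PowerSeries.mk fun n => if i + 1 ∣ n then 1 else 0

lemma absHasSum_geomSeries (i : ℕ) {q : ℂ} (hq : ‖q‖ < 1) :
    AbsHasSum (geomSeries ℂ i) q (1 - q ^ (i + 1))⁻¹ := by
  constructor
  · refine (summable_geometric_of_lt_one (norm_nonneg q) hq).of_nonneg_of_le
      (fun _ => norm_nonneg _) fun n => ?_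
    simp only [geomSeries, PowerSeries.coeff_mk]
    split_ifs
    · simp
    · simp
  · have h1 : ‖q ^ (i + 1)‖ < 1 := by
      rw [norm_pow]; exact pow_lt_one₀ (norm_nonneg _) hq (Nat.succ_ne_zero i)
    have hinj : Function.Injective fun j : ℕ => (i + 1) * j := fun a b h =>
      Nat.eq_of_mul_eq_mul_left (Nat.succ_pos i) h
    have h2 := hasSum_geometric_of_norm_lt_one h1
    rw [← hinj.hasSum_iff]
    · convert! h2 using 2 with j
      simp [geomSeries, pow_mul]
    · intro n hn
      have : ¬ i + 1 ∣ n := fun ⟨j, hj⟩ => hn ⟨j, hj.symm⟩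
      simp [geomSeries, this]

/-- The generating function of partitions into parts at most `M`. -/
noncomputable def finiteGenFun (R : Type*) [CommSemiring R] (M : ℕ) : PowerSeries R :=
  ∏ i ∈ Finset.range M, geomSeries R i

lemma coeff_finiteGenFun_complex (M n : ℕ) : PowerSeries.coeff n (finiteGenFun ℂ M) =
    ((PowerSeries.coeff n (finiteGenFun ℝ M) : ℝ) : ℂ) := by
  have h : finiteGenFun ℂ M = PowerSeries.map Complex.ofRealHom (finiteGenFun ℝ M) := by
    rw [finiteGenFun, finiteGenFun, map_prod]
    refine Finset.prod_congr rfl fun i _ => ?_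
    ext n
    simp only [geomSeries, PowerSeries.coeff_mk, PowerSeries.coeff_map]
    split_ifs <;> simp
  rw [h, PowerSeries.coeff_map]
  rfl

lemma coeff_finiteGenFun_nonneg (M n : ℕ) : 0 ≤ PowerSeries.coeff n (finiteGenFun ℝ M) := by
  induction M generalizing n with
  | zero =>
    rw [finiteGenFun, Finset.prod_range_zero, PowerSeries.coeff_one]
    split_ifs <;> norm_num
  | succ M ih =>
    rw [finiteGenFun, Finset.prod_range_succ, PowerSeries.coeff_mul]
    refine Finset.sum_nonneg fun x _ => mul_nonneg (ih _) ?_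
    simp only [geomSeries, PowerSeries.coeff_mk]
    split_ifs <;> norm_num

lemma monotone_coeff_finiteGenFun (n : ℕ) :
    Monotone fun M => PowerSeries.coeff n (finiteGenFun ℝ M) := by
  refine monotone_nat_of_le_succ fun M => ?_
  conv_rhs => rw [finiteGenFun, Finset.prod_range_succ, PowerSeries.coeff_mul]
  have h := Finset.single_le_sum (s := Finset.HasAntidiagonal.antidiagonal n)
    (f := fun x : ℕ × ℕ => PowerSeries.coeff x.1 (finiteGenFun ℝ M) *
      PowerSeries.coeff x.2 (geomSeries ℝ M)) (fun x _ => mul_nonneg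
        (coeff_finiteGenFun_nonneg M _) (by
          simp only [geomSeries, PowerSeries.coeff_mk]
          split_ifs <;> norm_num))
    (show (n, 0) ∈ Finset.HasAntidiagonal.antidiagonal n by simp)
  have h0 : PowerSeries.coeff 0 (geomSeries ℝ M) = 1 := by simp [geomSeries]
  simp only [h0, mul_one] at h
  exact h

section

open scoped PowerSeries.WithPiTopology

lemma tendsto_coeff_finiteGenFun (n : ℕ) :
    Tendsto (fun M => PowerSeries.coeff n (finiteGenFun ℝ M)) atTop
      (nhds (Fintype.card n.Partition : ℝ)) := by
  have h1 := Nat.Partition.hasProd_powerSeriesMk_card_restricted ℝ fun _ => True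
  have h2 : ∀ i : ℕ, (∑' j : ℕ, (PowerSeries.X : PowerSeries ℝ) ^ ((i + 1) * j)) =
      geomSeries ℝ i := by
    intro i
    refine HasSum.tsum_eq ((PowerSeries.WithPiTopology.hasSum_iff_hasSum_coeff _).2 fun d => ?_)
    simp only [PowerSeries.coeff_X_pow, geomSeries, PowerSeries.coeff_mk]
    split_ifs with h
    · obtain ⟨j, rfl⟩ := h
      convert! hasSum_ite_eq j (1 : ℝ) using 2 with k
      simp [eq_comm]
    · convert! hasSum_zero using 2 with k
      rw [if_neg fun hd => h ⟨k, hd⟩]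
  simp only [if_true, h2] at h1
  have h3 := ((PowerSeries.WithPiTopology.continuous_coeff ℝ n).tendsto _).comp
    h1.tendsto_prod_nat
  convert! h3 using 2
  simp [Nat.Partition.restricted]

end

lemma coeff_finiteGenFun_le (M n : ℕ) :
    PowerSeries.coeff n (finiteGenFun ℝ M) ≤ Fintype.card n.Partition :=
  (monotone_coeff_finiteGenFun n).ge_of_tendsto (tendsto_coeff_finiteGenFun n) M

lemma absHasSum_finiteGenFun (M : ℕ) {q : ℂ} (hq : ‖q‖ < 1) :
    AbsHasSum (finiteGenFun ℂ M) q (∏ i ∈ Finset.range M, (1 - q ^ (i + 1)))⁻¹ := by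
  rw [← Finset.prod_inv_distrib]
  exact absHasSum_prod _ fun i _ => absHasSum_geomSeries i hq

lemma one_sub_pow_ne_zero {q : ℂ} (hq : ‖q‖ < 1) (i : ℕ) : 1 - q ^ (i + 1) ≠ 0 := by
  intro h
  have h1 : ‖q ^ (i + 1)‖ < 1 := by
    rw [norm_pow]; exact pow_lt_one₀ (norm_nonneg _) hq (Nat.succ_ne_zero i)
  rw [← sub_eq_zero.1 h, norm_one] at h1
  exact lt_irrefl _ h1

lemma tprod_one_sub_pow_ne_zero {q : ℂ} (hq : ‖q‖ < 1) : ∏' i : ℕ, (1 - q ^ (i + 1)) ≠ 0 := by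
  have h := tprod_one_add_ne_zero_of_summable (f := fun i : ℕ => -q ^ (i + 1))
    (fun i => by simpa [sub_eq_add_neg] using one_sub_pow_ne_zero hq i)
    (by simpa using (summable_nat_add_iff 1).2 (summable_geometric_of_lt_one (norm_nonneg _) hq))
  simpa [sub_eq_add_neg] using h

lemma tendsto_prod_inv {q : ℂ} (hq : ‖q‖ < 1) :
    Tendsto (fun M => (∏ i ∈ Finset.range M, (1 - q ^ (i + 1)))⁻¹) atTop
      (nhds (∏' i : ℕ, (1 - q ^ (i + 1)))⁻¹) :=
  ((ModularForm.multipliable_one_sub_pow hq).hasProd.tendsto_prod_nat).inv₀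
    (tprod_one_sub_pow_ne_zero hq)

/-- Coefficients of the finite products increase to p(n), so each partial sum is a limit of
quantities bounded by the convergent sequence of finite products at x. -/
lemma summable_partition_mul_pow {x : ℝ} (hx0 : 0 ≤ x) (hx1 : x < 1) :
    Summable fun n : ℕ => (Fintype.card n.Partition : ℝ) * x ^ n := by
  have hq : ‖(x : ℂ)‖ < 1 := by rwa [Complex.norm_real, Real.norm_eq_abs, abs_of_nonneg hx0]
  obtain ⟨B, hB⟩ := (tendsto_prod_inv hq).norm.bddAbove_range
  refine summable_of_sum_range_le (c := B) (fun n => by positivity) fun N => ?_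
  refine le_of_tendsto' (tendsto_finsetSum (Finset.range N) fun n _ =>
    (tendsto_coeff_finiteGenFun n).mul_const (x ^ n)) fun M => ?_
  refine le_trans ?_ (hB ⟨M, rfl⟩)
  have h := absHasSum_finiteGenFun M hq
  have h2 : ∀ n, PowerSeries.coeff n (finiteGenFun ℂ M) * (x : ℂ) ^ n =
      ((PowerSeries.coeff n (finiteGenFun ℝ M) * x ^ n : ℝ) : ℂ) := fun n => by
    rw [coeff_finiteGenFun_complex]; push_cast; rfl
  have hnn : ∀ n, 0 ≤ PowerSeries.coeff n (finiteGenFun ℝ M) * x ^ n := fun n =>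
    mul_nonneg (coeff_finiteGenFun_nonneg M n) (by positivity)
  have h3 : Summable fun n => PowerSeries.coeff n (finiteGenFun ℝ M) * x ^ n := by
    refine h.1.congr fun n => ?_
    rw [h2, Complex.norm_real, Real.norm_eq_abs, abs_of_nonneg (hnn n)]
  have h4 := h.2.tsum_eq
  simp only [h2] at h4
  rw [← Complex.ofReal_tsum] at h4
  simp only
  rw [← h4, Complex.norm_real]
  exact (h3.sum_le_tsum _ fun n _ => hnn n).trans (le_abs_self _)

/-- The generating function `∑ p(n) q ^ n`. -/
noncomputable def partitionGenFun (q : ℂ) : ℂ := ∑' n : ℕ, (Fintype.card n.Partition : ℂ) * q ^ n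

lemma summable_norm_partition_mul_pow {q : ℂ} (hq : ‖q‖ < 1) :
    Summable fun n : ℕ => ‖(Fintype.card n.Partition : ℂ) * q ^ n‖ := by
  simpa using summable_partition_mul_pow (norm_nonneg q) hq

lemma partitionGenFun_eq {q : ℂ} (hq : ‖q‖ < 1) :
    partitionGenFun q = (∏' i : ℕ, (1 - q ^ (i + 1)))⁻¹ := by
  refine tendsto_nhds_unique ?_ (tendsto_prod_inv hq)
  have h := tendsto_tsum_of_dominated_convergence (𝓕 := atTop)
    (f := fun M n => PowerSeries.coeff n (finiteGenFun ℂ M) * q ^ n)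
    (g := fun n => (Fintype.card n.Partition : ℂ) * q ^ n)
    (summable_norm_partition_mul_pow hq) (fun n => ?_) (Eventually.of_forall fun M n => ?_)
  · refine h.congr fun M => (absHasSum_finiteGenFun M hq).2.tsum_eq
  · refine Tendsto.mul_const _ ?_
    simp only [coeff_finiteGenFun_complex]
    exact_mod_cast (Complex.continuous_ofReal.tendsto _).comp (tendsto_coeff_finiteGenFun n)
  · rw [norm_mul, norm_mul, coeff_finiteGenFun_complex, Complex.norm_real, Real.norm_eq_abs,
      abs_of_nonneg (coeff_finiteGenFun_nonneg M n), Complex.norm_natCast]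
    gcongr
    exact coeff_finiteGenFun_le M n

/-! ### Decay of the generating function off the real axis -/

lemma exp_two_mul_le {ρ : ℝ} (h0 : 0 ≤ ρ) (h1 : ρ < 1) :
    (1 - ρ) * Real.exp (2 * ρ) ≤ 1 + ρ := by
  have h := Real.hasSum_log_sub_log_of_abs_lt_one (x := ρ) (by rwa [abs_of_nonneg h0])
  have h2 := h.summable.le_tsum 0 fun j _ => by positivity
  rw [h.tsum_eq] at h2
  simp at h2
  have h3 : Real.log (1 - ρ) + 2 * ρ ≤ Real.log (1 + ρ) := by linarith
  have h4 := Real.exp_le_exp.2 h3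
  rwa [Real.exp_add, Real.exp_log (by linarith), Real.exp_log (by linarith)] at h4

lemma one_sub_norm_mul_exp_le {w : ℂ} (hw : ‖w‖ < 1) :
    (1 - ‖w‖) * Real.exp (‖w‖ - w.re) ≤ ‖1 - w‖ := by
  set ρ := ‖w‖ with hρ
  have h0 : 0 ≤ ρ := norm_nonneg w
  rcases h0.eq_or_lt with h | hpos
  · have : w = 0 := norm_eq_zero.1 (hρ ▸ h.symm)
    simp [this, ← h]
  have hre : |w.re| ≤ ρ := Complex.abs_re_le_norm w
  obtain ⟨hr1, hr2⟩ := abs_le.1 hre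
  have hsq : ‖1 - w‖ ^ 2 = (1 - ρ) ^ 2 + 2 * (ρ - w.re) := by
    have e1 : ρ ^ 2 = w.re ^ 2 + w.im ^ 2 := by
      rw [hρ, Complex.sq_norm, Complex.normSq_apply]; ring
    rw [Complex.sq_norm, Complex.normSq_apply]
    simp
    nlinarith
  set d := ρ - w.re with hd
  have hd0 : 0 ≤ d := by linarith
  have hd1 : d ≤ 2 * ρ := by linarith
  refine le_of_sq_le_sq ?_ (norm_nonneg _)
  -- After squaring, the claim is (1-ρ)² e^{2d} ≤ (1-ρ)² + 2d for 0 ≤ d ≤ 2ρ. The left side is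
  -- convex and the right side affine in d, so the endpoints suffice; at d = 2ρ it is the square of
  -- `exp_two_mul_le`.
  have hconv : Real.exp (2 * d) ≤ 1 + d / (2 * ρ) * (Real.exp (4 * ρ) - 1) := by
    have hθ : d / (2 * ρ) ≤ 1 := (div_le_one (by positivity)).2 hd1
    have h := convexOn_exp.2 (Set.mem_univ (0 : ℝ)) (Set.mem_univ (4 * ρ))
      (sub_nonneg.2 hθ) (show 0 ≤ d / (2 * ρ) by positivity) (by ring)
    simp only [smul_eq_mul, mul_zero, zero_add, Real.exp_zero, mul_one] at h
    have e : d / (2 * ρ) * (4 * ρ) = 2 * d := by field_simp; ring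
    rw [e] at h
    linarith
  have he : (1 - ρ) ^ 2 * Real.exp (4 * ρ) ≤ (1 + ρ) ^ 2 := by
    have h := exp_two_mul_le h0 hw
    have e : Real.exp (4 * ρ) = Real.exp (2 * ρ) ^ 2 := by rw [sq, ← Real.exp_add]; ring_nf
    rw [e, ← mul_pow]
    have : 0 ≤ (1 - ρ) * Real.exp (2 * ρ) := mul_nonneg (by linarith) (Real.exp_nonneg _)
    gcongr
  have e2 : Real.exp d ^ 2 = Real.exp (2 * d) := by rw [sq, ← Real.exp_add]; ring_nf
  rw [mul_pow, e2, hsq]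
  have h5 := mul_le_mul_of_nonneg_left hconv (sq_nonneg (1 - ρ))
  have h6 : d / (2 * ρ) * ((1 - ρ) ^ 2 * (Real.exp (4 * ρ) - 1)) ≤ d / (2 * ρ) * (4 * ρ) :=
    mul_le_mul_of_nonneg_left (by linarith) (by positivity)
  have e : d / (2 * ρ) * (4 * ρ) = 2 * d := by field_simp; ring
  nlinarith

/-- `one_sub_norm_mul_exp_le` is applied to each factor with w = q^{i+1}, and the exponents
|q|^{i+1} - Re q^{i+1} sum as geometric series. -/
lemma norm_partitionGenFun_le {q : ℂ} (hq : ‖q‖ < 1) :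
    ‖partitionGenFun q‖ ≤ ‖partitionGenFun (‖q‖ : ℂ)‖ *
      Real.exp (-(‖q‖ / (1 - ‖q‖) - (q / (1 - q)).re)) := by
  set r := ‖q‖ with hr
  have hr0 : 0 ≤ r := norm_nonneg q
  have hrq : ‖(r : ℂ)‖ = r := by rw [Complex.norm_real, Real.norm_eq_abs, abs_of_nonneg hr0]
  have hr1 : ‖(r : ℂ)‖ < 1 := by rwa [hrq]
  rw [partitionGenFun_eq hq, partitionGenFun_eq hr1]
  have hs1 : HasSum (fun i : ℕ => r ^ (i + 1)) (r / (1 - r)) := by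
    simpa [pow_succ', div_eq_mul_inv] using (hasSum_geometric_of_lt_one hr0 hq).mul_left r
  have hs2 : HasSum (fun i : ℕ => q ^ (i + 1)) (q / (1 - q)) := by
    simpa [pow_succ', div_eq_mul_inv] using (hasSum_geometric_of_norm_lt_one hq).mul_left q
  have hs3 := (hs1.sub (Complex.reCLM.hasSum hs2)).tendsto_sum_nat
  have hs4 := ((Real.continuous_exp.tendsto _).comp hs3.neg)
  refine le_of_tendsto_of_tendsto' (tendsto_prod_inv hq).norm
    ((tendsto_prod_inv hr1).norm.mul hs4) fun M => ?_
  simp only [Function.comp_apply, norm_inv, norm_prod, ← Finset.sum_neg_distrib, Real.exp_sum,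
    ← Finset.prod_inv_distrib]
  rw [← Finset.prod_mul_distrib]
  refine Finset.prod_le_prod (fun i _ => by positivity) fun i _ => ?_
  have hw : ‖q ^ (i + 1)‖ < 1 := by
    rw [norm_pow]; exact pow_lt_one₀ (norm_nonneg _) hq (Nat.succ_ne_zero i)
  have h := one_sub_norm_mul_exp_le hw
  rw [norm_pow, ← hr] at h hw
  have e1 : ‖1 - (r : ℂ) ^ (i + 1)‖ = 1 - r ^ (i + 1) := by
    rw [← Complex.ofReal_pow, ← Complex.ofReal_one, ← Complex.ofReal_sub, Complex.norm_real,
      Real.norm_eq_abs, abs_of_pos (by linarith)]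
  rw [e1, Real.exp_neg, ← mul_inv]
  have hp : 0 < (1 - r ^ (i + 1)) * Real.exp (r ^ (i + 1) - Complex.reCLM (q ^ (i + 1))) :=
    mul_pos (by linarith) (Real.exp_pos _)
  exact inv_anti₀ hp h

/-! ### Modular transformation and behaviour near q = 1 -/

open Complex in
/-- The modular transformation of the partition generating function. -/
lemma partitionGenFun_exp_neg {z : ℂ} (hz : 0 < z.re) :
    partitionGenFun (cexp (-z)) = cexp (log (z / (2 * Real.pi)) / 2) *
      cexp (Real.pi ^ 2 / (6 * z) - z / 24) * partitionGenFun (cexp (-(4 * Real.pi ^ 2 / z))) := by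
  have hπ : (Real.pi : ℂ) ≠ 0 := by exact_mod_cast Real.pi_ne_zero
  have hz0 : z ≠ 0 := fun h => by simp [h] at hz
  have hzi : 0 < (4 * Real.pi ^ 2 / z).re := by
    have : (4 * Real.pi ^ 2 / z : ℂ) = ((4 * Real.pi ^ 2 : ℝ) : ℂ) * z⁻¹ := by push_cast; rfl
    rw [this, re_ofReal_mul, inv_re]
    have := normSq_pos.2 hz0
    positivity
  have hn1 : ‖cexp (-z)‖ < 1 := by
    rw [norm_exp, Real.exp_lt_one_iff, neg_re]; linarith
  have hn2 : ‖cexp (-(4 * Real.pi ^ 2 / z))‖ < 1 := by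
    rw [norm_exp, Real.exp_lt_one_iff, neg_re]; linarith
  set τ : ℂ := I * (z / (2 * Real.pi)) with hτ
  have hwre : 0 < (z / (2 * Real.pi)).re := by
    have : (z / (2 * Real.pi) : ℂ) = z / ((2 * Real.pi : ℝ) : ℂ) := by push_cast; rfl
    rw [this, div_ofReal_re]
    positivity
  have hτim : 0 < τ.im := by simpa [hτ, mul_im] using hwre
  have hw0 : z / (2 * Real.pi : ℂ) ≠ 0 := fun h => by simp [h] at hwre
  have hτ0 : τ ≠ 0 := mul_ne_zero I_ne_zero hw0
  have h := ModularForm.eta_comp_eq_csqrt_I_inv (show τ ∈ UpperHalfPlane.upperHalfPlaneSet from hτim)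
  -- Since z/(2π) has positive real part, the two arguments add without leaving the principal
  -- branch; this fixes the sign of the square root.
  have hlog : log τ = log I + log (z / (2 * Real.pi)) := by
    rw [hτ, Complex.log_mul_eq_add_log_iff I_ne_zero hw0, arg_I]
    have h1 := abs_lt.1 (abs_arg_lt_pi_div_two_iff.2 (Or.inl hwre))
    constructor <;> linarith [h1.1, h1.2, Real.pi_pos]
  have hsq : (sqrt I)⁻¹ * sqrt τ = cexp (log (z / (2 * Real.pi)) / 2) := by
    rw [sqrt_eq_exp I_ne_zero, sqrt_eq_exp hτ0, hlog, ← exp_neg, ← exp_add]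
    congr 1
    ring
  simp only [Function.comp_apply, Pi.smul_apply, Pi.mul_apply, smul_eq_mul] at h
  rw [← mul_assoc, hsq] at h
  have q1 : ∀ n, ModularForm.eta_q n τ = cexp (-z) ^ (n + 1) := fun n => by
    rw [ModularForm.eta_q_eq_pow]
    congr 2
    rw [hτ]; field_simp; linear_combination I_sq
  have q2 : ∀ n, ModularForm.eta_q n (-1 / τ) = cexp (-(4 * Real.pi ^ 2 / z)) ^ (n + 1) := fun n => by
    rw [ModularForm.eta_q_eq_pow]
    congr 2
    rw [hτ]; field_simp; ring
  have r1 : Function.Periodic.qParam 24 τ = cexp (-z / 24) := by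
    rw [Function.Periodic.qParam]
    congr 1
    rw [hτ]; push_cast; field_simp; linear_combination I_sq
  have r2 : Function.Periodic.qParam 24 (-1 / τ) = cexp (-(Real.pi ^ 2 / (6 * z))) := by
    rw [Function.Periodic.qParam]
    congr 1
    rw [hτ]; push_cast; field_simp; ring
  rw [ModularForm.eta, ModularForm.eta, r1, r2] at h
  simp only [q1, q2] at h
  rw [partitionGenFun_eq hn1, partitionGenFun_eq hn2, sub_eq_add_neg, exp_add]
  have t1 := tprod_one_sub_pow_ne_zero hn1
  have t2 := tprod_one_sub_pow_ne_zero hn2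
  have e1 : cexp (Real.pi ^ 2 / (6 * z)) * cexp (-(Real.pi ^ 2 / (6 * z))) = 1 := by
    rw [← exp_add]; simp
  rw [← neg_div]
  generalize (∏' i : ℕ, (1 - cexp (-z) ^ (i + 1))) = P₁ at *
  generalize (∏' i : ℕ, (1 - cexp (-(4 * Real.pi ^ 2 / z)) ^ (i + 1))) = P₂ at *
  generalize cexp (-(Real.pi ^ 2 / (6 * z))) = A' at *
  generalize cexp (Real.pi ^ 2 / (6 * z)) = A at *
  rw [← div_eq_mul_inv, eq_div_iff t2, inv_mul_eq_iff_eq_mul₀ t1]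
  linear_combination A * h - P₂ * e1

lemma norm_partitionGenFun_sub_one_le : ∃ K : ℝ, 0 ≤ K ∧ ∀ q : ℂ, ‖q‖ ≤ 1 / 2 →
    ‖partitionGenFun q - 1‖ ≤ K * ‖q‖ := by
  have hs := summable_partition_mul_pow (x := 1 / 2) (by norm_num) (by norm_num)
  have hs1 : Summable fun n : ℕ => (Fintype.card (n + 1).Partition : ℝ) * (1 / 2) ^ n := by
    refine (((summable_nat_add_iff 1).2 hs).mul_left 2).congr fun n => ?_
    rw [pow_succ]; ring
  refine ⟨∑' n : ℕ, (Fintype.card (n + 1).Partition : ℝ) * (1 / 2) ^ n,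
    tsum_nonneg fun n => by positivity, fun q hq => ?_⟩
  have hq1 : ‖q‖ < 1 := by linarith
  have h0 := (summable_norm_partition_mul_pow hq1).of_norm.tsum_eq_zero_add
  have h1 : partitionGenFun q - 1 =
      ∑' n : ℕ, (Fintype.card (n + 1).Partition : ℂ) * q ^ (n + 1) := by
    rw [partitionGenFun, h0]; simp
  rw [h1]
  have h2 := hs1.hasSum.mul_right ‖q‖
  refine tsum_of_norm_bounded h2 fun n => ?_
  rw [norm_mul, norm_pow, pow_succ, Complex.norm_natCast, ← mul_assoc]
  gcongr

lemma exp_neg_inv_le {x : ℝ} (hx : 0 < x) : Real.exp (-x) ≤ 1 / x := by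
  rw [Real.exp_neg, ← one_div]
  exact one_div_le_one_div_of_le hx (by linarith [Real.add_one_le_exp x])

lemma nine_lt_pi_sq : (9 : ℝ) < Real.pi ^ 2 := by nlinarith [Real.pi_gt_three]

/-- In a sector, `F(e ^ (-z)) = √(z / 2π) e ^ (π² / 6z) (1 + O(z))`. -/
lemma exists_partitionGenFun_eq : ∃ C : ℝ, 0 ≤ C ∧ ∀ z : ℂ, 0 < z.re → z.re ≤ 1 →
    |z.im| ≤ z.re / 2 → ∃ R : ℂ, ‖R‖ ≤ C * z.re ∧
      partitionGenFun (Complex.exp (-z)) = Complex.exp (Complex.log (z / (2 * Real.pi)) / 2) *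
        Complex.exp (Real.pi ^ 2 / (6 * z)) * (1 + R) := by
  obtain ⟨K, hK, hF⟩ := norm_partitionGenFun_sub_one_le
  refine ⟨1 + K + K, by positivity, fun z hz hz1 him => ?_⟩
  set t := z.re with ht
  set q' : ℂ := Complex.exp (-(4 * Real.pi ^ 2 / z)) with hq'
  have hzn : ‖z‖ ≤ 2 * t := by
    have := Complex.norm_le_abs_re_add_abs_im z
    rw [← ht, abs_of_pos hz] at this
    linarith
  have hz0 : z ≠ 0 := fun h => by rw [ht, h] at hz; simp at hz
  have hzpos : 0 < ‖z‖ := norm_pos_iff.2 hz0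
  have hqn : ‖q'‖ ≤ t / 9 := by
    rw [hq', Complex.norm_exp]
    have e1 : (-(4 * Real.pi ^ 2 / z) : ℂ).re = -(4 * Real.pi ^ 2 * (t / ‖z‖ ^ 2)) := by
      have : (4 * Real.pi ^ 2 / z : ℂ) = ((4 * Real.pi ^ 2 : ℝ) : ℂ) * z⁻¹ := by push_cast; rfl
      rw [Complex.neg_re, this, Complex.re_ofReal_mul, Complex.inv_re, Complex.normSq_eq_norm_sq]
    -- In the sector |z| ≤ 2t, so the exponent is at least π²/t > 9/t; the transformed nome is then
    -- far smaller than any power of t, and t/9 suffices.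
    have e2 : 9 / t ≤ 4 * Real.pi ^ 2 * (t / ‖z‖ ^ 2) := by
      have h4 : ‖z‖ ^ 2 ≤ (2 * t) ^ 2 := by gcongr
      rw [mul_div_assoc', div_le_div_iff₀ hz (by positivity)]
      nlinarith [nine_lt_pi_sq, sq_nonneg t]
    rw [e1]
    calc Real.exp (-(4 * Real.pi ^ 2 * (t / ‖z‖ ^ 2))) ≤ Real.exp (-(9 / t)) := by
          rw [Real.exp_le_exp]; linarith
      _ ≤ 1 / (9 / t) := exp_neg_inv_le (by positivity)
      _ = t / 9 := by rw [one_div_div]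
  have hF1 := hF q' (by linarith)
  have hF2 : ‖partitionGenFun q' - 1‖ ≤ K * t := hF1.trans (by gcongr; linarith)
  have hF3 : ‖partitionGenFun q'‖ ≤ 1 + K := by
    have h1 : ‖partitionGenFun q'‖ ≤ ‖partitionGenFun q' - 1‖ + ‖(1 : ℂ)‖ := by
      have := norm_add_le (partitionGenFun q' - 1) 1
      rwa [sub_add_cancel] at this
    rw [norm_one] at h1
    have h2 : K * t ≤ K * 1 := by gcongr
    linarith
  have hE : ‖Complex.exp (-(z / 24)) - 1‖ ≤ t := by
    have h1 : ‖-(z / 24)‖ = ‖z‖ / 24 := by simp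
    have h2 := Complex.norm_exp_sub_one_le (x := -(z / 24)) (by rw [h1]; linarith)
    rw [h1] at h2
    linarith
  refine ⟨Complex.exp (-(z / 24)) * partitionGenFun q' - 1, ?_, ?_⟩
  · have h1 : Complex.exp (-(z / 24)) * partitionGenFun q' - 1 =
        (Complex.exp (-(z / 24)) - 1) * partitionGenFun q' + (partitionGenFun q' - 1) := by ring
    rw [h1]
    calc _ ≤ ‖Complex.exp (-(z / 24)) - 1‖ * ‖partitionGenFun q'‖ + ‖partitionGenFun q' - 1‖ := by
          refine (norm_add_le _ _).trans ?_
          rw [norm_mul]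
      _ ≤ t * (1 + K) + K * t := by gcongr
      _ = _ := by ring
  · rw [partitionGenFun_exp_neg hz, sub_eq_add_neg, Complex.exp_add]
    ring

/-! ### Gaussian approximation near the saddle point -/

/-- Keeping only the real part makes the error quadratic in B. With B of size N|u|³ and Gaussian
scale u ~ N^{-1/2}, this gives a relative error O(1/N); a bound linear in B would give only
N^{-1/2}. -/
lemma abs_exp_mul_cos_sub_one_le {A B : ℝ} (hA : 0 ≤ A) :
    |Real.exp A * Real.cos B - 1| ≤ Real.exp A * (A + B ^ 2 / 2) := by
  have h1 : Real.exp A - 1 ≤ A * Real.exp A := by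
    have h2 := Real.add_one_le_exp (-A)
    have h3 : Real.exp (-A) * Real.exp A = 1 := by rw [← Real.exp_add]; simp
    nlinarith [Real.exp_pos A]
  have h4 := Real.one_sub_sq_div_two_le_cos (x := B)
  have h5 := Real.cos_le_one B
  have h6 := Real.exp_pos A
  have h7 := Real.one_le_exp hA
  rw [abs_le]
  constructor
  · have : 0 ≤ Real.exp A * A := by positivity
    nlinarith
  · have : 0 ≤ Real.exp A * (B ^ 2 / 2) := by positivity
    nlinarith

lemma poly_le_exp {v : ℝ} (hv : 0 ≤ v) : v + v ^ 2 + v ^ 3 ≤ 250 * Real.exp (3 * v / 10) := by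
  have hx : 0 ≤ 3 * v / 10 := by positivity
  have h1 := Real.pow_div_factorial_le_exp _ hx 1
  have h2 := Real.pow_div_factorial_le_exp _ hx 2
  have h3 := Real.pow_div_factorial_le_exp _ hx 3
  simp only [Nat.factorial] at h1 h2 h3
  norm_num at h1 h2 h3
  nlinarith

/-- The exponent of the integrand of the saddle point integral, without its Gaussian part. -/
noncomputable def saddleExponent (N u : ℝ) : ℂ :=
  Complex.log (1 + u * Complex.I) / 2 +
    ((N / (1 + u ^ 2) * u ^ 4 : ℝ) + (N / (1 + u ^ 2) * u ^ 3 : ℝ) * Complex.I)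

lemma saddleExponent_re (N u : ℝ) : (saddleExponent N u).re =
    Real.log ‖1 + (u : ℂ) * Complex.I‖ / 2 + N / (1 + u ^ 2) * u ^ 4 := by
  rw [saddleExponent]
  generalize N / (1 + u ^ 2) * u ^ 4 = a
  generalize N / (1 + u ^ 2) * u ^ 3 = b
  simp [Complex.log_re]

lemma saddleExponent_im (N u : ℝ) : (saddleExponent N u).im =
    (Complex.log (1 + u * Complex.I)).im / 2 + N / (1 + u ^ 2) * u ^ 3 := by
  rw [saddleExponent]
  generalize N / (1 + u ^ 2) * u ^ 4 = a
  generalize N / (1 + u ^ 2) * u ^ 3 = b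
  simp

lemma saddleExponent_re_nonneg {N : ℝ} (hN : 0 < N) (u : ℝ) : 0 ≤ (saddleExponent N u).re := by
  have h2 : 1 ≤ ‖1 + (u : ℂ) * Complex.I‖ := by
    have := Complex.abs_re_le_norm (1 + (u : ℂ) * Complex.I)
    simpa using this
  rw [saddleExponent_re]
  have := Real.log_nonneg h2
  positivity

lemma saddleExponent_re_le {N u : ℝ} :
    (saddleExponent N u).re ≤ u ^ 2 / 4 + N / (1 + u ^ 2) * u ^ 4 := by
  have h2 : ‖1 + (u : ℂ) * Complex.I‖ ^ 2 = 1 + u ^ 2 := by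
    rw [Complex.sq_norm, Complex.normSq_apply]; simp; ring
  have h3 : Real.log (1 + u ^ 2) ≤ u ^ 2 := by
    have := Real.log_le_sub_one_of_pos (show 0 < 1 + u ^ 2 by positivity)
    linarith
  rw [← h2, Real.log_pow] at h3
  push_cast at h3
  rw [saddleExponent_re]
  linarith

lemma abs_saddleExponent_im_le {N u : ℝ} (hN : 0 < N) (hu : |u| ≤ 1 / 2) :
    |(saddleExponent N u).im| ≤ 3 / 4 * |u| + N * |u| ^ 3 := by
  have h2 : ‖(u : ℂ) * Complex.I‖ = |u| := by simp
  have h3 := Complex.norm_log_one_add_half_le_self (z := (u : ℂ) * Complex.I) (by rw [h2]; exact hu)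
  rw [h2] at h3
  have h4 := (Complex.abs_im_le_norm _).trans h3
  have h5 : |N / (1 + u ^ 2) * u ^ 3| ≤ N * |u| ^ 3 := by
    rw [abs_mul, abs_pow, abs_of_nonneg (by positivity : 0 ≤ N / (1 + u ^ 2))]
    gcongr
    exact div_le_self hN.le (by nlinarith [sq_nonneg u])
  rw [saddleExponent_im]
  refine (abs_add_le _ _).trans ?_
  rw [abs_div, abs_two]
  linarith

lemma abs_saddle_sub_gaussian_le {N u : ℝ} (hN : 0 < N) (hu : |u| ≤ 1 / 2) (R : ℂ) :
    |Real.exp (-N * u ^ 2) * (Complex.exp (saddleExponent N u) * (1 + R)).re -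
      Real.exp (-N * u ^ 2)| ≤ (500 / N + 2 * ‖R‖) * Real.exp (-(N / 2) * u ^ 2) := by
  set h := saddleExponent N u with hh
  set v := N * u ^ 2 with hv
  have hv0 : 0 ≤ v := by positivity
  have hu2 : u ^ 2 ≤ 1 / 4 := by
    have : |u| ^ 2 ≤ (1 / 2) ^ 2 := by gcongr
    rw [sq_abs] at this
    linarith
  have hA0 := saddleExponent_re_nonneg hN u
  have hA1 : h.re ≤ u ^ 2 / 4 + N / (1 + u ^ 2) * u ^ 4 := saddleExponent_re_le
  have hB := abs_saddleExponent_im_le hN hu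
  rw [← hh] at hA0 hB
  -- For u² ≤ 1/4 one has u²/(1+u²) ≤ 1/5, so e^{-v} e^{Re h} still decays like e^{-4v/5}. Spending
  -- 3v/10 on the polynomial in v leaves e^{-v/2}.
  have hA2 : h.re ≤ 1 / 16 + v / 5 := by
    have : N / (1 + u ^ 2) * u ^ 4 ≤ v / 5 := by
      rw [div_mul_eq_mul_div, div_le_iff₀ (by positivity), hv]
      nlinarith [mul_nonneg hN.le (sq_nonneg u)]
    linarith
  have hA3 : h.re ≤ u ^ 2 * (1 / 4 + v) := by
    have : N / (1 + u ^ 2) * u ^ 4 ≤ N * u ^ 4 := by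
      gcongr
      exact div_le_self hN.le (by nlinarith [sq_nonneg u])
    rw [hv]
    nlinarith
  have hB2 : h.im ^ 2 / 2 ≤ u ^ 2 * (9 / 16 + v ^ 2) := by
    have h1 : h.im ^ 2 ≤ (3 / 4 * |u| + N * |u| ^ 3) ^ 2 := by
      rw [← sq_abs h.im]; gcongr
    have h2 : (3 / 4 * |u| + N * |u| ^ 3) ^ 2 = |u| ^ 2 * (3 / 4 + N * |u| ^ 2) ^ 2 := by ring
    rw [h2, sq_abs, ← hv] at h1
    have h3 : (3 / 4 + v) ^ 2 ≤ 2 * (9 / 16 + v ^ 2) := by nlinarith [sq_nonneg (3 / 4 - v)]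
    have h4 := mul_le_mul_of_nonneg_left h3 (sq_nonneg u)
    linarith
  have hAB : h.re + h.im ^ 2 / 2 ≤ (v + v ^ 2 + v ^ 3) / N := by
    have : (v + v ^ 2 + v ^ 3) / N = u ^ 2 * (1 + v + v ^ 2) := by
      rw [hv]; field_simp
    rw [this]
    nlinarith [sq_nonneg u]
  have hexp : Real.exp (-v) * Real.exp h.re ≤ 2 * Real.exp (-(4 * v / 5)) := by
    have e1 : Real.exp (1 / 16) ≤ 2 := by
      have := Real.exp_one_lt_d9
      have h2 : Real.exp (1 / 16) ^ 16 = Real.exp 1 := by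
        rw [← Real.exp_nat_mul]; norm_num
      by_contra hc
      push Not at hc
      have h3 : (2 : ℝ) ^ 16 < Real.exp (1 / 16) ^ 16 := by gcongr
      norm_num at h3
      linarith
    rw [← Real.exp_add]
    calc Real.exp (-v + h.re) ≤ Real.exp (1 / 16 + -(4 * v / 5)) := by
          rw [Real.exp_le_exp]; linarith
      _ = Real.exp (1 / 16) * Real.exp (-(4 * v / 5)) := Real.exp_add _ _
      _ ≤ _ := by gcongr
  have hre : (Complex.exp h * (1 + R)).re =
      Real.exp h.re * Real.cos h.im + (Complex.exp h * R).re := by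
    rw [mul_add, mul_one, Complex.add_re, Complex.exp_re]
  have hR : |(Complex.exp h * R).re| ≤ Real.exp h.re * ‖R‖ := by
    refine (Complex.abs_re_le_norm _).trans (le_of_eq ?_)
    rw [norm_mul, Complex.norm_exp]
  have hcos := abs_exp_mul_cos_sub_one_le (B := h.im) hA0
  have e0 : -N * u ^ 2 = -v := by rw [hv]; ring
  have e5 : -(N / 2) * u ^ 2 = -(v / 2) := by rw [hv]; ring
  rw [e0, e5, hre]
  have e6 : Real.exp (-v) * (Real.exp h.re * Real.cos h.im + (Complex.exp h * R).re) -
      Real.exp (-v) = Real.exp (-v) * ((Real.exp h.re * Real.cos h.im - 1) +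
        (Complex.exp h * R).re) := by ring
  rw [e6, abs_mul, abs_of_pos (Real.exp_pos _)]
  have hpoly := poly_le_exp hv0
  have e7 : Real.exp (-(4 * v / 5)) * Real.exp (3 * v / 10) = Real.exp (-(v / 2)) := by
    rw [← Real.exp_add]; congr 1; ring
  have e8 : Real.exp (-(4 * v / 5)) ≤ Real.exp (-(v / 2)) := by
    rw [Real.exp_le_exp]; linarith
  calc Real.exp (-v) * |(Real.exp h.re * Real.cos h.im - 1) + (Complex.exp h * R).re|
      ≤ Real.exp (-v) * (Real.exp h.re * ((v + v ^ 2 + v ^ 3) / N) + Real.exp h.re * ‖R‖) := by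
        gcongr
        refine (abs_add_le _ _).trans (add_le_add (hcos.trans ?_) hR)
        gcongr
    _ = Real.exp (-v) * Real.exp h.re * ((v + v ^ 2 + v ^ 3) / N + ‖R‖) := by ring
    _ ≤ 2 * Real.exp (-(4 * v / 5)) * (250 * Real.exp (3 * v / 10) / N + ‖R‖) := by gcongr
    _ = 500 / N * (Real.exp (-(4 * v / 5)) * Real.exp (3 * v / 10)) +
        2 * ‖R‖ * Real.exp (-(4 * v / 5)) := by ring
    _ ≤ 500 / N * Real.exp (-(v / 2)) + 2 * ‖R‖ * Real.exp (-(v / 2)) := by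
        rw [e7]; gcongr
    _ = _ := by ring

/-! ### Cauchy's integral and the saddle point estimate -/

/-- The integrand of Cauchy's formula on the circle of radius `e ^ (-t)`, at the angle `t u`. -/
noncomputable def saddleIntegrand (n : ℕ) (t u : ℝ) : ℂ :=
  partitionGenFun (Complex.exp (-(t * (1 + u * Complex.I)))) *
    Complex.exp (n * (t * (1 + u * Complex.I)))

lemma norm_exp_neg_saddle (t u : ℝ) :
    ‖Complex.exp (-(t * (1 + u * Complex.I)))‖ = Real.exp (-t) := by
  rw [Complex.norm_exp]; simp

lemma integral_exp_saddle {t : ℝ} (ht : 0 < t) (n m : ℕ) :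
    ∫ u in (-(Real.pi / t))..(Real.pi / t),
      Complex.exp (-(t * (1 + u * Complex.I))) ^ m * Complex.exp (n * (t * (1 + u * Complex.I))) =
      if m = n then 2 * Real.pi / t else 0 := by
  have htc : (t : ℂ) ≠ 0 := by exact_mod_cast ht.ne'
  have hπ : (Real.pi : ℂ) ≠ 0 := by exact_mod_cast Real.pi_ne_zero
  have h1 : ∀ u : ℝ, Complex.exp (-(t * (1 + u * Complex.I))) ^ m *
      Complex.exp (n * (t * (1 + u * Complex.I))) =
      Complex.exp (((n : ℂ) - m) * t) * Complex.exp ((((n : ℂ) - m) * t * Complex.I) * u) := by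
    intro u
    rw [← Complex.exp_nat_mul, ← Complex.exp_add, ← Complex.exp_add]
    congr 1
    ring
  simp only [h1]
  rw [intervalIntegral.integral_const_mul]
  split_ifs with h
  · subst h
    simp
    ring
  · have hc : ((n : ℂ) - m) * t * Complex.I ≠ 0 := by
      refine mul_ne_zero (mul_ne_zero ?_ htc) Complex.I_ne_zero
      rw [sub_ne_zero]
      exact Nat.cast_injective.ne (Ne.symm h)
    rw [integral_exp_mul_complex hc]
    have e : Complex.exp ((n - m) * t * Complex.I * ((Real.pi / t : ℝ) : ℂ)) =
        Complex.exp ((n - m) * t * Complex.I * ((-(Real.pi / t) : ℝ) : ℂ)) := by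
      rw [Complex.exp_eq_exp_iff_exists_int]
      refine ⟨(n : ℤ) - m, ?_⟩
      push_cast
      field_simp
      ring
    rw [e]
    simp

lemma hasSum_saddleIntegrand (n : ℕ) {t : ℝ} (ht : 0 < t) (u : ℝ) :
    HasSum (fun m : ℕ => (Fintype.card m.Partition : ℂ) *
      (Complex.exp (-(t * (1 + u * Complex.I))) ^ m *
        Complex.exp (n * (t * (1 + u * Complex.I))))) (saddleIntegrand n t u) := by
  have hq : ‖Complex.exp (-(t * (1 + u * Complex.I)))‖ < 1 := by
    rw [norm_exp_neg_saddle]; exact exp_neg_lt_one ht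
  have h2 := (summable_norm_partition_mul_pow hq).of_norm.hasSum.mul_right
    (Complex.exp (n * (t * (1 + u * Complex.I))))
  simp only [mul_assoc] at h2 ⊢
  exact h2

lemma norm_saddleIntegrand_term (n m : ℕ) (t u : ℝ) :
    ‖(Fintype.card m.Partition : ℂ) * (Complex.exp (-(t * (1 + u * Complex.I))) ^ m *
      Complex.exp (n * (t * (1 + u * Complex.I))))‖ =
      (Fintype.card m.Partition : ℝ) * Real.exp (-t) ^ m * Real.exp (n * t) := by
  rw [norm_mul, norm_mul, norm_pow, norm_exp_neg_saddle, Complex.norm_natCast, ← mul_assoc]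
  congr 1
  rw [Complex.norm_exp]
  simp

lemma card_partition_eq_integral (n : ℕ) {t : ℝ} (ht : 0 < t) :
    ∫ u in (-(Real.pi / t))..(Real.pi / t), saddleIntegrand n t u =
      (Fintype.card n.Partition : ℂ) * (2 * Real.pi / t) := by
  have hs := (summable_partition_mul_pow (Real.exp_nonneg (-t)) (exp_neg_lt_one ht)).mul_right
    (Real.exp (n * t))
  have hm : ∀ m : ℕ, Continuous fun u : ℝ => (Fintype.card m.Partition : ℂ) *
      (Complex.exp (-(t * (1 + u * Complex.I))) ^ m *
        Complex.exp (n * (t * (1 + u * Complex.I)))) := fun m => by fun_prop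
  have h := intervalIntegral.hasSum_integral_of_dominated_convergence
    (μ := MeasureTheory.volume) (a := -(Real.pi / t)) (b := Real.pi / t)
    (fun (m : ℕ) (_ : ℝ) => (Fintype.card m.Partition : ℝ) * Real.exp (-t) ^ m * Real.exp (n * t))
    (fun m => (hm m).aestronglyMeasurable)
    (fun m => Eventually.of_forall fun u _ => (norm_saddleIntegrand_term n m t u).le)
    (Eventually.of_forall fun u _ => hs)
    intervalIntegrable_const
    (Eventually.of_forall fun u _ => hasSum_saddleIntegrand n ht u)
  simp only [intervalIntegral.integral_const_mul, integral_exp_saddle ht] at h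
  rw [← h.tsum_eq, tsum_eq_single n fun m hm => by simp [hm]]
  simp

/-- The size of the integrand at the saddle point. -/
noncomputable def saddleSize (t : ℝ) : ℝ :=
  Real.sqrt (t / (2 * Real.pi)) * Real.exp (2 * (Real.pi ^ 2 / (6 * t)))

lemma saddleSize_pos {t : ℝ} (ht : 0 < t) : 0 < saddleSize t := by
  have := Real.pi_pos
  unfold saddleSize; positivity

lemma exp_half_log_eq {t : ℝ} (ht : 0 < t) {w : ℂ} (hw : w ≠ 0) :
    Complex.exp (Complex.log (t * w / (2 * Real.pi)) / 2) =
      (Real.sqrt (t / (2 * Real.pi)) : ℂ) * Complex.exp (Complex.log w / 2) := by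
  have hπ := Real.pi_pos
  have h1 : (t * w / (2 * Real.pi) : ℂ) = ((t / (2 * Real.pi) : ℝ) : ℂ) * w := by
    push_cast; ring
  rw [h1, Complex.log_ofReal_mul (by positivity) hw, add_div, Complex.exp_add]
  congr 1
  rw [Real.sqrt_eq_rpow, Real.rpow_def_of_pos (by positivity), Complex.ofReal_exp]
  congr 1
  push_cast
  ring

/-- With n t = π²/(6t) = N, the linear terms in u cancel: this is the saddle point condition. The
remainder after 2N - N u² is cubic and quartic, plus the logarithm from the square root factor. -/
lemma saddle_exponent_identity {N u : ℝ} : (N : ℂ) / (1 + u * Complex.I) +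
    N * (1 + u * Complex.I) + Complex.log (1 + u * Complex.I) / 2 =
      ((2 * N : ℝ) : ℂ) + ((-N * u ^ 2 : ℝ) : ℂ) + saddleExponent N u := by
  have h0 : (1 + u * Complex.I : ℂ) ≠ 0 := fun h => by
    have := congrArg Complex.re h
    simp at this
  have h1 : (1 + (u : ℂ) ^ 2) ≠ 0 := by
    have : (1 + u ^ 2 : ℝ) ≠ 0 := by positivity
    exact_mod_cast this
  rw [saddleExponent]
  push_cast
  have h2 : (N : ℂ) / (1 + u * Complex.I) = N * (1 - u * Complex.I) / (1 + (u : ℂ) ^ 2) := by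
    rw [div_eq_div_iff h0 h1]
    linear_combination (N : ℂ) * u ^ 2 * Complex.I_sq
  rw [h2]
  field_simp
  ring

lemma exists_saddleIntegrand_eq : ∃ C : ℝ, 0 ≤ C ∧ ∀ (n : ℕ) (t u : ℝ), 0 < t → t ≤ 1 →
    n * t = Real.pi ^ 2 / (6 * t) → |u| ≤ 1 / 2 → ∃ R : ℂ, ‖R‖ ≤ C * t ∧
      saddleIntegrand n t u = ((saddleSize t * Real.exp (-(Real.pi ^ 2 / (6 * t)) * u ^ 2) : ℝ) : ℂ) *
        (Complex.exp (saddleExponent (Real.pi ^ 2 / (6 * t)) u) * (1 + R)) := by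
  obtain ⟨C, hC, h⟩ := exists_partitionGenFun_eq
  refine ⟨C, hC, fun n t u ht ht1 hn hu => ?_⟩
  set N := Real.pi ^ 2 / (6 * t) with hN
  have hre : (t * (1 + u * Complex.I) : ℂ).re = t := by simp
  have him : (t * (1 + u * Complex.I) : ℂ).im = t * u := by simp
  obtain ⟨R, hR, hF⟩ := h (t * (1 + u * Complex.I)) (by rwa [hre]) (by rwa [hre]) (by
    rw [hre, him, abs_mul, abs_of_pos ht]
    nlinarith)
  rw [hre] at hR
  refine ⟨R, hR, ?_⟩
  have h0 : (1 + u * Complex.I : ℂ) ≠ 0 := fun h => by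
    have := congrArg Complex.re h
    simp at this
  have htc : (t : ℂ) ≠ 0 := by exact_mod_cast ht.ne'
  have hnc : (n : ℂ) * t = N := by exact_mod_cast hn
  have hNc : (Real.pi ^ 2 / (6 * (t * (1 + u * Complex.I))) : ℂ) = N / (1 + u * Complex.I) := by
    rw [hN]; push_cast; field_simp
  rw [saddleIntegrand, hF, exp_half_log_eq ht h0, hNc, ← mul_assoc (n : ℂ), hnc, saddleSize, ← hN]
  have hid := congrArg Complex.exp (saddle_exponent_identity (N := N) (u := u))
  simp only [Complex.exp_add] at hid
  push_cast at hid ⊢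
  linear_combination (Real.sqrt (t / (2 * Real.pi)) : ℂ) * (1 + R) * hid

lemma abs_saddleIntegrand_near_le : ∃ C : ℝ, 0 ≤ C ∧ ∀ (n : ℕ) (t u : ℝ), 0 < t → t ≤ 1 →
    n * t = Real.pi ^ 2 / (6 * t) → |u| ≤ 1 / 2 →
      |(saddleIntegrand n t u).re -
        saddleSize t * Real.exp (-(Real.pi ^ 2 / (6 * t)) * u ^ 2)| ≤
        saddleSize t * (C * t * Real.exp (-(Real.pi ^ 2 / (6 * t) / 2) * u ^ 2)) := by
  obtain ⟨C, hC, h⟩ := exists_saddleIntegrand_eq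
  refine ⟨500 + 2 * C, by positivity, fun n t u ht ht1 hn hu => ?_⟩
  obtain ⟨R, hR, he⟩ := h n t u ht ht1 hn hu
  have hN : 0 < Real.pi ^ 2 / (6 * t) := by have := Real.pi_pos; positivity
  have h1 := abs_saddle_sub_gaussian_le hN hu R
  have hS := saddleSize_pos ht
  have h2 : 500 / (Real.pi ^ 2 / (6 * t)) ≤ 500 * t := by
    rw [div_div_eq_mul_div, div_le_iff₀ (by positivity)]
    nlinarith [nine_lt_pi_sq]
  rw [he, Complex.re_ofReal_mul, mul_assoc, ← mul_sub, abs_mul, abs_of_pos hS]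
  gcongr
  refine h1.trans ?_
  gcongr
  linarith

lemma norm_partitionGenFun_real_le : ∃ C : ℝ, 0 ≤ C ∧ ∀ t : ℝ, 0 < t → t ≤ 1 →
    ‖partitionGenFun (Real.exp (-t) : ℂ)‖ ≤
      C * (Real.sqrt (t / (2 * Real.pi)) * Real.exp (Real.pi ^ 2 / (6 * t))) := by
  obtain ⟨C, hC, h⟩ := exists_partitionGenFun_eq
  refine ⟨1 + C, by positivity, fun t ht ht1 => ?_⟩
  obtain ⟨R, hR, hF⟩ := h t (by simpa) (by simpa) (by simp; positivity)
  have h1 := exp_half_log_eq ht (w := 1) one_ne_zero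
  rw [mul_one] at h1
  have h2 : (Real.pi ^ 2 / (6 * t) : ℂ) = ((Real.pi ^ 2 / (6 * t) : ℝ) : ℂ) := by push_cast; rfl
  have h3 : Complex.exp (-(t : ℂ)) = (Real.exp (-t) : ℂ) := by push_cast; rfl
  rw [← h3, hF, h1, h2, ← Complex.ofReal_exp, norm_mul, norm_mul, norm_mul, Complex.norm_real,
    Complex.norm_real, Real.norm_eq_abs, Real.norm_eq_abs, abs_of_nonneg (Real.sqrt_nonneg _),
    abs_of_pos (Real.exp_pos _)]
  have h4 : ‖1 + R‖ ≤ 1 + C := by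
    refine (norm_add_le _ _).trans ?_
    rw [norm_one]
    have : C * t ≤ C * 1 := by gcongr
    simp only [Complex.ofReal_re] at hR
    linarith
  simp only [Complex.log_one, zero_div, Complex.exp_zero, norm_one, mul_one]
  rw [mul_comm (1 + C)]
  gcongr

/-- Here 1 - cos(tu) ≥ 2(tu)²/π² ≥ t²/20, while 1 - r ≤ t, so |1 - q| exceeds 1 - r by the fixed
factor 51/50. The difference is thus at least r/(51(1-r)), and r/(1-r) ≥ 1/(2t). -/
lemma one_div_le_far_exponent {t u : ℝ} (ht : 0 < t) (ht1 : t ≤ 1 / 2) (hu : 1 / 2 ≤ |u|)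
    (hu1 : |u| ≤ Real.pi / t) :
    1 / (200 * t) ≤ Real.exp (-t) / (1 - Real.exp (-t)) -
      (Complex.exp (-(t * (1 + u * Complex.I))) /
        (1 - Complex.exp (-(t * (1 + u * Complex.I))))).re := by
  set q := Complex.exp (-(t * (1 + u * Complex.I))) with hq
  set r := Real.exp (-t) with hr
  have hqn : ‖q‖ = r := norm_exp_neg_saddle t u
  have hr1 : 0 < 1 - r := by linarith [exp_neg_lt_one ht]
  have hr2 : 1 - r ≤ t := by linarith [Real.add_one_le_exp (-t)]
  have hr3 : 1 / 2 ≤ r := by linarith [Real.add_one_le_exp (-t)]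
  have hqre : q.re = r * Real.cos (t * u) := by
    rw [hq, Complex.exp_re]; simp [hr]
  have hsq : ‖1 - q‖ ^ 2 = (1 - r) ^ 2 + 2 * r * (1 - Real.cos (t * u)) := by
    have e1 : r ^ 2 = q.re ^ 2 + q.im ^ 2 := by
      rw [← hqn, Complex.sq_norm, Complex.normSq_apply]; ring
    rw [Complex.sq_norm, Complex.normSq_apply]
    simp only [Complex.sub_re, Complex.one_re, Complex.sub_im, Complex.one_im]
    nlinarith
  have hcos := Real.cos_le_one_sub_mul_cos_sq (x := t * u) (by
    rw [abs_mul, abs_of_pos ht]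
    rwa [le_div_iff₀ ht, mul_comm] at hu1)
  have hu2 : 1 / 4 ≤ u ^ 2 := by
    rw [← sq_abs]; nlinarith [abs_nonneg u]
  have hπ2 : Real.pi ^ 2 ≤ 10 := by nlinarith [Real.pi_lt_d2, Real.pi_gt_three]
  have hlow : t ^ 2 / 20 ≤ 1 - Real.cos (t * u) := by
    have h1 : t ^ 2 / 20 ≤ 2 / Real.pi ^ 2 * (t * u) ^ 2 := by
      rw [div_mul_eq_mul_div, div_le_div_iff₀ (by norm_num) (by positivity), mul_pow]
      nlinarith [sq_nonneg t, mul_le_mul_of_nonneg_left hu2 (sq_nonneg t),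
        mul_le_mul_of_nonneg_left hπ2 (sq_nonneg t)]
    linarith
  have hnorm : (1 - r) * (51 / 50) ≤ ‖1 - q‖ := by
    refine le_of_sq_le_sq ?_ (norm_nonneg _)
    rw [hsq, mul_pow]
    have h1 : (1 - r) ^ 2 ≤ t ^ 2 := by gcongr
    have h2 : (1 / 2) * (t ^ 2 / 20) ≤ r * (1 - Real.cos (t * u)) := by gcongr
    nlinarith
  have hnpos : 0 < ‖1 - q‖ := lt_of_lt_of_le (by positivity) hnorm
  have hre : (q / (1 - q)).re ≤ r / (1 - r) * (50 / 51) := by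
    refine ((le_abs_self _).trans (Complex.abs_re_le_norm _)).trans ?_
    rw [norm_div, hqn, div_mul_div_comm]
    rw [div_le_div_iff₀ hnpos (by positivity)]
    nlinarith
  have hfin : 1 / (2 * t) ≤ r / (1 - r) := by
    rw [div_le_div_iff₀ (by positivity) hr1]
    nlinarith
  have h5 : 1 / (200 * t) = 1 / (2 * t) * (1 / 100) := by field_simp; norm_num
  rw [h5]
  have : 0 < 1 / (2 * t) := by positivity
  linarith

lemma norm_saddleIntegrand_far_le : ∃ C : ℝ, 0 ≤ C ∧ ∀ (n : ℕ) (t u : ℝ), 0 < t → t ≤ 1 / 2 →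
    n * t = Real.pi ^ 2 / (6 * t) → 1 / 2 ≤ |u| → |u| ≤ Real.pi / t →
      ‖saddleIntegrand n t u‖ ≤ saddleSize t * (C * t ^ 3) := by
  obtain ⟨C, hC, h⟩ := norm_partitionGenFun_real_le
  -- The constant comes from e^{-x} ≤ 3!/x³ at x = 1/(200t). A cube of t is kept because the range
  -- of u has length 2π/t, leaving t² after integration.
  refine ⟨C * (6 * 200 ^ 3), by positivity, fun n t u ht ht1 hn hu hu1 => ?_⟩
  have hq : ‖Complex.exp (-(t * (1 + u * Complex.I)))‖ < 1 := by
    rw [norm_exp_neg_saddle]; exact exp_neg_lt_one ht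
  have h1 := norm_partitionGenFun_le hq
  rw [norm_exp_neg_saddle] at h1
  have h2 := h t ht (by linarith)
  have h3 := one_div_le_far_exponent ht ht1 hu hu1
  have h4 : ‖Complex.exp (n * (t * (1 + u * Complex.I)))‖ = Real.exp (Real.pi ^ 2 / (6 * t)) := by
    rw [Complex.norm_exp, ← hn]; simp
  have h5 : Real.exp (-(1 / (200 * t))) ≤ 6 * 200 ^ 3 * t ^ 3 := by
    have hx : 0 < 1 / (200 * t) := by positivity
    have h6 := Real.pow_div_factorial_le_exp _ hx.le 3
    rw [Real.exp_neg]
    have h7 : ((1 / (200 * t)) ^ 3 / (Nat.factorial 3 : ℝ))⁻¹ = 6 * 200 ^ 3 * t ^ 3 := by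
      simp only [Nat.factorial]; push_cast; field_simp
    rw [← h7]
    exact inv_anti₀ (by positivity) h6
  rw [saddleIntegrand, norm_mul, h4]
  calc _ ≤ (C * (Real.sqrt (t / (2 * Real.pi)) * Real.exp (Real.pi ^ 2 / (6 * t))) *
        Real.exp (-(1 / (200 * t)))) * Real.exp (Real.pi ^ 2 / (6 * t)) := by
        gcongr
        refine h1.trans ?_
        gcongr
    _ ≤ (C * (Real.sqrt (t / (2 * Real.pi)) * Real.exp (Real.pi ^ 2 / (6 * t))) *
        (6 * 200 ^ 3 * t ^ 3)) * Real.exp (Real.pi ^ 2 / (6 * t)) := by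
        gcongr
    _ = _ := by
        rw [saddleSize, two_mul (Real.pi ^ 2 / (6 * t)), Real.exp_add]; ring

lemma continuous_saddleIntegrand (n : ℕ) {t : ℝ} (ht : 0 < t) :
    Continuous (saddleIntegrand n t) := by
  have hs := (summable_partition_mul_pow (Real.exp_nonneg (-t)) (exp_neg_lt_one ht)).mul_right
    (Real.exp (n * t))
  have h1 : saddleIntegrand n t = fun u : ℝ => ∑' m : ℕ, (Fintype.card m.Partition : ℂ) *
      (Complex.exp (-(t * (1 + u * Complex.I))) ^ m *
        Complex.exp (n * (t * (1 + u * Complex.I)))) :=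
    funext fun u => (hasSum_saddleIntegrand n ht u).tsum_eq.symm
  rw [h1]
  exact continuous_tsum (fun m => by fun_prop) hs
    fun m u => (norm_saddleIntegrand_term n m t u).le

lemma gaussian_le_of_half_le {t u : ℝ} (ht : 0 < t) (hu : 1 / 2 ≤ |u|) :
    Real.exp (-(Real.pi ^ 2 / (6 * t)) * u ^ 2) ≤
      8 * t * Real.exp (-(Real.pi ^ 2 / (6 * t) / 2) * u ^ 2) := by
  have hN : 1 / t ≤ Real.pi ^ 2 / (6 * t) := by
    rw [div_le_div_iff₀ ht (by positivity)]
    nlinarith [nine_lt_pi_sq]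
  set N := Real.pi ^ 2 / (6 * t)
  have ht' : 0 < 1 / t := by positivity
  have hu2 : 1 / 4 ≤ u ^ 2 := by
    rw [← sq_abs]; nlinarith [abs_nonneg u]
  have e1 : -N * u ^ 2 = -(N / 2 * u ^ 2) + -(N / 2) * u ^ 2 := by ring
  rw [e1, Real.exp_add]
  gcongr
  calc Real.exp (-(N / 2 * u ^ 2)) ≤ Real.exp (-(1 / t / 8)) := by
        rw [Real.exp_le_exp]
        nlinarith
    _ ≤ 1 / (1 / t / 8) := exp_neg_inv_le (by positivity)
    _ = 8 * t := by field_simp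

lemma abs_integral_saddle_sub_le : ∃ C : ℝ, 0 ≤ C ∧ ∀ (n : ℕ) (t : ℝ), 0 < t → t ≤ 1 / 2 →
    n * t = Real.pi ^ 2 / (6 * t) →
      |(Fintype.card n.Partition : ℝ) * (2 * Real.pi / t) -
        saddleSize t * Real.sqrt (Real.pi / (Real.pi ^ 2 / (6 * t)))| ≤
        saddleSize t * (C * t * Real.sqrt (Real.pi / (Real.pi ^ 2 / (6 * t) / 2)) + C * t ^ 2) := by
  obtain ⟨C₁, hC₁, hnear⟩ := abs_saddleIntegrand_near_le
  obtain ⟨C₂, hC₂, hfar⟩ := norm_saddleIntegrand_far_le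
  have hπ := Real.pi_pos
  refine ⟨C₁ + 8 + C₂ * (2 * Real.pi), by positivity, fun n t ht ht1 hn => ?_⟩
  set N := Real.pi ^ 2 / (6 * t) with hN
  have hN0 : 0 < N := by positivity
  set S := saddleSize t with hS
  have hS0 : 0 < S := saddleSize_pos ht
  have hL : 1 / 2 ≤ Real.pi / t := by
    rw [div_le_div_iff₀ (by norm_num) ht]; linarith [Real.pi_gt_three]
  set I : Set ℝ := Set.Ioc (-(Real.pi / t)) (Real.pi / t) with hI
  set g : ℝ → ℝ := fun u => (saddleIntegrand n t u).re with hg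
  have hgc : Continuous g := Complex.continuous_re.comp (continuous_saddleIntegrand n ht)
  have hint : ∫ u, I.indicator g u = (Fintype.card n.Partition : ℝ) * (2 * Real.pi / t) := by
    rw [MeasureTheory.integral_indicator measurableSet_Ioc,
      ← intervalIntegral.integral_of_le (by linarith)]
    have h1 := Complex.reCLM.intervalIntegral_comp_comm
      ((continuous_saddleIntegrand n ht).intervalIntegrable (μ := MeasureTheory.volume)
        (-(Real.pi / t)) (Real.pi / t))
    rw [card_partition_eq_integral n ht] at h1
    refine h1.trans ?_
    have e : (Fintype.card n.Partition : ℂ) * (2 * Real.pi / t) =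
        (((Fintype.card n.Partition : ℝ) * (2 * Real.pi / t) : ℝ) : ℂ) := by push_cast; rfl
    rw [e]
    exact Complex.ofReal_re _
  have hig : MeasureTheory.Integrable (I.indicator g) :=
    (MeasureTheory.integrable_indicator_iff measurableSet_Ioc).2
      (hgc.integrableOn_Ioc)
  have hi1 := (integrable_exp_neg_mul_sq hN0).const_mul S
  have hi2 := integrable_exp_neg_mul_sq (half_pos hN0)
  have hi3 : MeasureTheory.Integrable (I.indicator fun _ => (1 : ℝ)) :=
    (MeasureTheory.integrable_indicator_iff measurableSet_Ioc).2 (by simp)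
  -- One integrable majorant on the whole line covers three regions: the saddle, the rest of the
  -- circle, and the Gaussian tail outside it. For |u| ≥ 1/2 the Gaussian itself is at most 8t times
  -- the wider one.
  have hbound : ∀ u, ‖I.indicator g u - S * Real.exp (-N * u ^ 2)‖ ≤
      S * ((C₁ + 8) * t * Real.exp (-(N / 2) * u ^ 2)) +
        S * (C₂ * t ^ 3) * I.indicator (fun _ => (1 : ℝ)) u := by
    intro u
    rw [Real.norm_eq_abs]
    have hE := Real.exp_pos (-(N / 2) * u ^ 2)
    have hE' := Real.exp_pos (-N * u ^ 2)
    by_cases hu : u ∈ I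
    · rw [Set.indicator_of_mem hu, Set.indicator_of_mem hu, mul_one]
      rcases le_total |u| (1 / 2) with h | h
      · refine (hnear n t u ht (by linarith) hn h).trans ?_
        rw [← hN, ← hS]
        have h1 : 0 ≤ S * (C₂ * t ^ 3) := by positivity
        have h2 : S * (C₁ * t * Real.exp (-(N / 2) * u ^ 2)) ≤
            S * ((C₁ + 8) * t * Real.exp (-(N / 2) * u ^ 2)) := by
          gcongr; linarith
        linarith
      · have h1 := (Complex.abs_re_le_norm _).trans
          (hfar n t u ht ht1 hn h (abs_le.2 ⟨hu.1.le, hu.2⟩))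
        have h2 := gaussian_le_of_half_le ht h
        rw [← hN] at h2
        have h3 : |g u - S * Real.exp (-N * u ^ 2)| ≤ |g u| + S * Real.exp (-N * u ^ 2) := by
          have := abs_sub (g u) (S * Real.exp (-N * u ^ 2))
          rwa [abs_of_pos (mul_pos hS0 hE')] at this
        have h4 : S * Real.exp (-N * u ^ 2) ≤
            S * ((C₁ + 8) * t * Real.exp (-(N / 2) * u ^ 2)) := by
          gcongr
          refine h2.trans ?_
          gcongr
          linarith
        linarith
    · rw [Set.indicator_of_notMem hu, Set.indicator_of_notMem hu, mul_zero, add_zero, zero_sub,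
        abs_neg, abs_of_pos (mul_pos hS0 hE')]
      have h : 1 / 2 ≤ |u| := by
        by_contra hc
        push Not at hc
        have := abs_lt.1 hc
        exact hu ⟨by linarith [this.1], by linarith [this.2]⟩
      have h2 := gaussian_le_of_half_le ht h
      rw [← hN] at h2
      gcongr
      refine h2.trans ?_
      gcongr
      linarith
  have hmain := MeasureTheory.norm_integral_le_of_norm_le
    (((hi2.const_mul ((C₁ + 8) * t)).const_mul S).add (hi3.const_mul (S * (C₂ * t ^ 3))))
    (Eventually.of_forall hbound)
  have hrhs : ∫ u, (S * ((C₁ + 8) * t * Real.exp (-(N / 2) * u ^ 2)) +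
      S * (C₂ * t ^ 3) * I.indicator (fun _ => (1 : ℝ)) u) =
      S * ((C₁ + 8) * t * Real.sqrt (Real.pi / (N / 2))) +
        S * (C₂ * t ^ 3) * (2 * Real.pi / t) := by
    rw [MeasureTheory.integral_add ((hi2.const_mul ((C₁ + 8) * t)).const_mul S)
      (hi3.const_mul (S * (C₂ * t ^ 3))), MeasureTheory.integral_const_mul,
      MeasureTheory.integral_const_mul, MeasureTheory.integral_const_mul, integral_gaussian,
      MeasureTheory.integral_indicator measurableSet_Ioc]
    congr 2
    rw [MeasureTheory.setIntegral_const, Real.volume_real_Ioc_of_le (by linarith)]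
    simp
    ring
  rw [MeasureTheory.integral_sub hig hi1, hint, MeasureTheory.integral_const_mul,
    integral_gaussian, Real.norm_eq_abs] at hmain
  refine hmain.trans ?_
  rw [show (∫ a, ((fun u => S * ((C₁ + 8) * t * Real.exp (-(N / 2) * u ^ 2))) +
    fun u => S * (C₂ * t ^ 3) * I.indicator (fun _ => (1 : ℝ)) u) a) = _ from hrhs]
  have e1 : S * (C₂ * t ^ 3) * (2 * Real.pi / t) = S * (C₂ * (2 * Real.pi) * t ^ 2) := by
    field_simp
  rw [e1, ← mul_add]
  refine mul_le_mul_of_nonneg_left (add_le_add ?_ ?_) hS0.le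
  · have h1 : C₁ + 8 ≤ C₁ + 8 + C₂ * (2 * Real.pi) := le_add_of_nonneg_right (by positivity)
    exact mul_le_mul_of_nonneg_right (mul_le_mul_of_nonneg_right h1 ht.le) (Real.sqrt_nonneg _)
  · exact mul_le_mul_of_nonneg_right (by linarith) (sq_nonneg t)

/-! ### The Hardy–Ramanujan formula with error term -/

/-- The leading term of the Hardy–Ramanujan formula. -/
noncomputable def hardyRamanujan (x : ℝ) : ℝ :=
  1 / (4 * Real.sqrt 3 * x) * Real.exp (Real.pi * Real.sqrt (2 * x / 3))

/-- The saddle point `π / √(6 x)`. -/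
noncomputable def saddlePoint (x : ℝ) : ℝ := Real.pi / Real.sqrt (6 * x)

lemma saddlePoint_pos {x : ℝ} (hx : 0 < x) : 0 < saddlePoint x := by
  have := Real.pi_pos
  unfold saddlePoint; positivity

lemma mul_saddlePoint {x : ℝ} (hx : 0 < x) :
    x * saddlePoint x = Real.pi ^ 2 / (6 * saddlePoint x) := by
  have h1 := Real.sq_sqrt (show 0 ≤ 6 * x by positivity)
  have h2 : 0 < Real.sqrt (6 * x) := by positivity
  have := Real.pi_pos
  unfold saddlePoint
  generalize Real.sqrt (6 * x) = s at h1 h2 ⊢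
  field_simp
  linarith

lemma two_mul_mul_saddlePoint {x : ℝ} (hx : 0 < x) :
    2 * (x * saddlePoint x) = Real.pi * Real.sqrt (2 * x / 3) := by
  have h2 : 0 < Real.sqrt (6 * x) := by positivity
  have h3 : Real.sqrt (2 * x / 3) = Real.sqrt (6 * x) / 3 := by
    rw [show 2 * x / 3 = 6 * x / 3 ^ 2 by ring, Real.sqrt_div' _ (by norm_num),
      Real.sqrt_sq (by norm_num)]
  have h1 := Real.sq_sqrt (show 0 ≤ 6 * x by positivity)
  rw [h3, saddlePoint]
  generalize Real.sqrt (6 * x) = s at h1 h2 ⊢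
  field_simp
  linarith

lemma hardyRamanujan_eq {x : ℝ} (hx : 0 < x) :
    saddlePoint x / (2 * Real.pi) * (saddleSize (saddlePoint x) *
      Real.sqrt (Real.pi / (Real.pi ^ 2 / (6 * saddlePoint x)))) = hardyRamanujan x := by
  have hπ := Real.pi_pos
  have ht := saddlePoint_pos hx
  rw [saddleSize, ← mul_saddlePoint hx, two_mul_mul_saddlePoint hx, hardyRamanujan,
    mul_right_comm (Real.sqrt _), ← Real.sqrt_mul (by positivity), ← mul_assoc]
  congr 1
  have h1 : saddlePoint x / (2 * Real.pi) * (Real.pi / (x * saddlePoint x)) =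
      3 / (6 * x) := by field_simp; norm_num
  have h2 := Real.sq_sqrt (show (0 : ℝ) ≤ 3 by norm_num)
  have h3 := Real.sq_sqrt (show 0 ≤ 6 * x by positivity)
  have h4 : 0 < Real.sqrt (6 * x) := by positivity
  rw [h1, Real.sqrt_div (by norm_num), saddlePoint]
  field_simp
  rw [h3, h2]
  ring

lemma hardyRamanujan_pos {x : ℝ} (hx : 0 < x) : 0 < hardyRamanujan x := by
  unfold hardyRamanujan; positivity

lemma abs_card_partition_sub_le_of_saddlePoint : ∃ C : ℝ, 0 ≤ C ∧ ∀ n : ℕ, 0 < n →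
    saddlePoint n ≤ 1 / 2 →
      |(Fintype.card n.Partition : ℝ) - hardyRamanujan n| ≤
        C * saddlePoint n * hardyRamanujan n := by
  obtain ⟨C, hC, h⟩ := abs_integral_saddle_sub_le
  refine ⟨3 * C, by positivity, fun n hn ht1 => ?_⟩
  have hn' : (0 : ℝ) < n := by exact_mod_cast hn
  have ht := saddlePoint_pos hn'
  have h1 := h n _ ht ht1 (mul_saddlePoint hn')
  have hHR := hardyRamanujan_eq hn'
  set t := saddlePoint (n : ℝ) with htdef
  have hπ := Real.pi_pos
  set Q := Real.sqrt (Real.pi / (Real.pi ^ 2 / (6 * t))) with hQ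
  have hS := saddleSize_pos ht
  -- Q = √(6t/π) dominates t, so the far contribution C t² is absorbed into C t Q.
  have hQ1 : t ≤ Q := by
    rw [hQ]
    refine Real.le_sqrt_of_sq_le ?_
    have : Real.pi / (Real.pi ^ 2 / (6 * t)) = 6 * t / Real.pi := by field_simp
    rw [this, le_div_iff₀ hπ]
    nlinarith [Real.pi_lt_four]
  have hQ2 : Real.sqrt (Real.pi / (Real.pi ^ 2 / (6 * t) / 2)) ≤ 2 * Q := by
    have e : Real.pi / (Real.pi ^ 2 / (6 * t) / 2) = 2 * (Real.pi / (Real.pi ^ 2 / (6 * t))) := by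
      field_simp
    rw [e, Real.sqrt_mul (by norm_num)]
    gcongr
    rw [Real.sqrt_le_left (by norm_num)]
    norm_num
  have h2 : saddleSize t * (C * t * Real.sqrt (Real.pi / (Real.pi ^ 2 / (6 * t) / 2)) + C * t ^ 2) ≤
      saddleSize t * (3 * C * t * Q) := by
    gcongr
    have e1 : C * t * Real.sqrt (Real.pi / (Real.pi ^ 2 / (6 * t) / 2)) ≤ C * t * (2 * Q) := by
      gcongr
    have e2 : C * t * t ≤ C * t * Q := by gcongr
    nlinarith
  have h3 : (Fintype.card n.Partition : ℝ) - hardyRamanujan n = t / (2 * Real.pi) *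
      ((Fintype.card n.Partition : ℝ) * (2 * Real.pi / t) - saddleSize t * Q) := by
    rw [mul_sub, hHR]
    field_simp
  rw [h3, abs_mul, abs_of_pos (by positivity), ← hHR]
  calc t / (2 * Real.pi) * _ ≤ t / (2 * Real.pi) * (saddleSize t * (3 * C * t * Q)) := by
        gcongr
        exact h1.trans h2
    _ = _ := by ring

/-- The Hardy–Ramanujan formula with its error term. -/
lemma abs_card_partition_sub_le : ∃ C : ℝ, 0 ≤ C ∧ ∀ n : ℕ, 0 < n →
    |(Fintype.card n.Partition : ℝ) - hardyRamanujan n| ≤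
      C * saddlePoint n * hardyRamanujan n := by
  obtain ⟨C, hC, h⟩ := abs_card_partition_sub_le_of_saddlePoint
  set D : ℕ → ℝ := fun n => |(Fintype.card n.Partition : ℝ) - hardyRamanujan n| /
    (saddlePoint n * hardyRamanujan n) with hD
  have hDnn : ∀ n : ℕ, 0 < n → 0 ≤ D n := fun n hn => by
    have hn' : (0 : ℝ) < n := by exact_mod_cast hn
    have := saddlePoint_pos hn'
    have := hardyRamanujan_pos hn'
    positivity
  have hsum : 0 ≤ ∑ n ∈ Finset.Icc 1 7, D n :=
    Finset.sum_nonneg fun n hn => hDnn n (Finset.mem_Icc.1 hn).1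
  refine ⟨C + ∑ n ∈ Finset.Icc 1 7, D n, by positivity, fun n hn => ?_⟩
  have hn' : (0 : ℝ) < n := by exact_mod_cast hn
  have ht := saddlePoint_pos hn'
  have ha := hardyRamanujan_pos hn'
  -- For n ≥ 8 one has √(6n) ≥ 2π, that is t ≤ 1/2; the finitely many smaller n are absorbed into
  -- the constant.
  rcases Nat.lt_or_ge 7 n with h7 | h7
  · have h8 : (8 : ℝ) ≤ n := by exact_mod_cast h7
    have hs : saddlePoint n ≤ 1 / 2 := by
      have hs6 : 2 * Real.pi ≤ Real.sqrt (6 * n) := by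
        refine Real.le_sqrt_of_sq_le ?_
        nlinarith [Real.pi_lt_d2, Real.pi_gt_three]
      rw [saddlePoint, div_le_div_iff₀ (by positivity) (by norm_num)]
      linarith
    refine (h n hn hs).trans ?_
    gcongr
    linarith
  · have h9 : D n ≤ ∑ n ∈ Finset.Icc 1 7, D n :=
      Finset.single_le_sum (fun m hm => hDnn m (Finset.mem_Icc.1 hm).1)
        (Finset.mem_Icc.2 ⟨hn, h7⟩)
    have h10 : |(Fintype.card n.Partition : ℝ) - hardyRamanujan n| =
        D n * (saddlePoint n * hardyRamanujan n) := by
      rw [hD]; field_simp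
    rw [h10, mul_assoc]
    gcongr
    linarith

/-! ### Shifting the argument: p(n - m) uniformly in m -/

lemma mul_saddlePoint_sq {x : ℝ} (hx : 0 < x) : x * saddlePoint x ^ 2 = Real.pi ^ 2 / 6 := by
  have ht := saddlePoint_pos hx
  rw [sq, ← mul_assoc, mul_saddlePoint hx]
  field_simp

lemma saddlePoint_le_two {x : ℝ} (hx : 1 ≤ x) : saddlePoint x ≤ 2 := by
  have h0 : 0 < x := by linarith
  have ht := saddlePoint_pos h0
  have h := mul_saddlePoint_sq h0
  nlinarith [Real.pi_lt_d2, Real.pi_gt_three]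

lemma saddlePoint_le_two_mul {x y : ℝ} (hx : 0 < x) (hxy : x / 2 ≤ y) :
    saddlePoint y ≤ 2 * saddlePoint x := by
  have hy : 0 < y := by linarith
  have h1 := saddlePoint_pos hx
  have h2 := saddlePoint_pos hy
  have h3 := mul_saddlePoint_sq hx
  have h4 := mul_saddlePoint_sq hy
  refine le_of_sq_le_sq ?_ (by positivity)
  nlinarith [mul_le_mul_of_nonneg_right hxy (sq_nonneg (saddlePoint y)), sq_nonneg (saddlePoint x)]

/-- The tangent line of the concave function `y ↦ π √(2 y / 3)` at `x` lies above it. -/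
lemma sqrt_sub_le {x m : ℝ} (hx : 0 < x) (hm : m ≤ x) :
    Real.pi * Real.sqrt (2 * (x - m) / 3) ≤
      Real.pi * Real.sqrt (2 * x / 3) - saddlePoint x * m := by
  have e := two_mul_mul_saddlePoint hx
  have ht := saddlePoint_pos hx
  have h3 := mul_saddlePoint_sq hx
  have hπ := Real.pi_pos
  rw [← e]
  refine abs_le_of_sq_le_sq' ?_ (by nlinarith) |>.2
  rw [mul_pow, Real.sq_sqrt (by linarith)]
  have h5 : Real.pi ^ 2 = 6 * (x * saddlePoint x ^ 2) := by linarith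
  rw [h5]
  nlinarith [sq_nonneg (saddlePoint x * m)]

/-- Since x t² = π²/6 > 1, the subtracted term is at least t m²/x. The rest reduces to (x-m)(2x+m)²
≤ 4x³, whose two sides differ by 3xm² + m³. -/
lemma le_sqrt_sub {x m : ℝ} (hx : 0 < x) (hm0 : 0 ≤ m) (hm : m ≤ x) :
    Real.pi * Real.sqrt (2 * x / 3) - saddlePoint x * m -
      saddlePoint x * (saddlePoint x * m) ^ 2 ≤ Real.pi * Real.sqrt (2 * (x - m) / 3) := by
  have e := two_mul_mul_saddlePoint hx
  have ht := saddlePoint_pos hx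
  have h3 := mul_saddlePoint_sq hx
  have hπ := nine_lt_pi_sq
  have hπ0 := Real.pi_pos
  rw [← e]
  set t := saddlePoint x with htd
  have h5 : Real.pi ^ 2 = 6 * (x * t ^ 2) := by linarith
  have hb : t * (m ^ 2 / x) ≤ t * (t * m) ^ 2 := by
    refine mul_le_mul_of_nonneg_left ?_ ht.le
    rw [div_le_iff₀ hx]
    nlinarith [sq_nonneg m]
  refine le_trans (sub_le_sub_left hb _) ?_
  have h6 : Real.pi * Real.sqrt (2 * (x - m) / 3) =
      Real.sqrt ((2 * t) ^ 2 * (x * (x - m))) := by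
    conv_lhs => rw [← Real.sqrt_sq hπ0.le, ← Real.sqrt_mul (sq_nonneg _), h5]
    congr 1; ring
  rw [h6]
  refine Real.le_sqrt_of_sq_le ?_
  have h7 : 2 * (x * t) - t * m - t * (m ^ 2 / x) = t / x * ((x - m) * (2 * x + m)) := by
    field_simp; ring
  have h8 : (x - m) * (2 * x + m) ^ 2 ≤ 4 * x ^ 3 := by
    have : 0 ≤ x * m ^ 2 := by positivity
    have : 0 ≤ m ^ 3 := by positivity
    nlinarith
  rw [h7, show (2 * t) ^ 2 * (x * (x - m)) = (t / x) ^ 2 * ((x - m) * (4 * x ^ 3)) by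
    field_simp; ring, mul_pow]
  refine mul_le_mul_of_nonneg_left ?_ (sq_nonneg _)
  calc ((x - m) * (2 * x + m)) ^ 2 = (x - m) * ((x - m) * (2 * x + m) ^ 2) := by ring
    _ ≤ _ := mul_le_mul_of_nonneg_left h8 (by linarith)

lemma hardyRamanujan_mul (x : ℝ) (hx : 0 < x) :
    4 * Real.sqrt 3 * x * hardyRamanujan x = Real.exp (Real.pi * Real.sqrt (2 * x / 3)) := by
  unfold hardyRamanujan
  field_simp

lemma hardyRamanujan_le_exp {x : ℝ} (hx : 1 ≤ x) :
    hardyRamanujan x ≤ Real.exp (Real.pi * Real.sqrt (2 * x / 3)) := by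
  have h := hardyRamanujan_pos (show 0 < x by linarith)
  rw [← hardyRamanujan_mul x (by linarith)]
  refine le_mul_of_one_le_left h.le ?_
  have : 1 ≤ Real.sqrt 3 := Real.one_le_sqrt.2 (by norm_num)
  nlinarith

/-- Shifting the argument of the Hardy–Ramanujan main term. -/
lemma abs_hardyRamanujan_sub_le {x m : ℝ} (hx : 0 < x) (hm0 : 0 ≤ m) (hm : m ≤ x / 2) :
    |hardyRamanujan (x - m) - hardyRamanujan x * Real.exp (-(saddlePoint x * m))| ≤
      hardyRamanujan x * Real.exp (-(saddlePoint x * m)) *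
        (saddlePoint x * (2 * (saddlePoint x * m) + (saddlePoint x * m) ^ 2)) := by
  have hy : 0 < x - m := by linarith
  have h1 := sqrt_sub_le hx (show m ≤ x by linarith)
  have h2 := le_sqrt_sub hx hm0 (show m ≤ x by linarith)
  have h3 := mul_saddlePoint_sq hx
  have hπ := nine_lt_pi_sq
  have ha := hardyRamanujan_pos hx
  have hex := hardyRamanujan_mul x hx
  have hey := hardyRamanujan_mul _ hy
  have ht := saddlePoint_pos hx
  set t := saddlePoint x
  set w := t * m with hw
  have hw0 : 0 ≤ w := by positivity
  set r := Real.exp (Real.pi * Real.sqrt (2 * (x - m) / 3) -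
    (Real.pi * Real.sqrt (2 * x / 3) - w)) with hr
  have hr1 : r ≤ 1 := Real.exp_le_one_iff.2 (by linarith)
  have hr0 : 0 < r := Real.exp_pos _
  have hr2 : 1 - t * w ^ 2 ≤ r := by
    refine le_trans ?_ (Real.add_one_le_exp _)
    linarith
  have e : hardyRamanujan (x - m) = hardyRamanujan x * Real.exp (-w) * (x / (x - m) * r) := by
    have h5 : Real.exp (Real.pi * Real.sqrt (2 * (x - m) / 3)) =
        Real.exp (Real.pi * Real.sqrt (2 * x / 3)) * Real.exp (-w) * r := by
      rw [hr, ← Real.exp_add, ← Real.exp_add]; congr 1; ring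
    rw [← hex, ← hey] at h5
    have h6 : 0 < Real.sqrt 3 := by positivity
    field_simp
    refine mul_left_cancel₀ (show 4 * Real.sqrt 3 ≠ 0 by positivity) ?_
    linarith
  rw [e, ← mul_sub_one, abs_mul, abs_of_pos (by positivity)]
  refine mul_le_mul_of_nonneg_left ?_ (by positivity)
  -- The quotient m/(x-m) is at most 2m/x because m ≤ x/2, and 1/x ≤ t² because x t² > 1.
  have hq : x / (x - m) - 1 ≤ 2 * t * w := by
    rw [div_sub_one hy.ne', div_le_iff₀ hy, hw]
    have h7 : m * (x * t ^ 2) ≤ 2 * m * t ^ 2 * (x - m) := by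
      nlinarith [mul_nonneg hm0 (sq_nonneg t)]
    nlinarith
  have hq0 : 0 ≤ x / (x - m) - 1 := by
    rw [div_sub_one hy.ne']; exact div_nonneg (by linarith) hy.le
  rw [abs_le]
  constructor <;> nlinarith

lemma card_partition_le_exp : ∃ K : ℝ, 0 ≤ K ∧ ∀ n : ℕ,
    (Fintype.card n.Partition : ℝ) ≤ K * Real.exp (Real.pi * Real.sqrt (2 * n / 3)) := by
  obtain ⟨C, hC, h⟩ := abs_card_partition_sub_le
  refine ⟨1 + 2 * C, by positivity, fun n => ?_⟩
  rcases Nat.eq_zero_or_pos n with rfl | hn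
  · have : Fintype.card (Nat.Partition 0) = 1 := Fintype.card_unique
    rw [this]
    simp
    linarith
  · have hn' : (1 : ℝ) ≤ n := by exact_mod_cast hn
    have h1 := (abs_le.1 (h n hn)).2
    have h2 := saddlePoint_le_two hn'
    have h3 := hardyRamanujan_le_exp hn'
    have h4 := hardyRamanujan_pos (show (0 : ℝ) < n by linarith)
    calc (Fintype.card n.Partition : ℝ) ≤ (1 + C * saddlePoint n) * hardyRamanujan n := by linarith
      _ ≤ (1 + 2 * C) * hardyRamanujan n := by gcongr ?_ * _; nlinarith
      _ ≤ _ := by gcongr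

lemma one_add_pow_three_le {w : ℝ} (hw : 0 ≤ w) : (1 + w) ^ 3 ≤ 216 * Real.exp (w / 2) := by
  have h1 : 1 + w ≤ 6 * Real.exp (w / 6) := by linarith [Real.add_one_le_exp (w / 6)]
  calc (1 + w) ^ 3 ≤ (6 * Real.exp (w / 6)) ^ 3 := by gcongr
    _ = 216 * Real.exp (w / 2) := by
      rw [mul_pow, ← Real.exp_nat_mul]; norm_num; ring_nf

lemma abs_card_partition_sub_le_of_le_half : ∃ C : ℝ, 0 ≤ C ∧ ∀ n m : ℕ, 0 < n →
    (m : ℝ) ≤ n / 2 →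
    |(Fintype.card (n - m).Partition : ℝ) -
        hardyRamanujan n * Real.exp (-(saddlePoint n * m))| ≤
      C * saddlePoint n * (hardyRamanujan n * Real.exp (-(saddlePoint n * m))) *
        (1 + saddlePoint n * m) ^ 3 := by
  obtain ⟨C, hC, h⟩ := abs_card_partition_sub_le
  refine ⟨2 + 8 * C, by positivity, fun n m hn hm => ?_⟩
  have hn' : (0 : ℝ) < n := by exact_mod_cast hn
  have hmn : m < n := by
    have : (m : ℝ) < n := by linarith
    exact_mod_cast this
  have h1 := h (n - m) (by omega)
  rw [Nat.cast_sub hmn.le] at h1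
  have h2 := abs_hardyRamanujan_sub_le hn' (Nat.cast_nonneg m) hm
  have h3 := saddlePoint_le_two_mul hn' (show (n : ℝ) / 2 ≤ n - m by linarith)
  have ht := saddlePoint_pos hn'
  have hty := saddlePoint_pos (show (0 : ℝ) < n - m by linarith)
  have hay := hardyRamanujan_pos (show (0 : ℝ) < n - m by linarith)
  have ha := hardyRamanujan_pos hn'
  have h5 := saddlePoint_le_two (show (1 : ℝ) ≤ n by exact_mod_cast hn)
  have hm0 : (0 : ℝ) ≤ m := Nat.cast_nonneg m
  set t := saddlePoint (n : ℝ)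
  set w := t * m with hw
  have hw0 : 0 ≤ w := by positivity
  set A := hardyRamanujan n * Real.exp (-w)
  have hA : 0 < A := by positivity
  have hay2 : hardyRamanujan ((n : ℝ) - m) ≤ A * (4 * (1 + w) ^ 3) := by
    have h6 := (abs_le.1 h2).2
    have h7 : t * (2 * w + w ^ 2) ≤ 2 * (2 * w + w ^ 2) := by gcongr
    have h8 : 1 + 2 * (2 * w + w ^ 2) ≤ 4 * (1 + w) ^ 3 := by
      nlinarith [pow_nonneg hw0 3, pow_nonneg hw0 2]
    calc hardyRamanujan ((n : ℝ) - m) ≤ A * (1 + t * (2 * w + w ^ 2)) := by linarith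
      _ ≤ _ := by gcongr; linarith
  have h9 : 2 * w + w ^ 2 ≤ 2 * (1 + w) ^ 3 := by
    nlinarith [pow_nonneg hw0 3, pow_nonneg hw0 2]
  calc |(Fintype.card (n - m).Partition : ℝ) - A| ≤
        C * saddlePoint ((n : ℝ) - m) * hardyRamanujan ((n : ℝ) - m) +
          A * (t * (2 * w + w ^ 2)) :=
        (abs_sub_le _ (hardyRamanujan ((n : ℝ) - m)) _).trans (add_le_add h1 h2)
    _ ≤ C * (2 * t) * (A * (4 * (1 + w) ^ 3)) + A * (t * (2 * (1 + w) ^ 3)) := by gcongr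
    _ = (2 + 8 * C) * t * A * (1 + w) ^ 3 := by ring

/-- For such large shifts no cancellation is needed: both terms are bounded separately. The crude
bound on p(n - m) loses a factor n, which the polynomial weight in w = tm recovers. -/
lemma abs_card_partition_sub_le_of_half_lt : ∃ C : ℝ, 0 ≤ C ∧ ∀ n m : ℕ, 0 < n →
    (n : ℝ) / 2 ≤ m →
    |(if m ≤ n then (Fintype.card (n - m).Partition : ℝ) else 0) -
        hardyRamanujan n * Real.exp (-(saddlePoint n * m))| ≤
      C * saddlePoint n * (hardyRamanujan n * Real.exp (-(saddlePoint n * m))) *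
        (1 + saddlePoint n * m) ^ 3 := by
  obtain ⟨K, hK, h⟩ := card_partition_le_exp
  refine ⟨128 * K + 2, by positivity, fun n m hn hm => ?_⟩
  have hn' : (0 : ℝ) < n := by exact_mod_cast hn
  have ht := saddlePoint_pos hn'
  have ha := hardyRamanujan_pos hn'
  have h1 := mul_saddlePoint_sq hn'
  have hp : (if m ≤ n then (Fintype.card (n - m).Partition : ℝ) else 0) ≤
      K * (8 * n * (hardyRamanujan n * Real.exp (-(saddlePoint n * m)))) := by
    split_ifs with hmn
    · have h2 := h (n - m)
      rw [Nat.cast_sub hmn] at h2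
      have h3 := sqrt_sub_le hn' (show (m : ℝ) ≤ n by exact_mod_cast hmn)
      refine h2.trans (mul_le_mul_of_nonneg_left ?_ hK)
      refine (Real.exp_le_exp.2 h3).trans ?_
      rw [sub_eq_add_neg, Real.exp_add, ← hardyRamanujan_mul _ hn', ← mul_assoc]
      gcongr
      have : Real.sqrt 3 ≤ 2 := by rw [Real.sqrt_le_left (by norm_num)]; norm_num
      linarith
    · positivity
  have hp0 : 0 ≤ (if m ≤ n then (Fintype.card (n - m).Partition : ℝ) else 0) := by
    split_ifs <;> positivity
  set p := (if m ≤ n then (Fintype.card (n - m).Partition : ℝ) else 0)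
  set t := saddlePoint (n : ℝ)
  set w := t * m with hw
  have hm0 : (0 : ℝ) ≤ m := Nat.cast_nonneg m
  have hw0 : 0 ≤ w := by positivity
  set A := hardyRamanujan n * Real.exp (-w)
  have hA : 0 < A := by positivity
  have hπ := nine_lt_pi_sq
  have hπ2 : Real.pi ^ 2 / 6 ≤ 2 := by nlinarith [Real.pi_lt_d2, Real.pi_gt_three]
  -- t w = t² m ≥ t² n/2 = π²/12 > 1/2. Cubing this and using n t² ≤ 2 gives n ≤ 16 t w³ below.
  have htw : 1 ≤ 2 * (t * w) := by
    rw [hw]; nlinarith [mul_le_mul_of_nonneg_right hm (sq_nonneg t)]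
  have hn2 : (n : ℝ) ≤ 16 * t * w ^ 3 := by
    have h3 : 1 ≤ (2 * (t * w)) ^ 3 := one_le_pow₀ htw
    have h4 : (n : ℝ) * t ^ 2 ≤ (16 * t * w ^ 3) * t ^ 2 := by nlinarith
    exact le_of_mul_le_mul_right h4 (by positivity)
  have hw3 : w ^ 3 ≤ (1 + w) ^ 3 := by gcongr; linarith
  have hw1 : w ≤ (1 + w) ^ 3 := by nlinarith [pow_nonneg hw0 3, pow_nonneg hw0 2]
  have h5 : p ≤ 128 * K * t * A * (1 + w) ^ 3 :=
    calc p ≤ K * (8 * n * A) := hp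
      _ ≤ K * (8 * (16 * t * (1 + w) ^ 3) * A) := by
        gcongr
        exact hn2.trans (by gcongr)
      _ = _ := by ring
  have h6 : A ≤ 2 * t * A * (1 + w) ^ 3 :=
    calc A ≤ A * (2 * (t * w)) := le_mul_of_one_le_right hA.le htw
      _ ≤ A * (2 * (t * (1 + w) ^ 3)) := by gcongr
      _ = _ := by ring
  rw [abs_le]
  constructor
  · nlinarith
  · nlinarith

/-- The shifted Hardy–Ramanujan formula, uniformly in the shift. -/
lemma abs_card_partition_shift_sub_le : ∃ C : ℝ, 0 ≤ C ∧ ∀ n m : ℕ, 0 < n →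
    |(if m ≤ n then (Fintype.card (n - m).Partition : ℝ) else 0) -
        hardyRamanujan n * Real.exp (-saddlePoint n) ^ m| ≤
      C * saddlePoint n * hardyRamanujan n * Real.exp (-(saddlePoint n / 2)) ^ m := by
  obtain ⟨C₁, hC₁, h₁⟩ := abs_card_partition_sub_le_of_le_half
  obtain ⟨C₂, hC₂, h₂⟩ := abs_card_partition_sub_le_of_half_lt
  -- The factor 216 is the cost of absorbing (1+w)³ into e^{w/2}, which weakens the decay from
  -- e^{-tm} to e^{-tm/2}.
  refine ⟨216 * (C₁ + C₂), by positivity, fun n m hn => ?_⟩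
  have hn' : (0 : ℝ) < n := by exact_mod_cast hn
  have ht := saddlePoint_pos hn'
  have ha := hardyRamanujan_pos hn'
  have e1 : Real.exp (-saddlePoint n) ^ m = Real.exp (-(saddlePoint n * m)) := by
    rw [← Real.exp_nat_mul]; congr 1; ring
  have e2 : Real.exp (-(saddlePoint n / 2)) ^ m =
      Real.exp (-(saddlePoint n * m)) * Real.exp (saddlePoint n * m / 2) := by
    rw [← Real.exp_nat_mul, ← Real.exp_add]; congr 1; ring
  have hm : |(if m ≤ n then (Fintype.card (n - m).Partition : ℝ) else 0) -
        hardyRamanujan n * Real.exp (-(saddlePoint n * m))| ≤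
      (C₁ + C₂) * saddlePoint n * (hardyRamanujan n * Real.exp (-(saddlePoint n * m))) *
        (1 + saddlePoint n * m) ^ 3 := by
    rcases le_total (m : ℝ) (n / 2) with hmn | hmn
    · have hle : m ≤ n := by
        have : (m : ℝ) ≤ n := by linarith
        exact_mod_cast this
      rw [if_pos hle]
      refine (h₁ n m hn hmn).trans ?_
      gcongr
      linarith
    · refine (h₂ n m hn hmn).trans ?_
      gcongr
      linarith
  rw [e1, e2]
  refine hm.trans ?_
  calc _ ≤ (C₁ + C₂) * saddlePoint n * (hardyRamanujan n * Real.exp (-(saddlePoint n * m))) *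
        (216 * Real.exp (saddlePoint n * m / 2)) := by
        gcongr
        exact one_add_pow_three_le (by positivity)
    _ = _ := by ring

/-! ### Asymptotics of the moments -/

lemma abs_moment_sub_bellValue_le (k : ℕ) : ∃ C : ℝ, 0 ≤ C ∧ ∀ n : ℕ, 0 < n →
    |(moment k n : ℝ) - hardyRamanujan n * bellValue k (saddlePoint n)| ≤
      C * saddlePoint n * hardyRamanujan n * bellValue k (saddlePoint n / 2) := by
  obtain ⟨C, hC, h⟩ := abs_card_partition_shift_sub_le
  refine ⟨C, hC, fun n hn => ?_⟩
  have hn' : (0 : ℝ) < n := by exact_mod_cast hn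
  have ht := saddlePoint_pos hn'
  have h1 := ((absHasSum_bellSeries k ht).2).mul_left (hardyRamanujan n)
  have h2 := ((absHasSum_bellSeries k (half_pos ht)).2).mul_left
    (C * saddlePoint n * hardyRamanujan n)
  have h3 : HasSum (fun m => PowerSeries.coeff m (bellSeries k) *
      (if m ≤ n then (Fintype.card (n - m).Partition : ℝ) else 0)) (moment k n : ℝ) := by
    rw [moment_eq_sum_bellSeries]
    have e : ∑ m ∈ Finset.range (n + 1), PowerSeries.coeff m (bellSeries k) *
        (Fintype.card (n - m).Partition : ℝ) = ∑ m ∈ Finset.range (n + 1),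
        PowerSeries.coeff m (bellSeries k) *
          (if m ≤ n then (Fintype.card (n - m).Partition : ℝ) else 0) :=
      Finset.sum_congr rfl fun m hm => by
        rw [if_pos (Nat.lt_succ_iff.1 (Finset.mem_range.1 hm))]
    rw [e]
    refine hasSum_sum_of_ne_finset_zero fun m hm => ?_
    rw [if_neg (by simpa using hm), mul_zero]
  have h4 := (h3.sub h1).norm_le_of_bounded h2 fun m => by
    have hc := coeff_bellSeries_nonneg k m
    rw [Real.norm_eq_abs, mul_left_comm, ← mul_sub, abs_mul, abs_of_nonneg hc, mul_left_comm]
    exact mul_le_mul_of_nonneg_left (h n m hn) hc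
  exact h4

lemma abs_moment_sub_bellPoly_le (k : ℕ) : ∃ C : ℝ, 0 ≤ C ∧ ∀ n : ℕ, 0 < n →
    saddlePoint n ≤ Real.exp (-1) →
    |(moment k n : ℝ) -
        hardyRamanujan n * ((saddlePoint n)⁻¹ ^ k * bellPoly (zetaArg (saddlePoint n)) k)| ≤
      C * saddlePoint n *
        (hardyRamanujan n * ((saddlePoint n)⁻¹ ^ k * bellPoly (zetaArg (saddlePoint n)) k)) := by
  obtain ⟨C₀, hC₀, h₀⟩ := abs_moment_sub_bellValue_le k
  obtain ⟨C₁, hC₁, h₁⟩ := abs_bellValue_sub_le k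
  obtain ⟨C₂, hC₂, h₂⟩ := bellValue_half_le k
  refine ⟨C₀ * C₂ + C₁, by positivity, fun n hn ht1 => ?_⟩
  have hn' : (0 : ℝ) < n := by exact_mod_cast hn
  have ht := saddlePoint_pos hn'
  have ha := hardyRamanujan_pos hn'
  have g0 := h₀ n hn
  have g1 := h₁ _ ht ht1
  have g2 := h₂ _ ht ht1
  set t := saddlePoint (n : ℝ)
  set a := hardyRamanujan (n : ℝ)
  set B := bellPoly (zetaArg t) k
  have htk : t⁻¹ ^ k * t ^ k = 1 := by rw [← mul_pow, inv_mul_cancel₀ ht.ne', one_pow]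
  have f1 : |a * bellValue k t - a * (t⁻¹ ^ k * B)| ≤ a * (t⁻¹ ^ k * (C₁ * t * B)) := by
    have : a * bellValue k t - a * (t⁻¹ ^ k * B) =
        a * (t⁻¹ ^ k * (t ^ k * bellValue k t - B)) := by
      rw [mul_sub (t⁻¹ ^ k), ← mul_assoc (t⁻¹ ^ k), htk]; ring
    rw [this, abs_mul, abs_mul, abs_of_pos ha, abs_of_pos (by positivity)]
    gcongr
  have f2 : bellValue k (t / 2) ≤ t⁻¹ ^ k * (C₂ * B) := by
    calc bellValue k (t / 2) = t⁻¹ ^ k * (t ^ k * bellValue k (t / 2)) := by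
          rw [← mul_assoc, htk, one_mul]
      _ ≤ _ := by gcongr
  calc _ ≤ C₀ * t * a * bellValue k (t / 2) + a * (t⁻¹ ^ k * (C₁ * t * B)) :=
        (abs_sub_le _ (a * bellValue k t) _).trans (add_le_add g0 f1)
    _ ≤ C₀ * t * a * (t⁻¹ ^ k * (C₂ * B)) + a * (t⁻¹ ^ k * (C₁ * t * B)) := by gcongr
    _ = _ := by ring

lemma saddlePoint_eq_rpow (n : ℕ) :
    saddlePoint n = Real.pi / Real.sqrt 6 * (n : ℝ) ^ (-(1 / 2) : ℝ) := by
  rw [saddlePoint, Real.sqrt_mul (by norm_num), Real.rpow_neg (Nat.cast_nonneg n),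
    ← Real.sqrt_eq_rpow, div_mul_eq_div_div, div_eq_mul_inv]

lemma tendsto_saddlePoint : Tendsto (fun n : ℕ => saddlePoint n) atTop (nhds 0) := by
  have h : Tendsto (fun n : ℕ => (n : ℝ) ^ (-(1 / 2) : ℝ)) atTop (nhds 0) :=
    (tendsto_rpow_neg_atTop (by norm_num)).comp tendsto_natCast_atTop_atTop
  simpa [saddlePoint_eq_rpow] using h.const_mul (Real.pi / Real.sqrt 6)

lemma bellSum_zetaArgs (k n : ℕ) :
    bellSum k (zetaArgs k n) = bellPoly (zetaArg (saddlePoint n)) k := by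
  unfold bellPoly
  congr 1
  funext i
  unfold zetaArgs zetaArg
  split_ifs
  · rw [saddlePoint, ← inv_div, Real.log_inv, sub_eq_add_neg]
  · rfl

lemma eqOneAddBigO_moment (k : ℕ) :
    EqOneAddBigO (fun n => (moment k n : ℝ))
      (fun n => 1 / (4 * Real.sqrt 3 * (n : ℝ)) *
        Real.exp (Real.pi * Real.sqrt (2 * (n : ℝ) / 3)) *
        (Real.sqrt (6 * (n : ℝ)) / Real.pi) ^ k * bellSum k (zetaArgs k n)) := by
  obtain ⟨C, hC, h⟩ := abs_moment_sub_bellPoly_le k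
  set g : ℕ → ℝ := fun n =>
    hardyRamanujan n * ((saddlePoint n)⁻¹ ^ k * bellPoly (zetaArg (saddlePoint n)) k) with hg
  have hgeq : (fun n : ℕ => 1 / (4 * Real.sqrt 3 * (n : ℝ)) *
        Real.exp (Real.pi * Real.sqrt (2 * (n : ℝ) / 3)) *
        (Real.sqrt (6 * (n : ℝ)) / Real.pi) ^ k * bellSum k (zetaArgs k n)) = g := by
    funext n
    rw [hg, bellSum_zetaArgs, mul_assoc, ← inv_div Real.pi]
    rfl
  rw [hgeq]
  have hev : ∀ᶠ n : ℕ in atTop, 0 < n ∧ saddlePoint n ≤ Real.exp (-1) :=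
    (eventually_gt_atTop 0).and (tendsto_saddlePoint.eventually_le_const (Real.exp_pos _))
  have hgpos : ∀ n : ℕ, 0 < n ∧ saddlePoint n ≤ Real.exp (-1) → 0 < g n := fun n hn => by
    have hn' : (0 : ℝ) < n := by exact_mod_cast hn.1
    have ht := saddlePoint_pos hn'
    have := hardyRamanujan_pos hn'
    have := bellPoly_pos (one_le_zetaArg ht hn.2) k
    positivity
  -- The relative error is a genuine quotient only once g n > 0, which holds as soon as t ≤ e^{-1};
  -- hence the eventual statements.
  refine ⟨fun n => (moment k n : ℝ) / g n - 1, ?_, ?_⟩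
  · refine IsBigO.of_bound (C * (Real.pi / Real.sqrt 6)) ?_
    filter_upwards [hev] with n hn
    have hp := hgpos n hn
    have h1 := h n hn.1 hn.2
    rw [Real.norm_eq_abs, Real.norm_of_nonneg (by positivity), mul_assoc, ← saddlePoint_eq_rpow,
      div_sub_one hp.ne', abs_div, abs_of_pos hp, div_le_iff₀ hp]
    exact h1
  · filter_upwards [hev] with n hn
    have hp := hgpos n hn
    field_simp
    ring

lemma sqrt_two_div_eq (n : ℕ) :
    Real.sqrt 2 / (4 * Real.pi * Real.sqrt (n : ℝ)) =
      1 / (4 * Real.sqrt 3 * (n : ℝ)) * (Real.sqrt (6 * (n : ℝ)) / Real.pi) := by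
  rcases Nat.eq_zero_or_pos n with rfl | hn
  · simp
  have hn' : (0 : ℝ) < n := by exact_mod_cast hn
  have h1 := Real.sq_sqrt hn'.le
  have h3 := Real.sq_sqrt (show (0 : ℝ) ≤ 3 by norm_num)
  have h6 : Real.sqrt (6 * n) = Real.sqrt 2 * Real.sqrt 3 * Real.sqrt n := by
    rw [← Real.sqrt_mul (by norm_num), ← Real.sqrt_mul (by norm_num)]; norm_num
  have hπ := Real.pi_pos
  have hs : 0 < Real.sqrt n := by positivity
  rw [h6]
  field_simp
  linarith

lemma bellSum_one (x : Fin 1 → ℝ) : bellSum 1 x = x 0 := by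
  have h := bellPoly_succ (fun _ => x 0) 0
  have e : (fun _ : Fin 1 => x 0) = x := funext fun i => by rw [Subsingleton.elim i 0]
  simp only [zero_add, Finset.sum_range_one, Nat.choose_self, Nat.cast_one, one_mul, tsub_zero,
    bellPoly_zero, mul_one] at h
  rwa [bellPoly, e] at h

end PartitionMoments

theorem mainTheorem8 :
    PartitionMoments.EqOneAddBigO
      (fun n => (PartitionMoments.moment 1 n : ℝ))
      (fun n => Real.sqrt 2 / (4 * Real.pi * Real.sqrt (n : ℝ)) *
        Real.exp (Real.pi * Real.sqrt (2 * (n : ℝ) / 3)) *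
        (Real.eulerMascheroniConstant + Real.log (Real.sqrt (6 * (n : ℝ)) / Real.pi))) ∧
    ∀ k : ℕ, 2 ≤ k →
      PartitionMoments.EqOneAddBigO
        (fun n => (PartitionMoments.moment k n : ℝ))
        (fun n => 1 / (4 * Real.sqrt 3 * (n : ℝ)) *
          Real.exp (Real.pi * Real.sqrt (2 * (n : ℝ) / 3)) *
          (Real.sqrt (6 * (n : ℝ)) / Real.pi) ^ k *
          PartitionMoments.bellSum k (PartitionMoments.zetaArgs k n)) := by
  refine ⟨?_, fun k _ => PartitionMoments.eqOneAddBigO_moment k⟩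
  have h := PartitionMoments.eqOneAddBigO_moment 1
  convert h using 2 with n
  rw [PartitionMoments.sqrt_two_div_eq, PartitionMoments.bellSum_one, pow_one,
    PartitionMoments.zetaArgs, if_pos (by simp)]
  ring
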